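/- Let $G$ be a Lie group and $P\subset G$ a closed subgroup, with Lie algebras $\mathfrak g,\mathfrak p$. A \emph{Cartan geometry of type $(G,P)$} on a smooth manifold $M$ is a smooth principal $P$-bundle $p:\mathcal G\to M$ with a one-form $\omega\in\Omega^1(\mathcal G,\mathfrak g)$ which is $P$-equivariant, $\omega_{u\cdot b}(T_ur^b\,\xi)=\mathrm{Ad}(b^{-1})\omega_u(\xi)$, satisfies $\omega(\zeta_Y)=Y$ for the fundamental vector fields $\zeta_Y$, $Y\in\mathfrak p$, and is a linear isomorphism $\omega_u:T_u\mathcal G\to\mathfrak g$ for all $u\in\mathcal G$. Its curvature is $K(\xi,\eta)=d\omega(\xi,\eta)+[\omega(\xi),\omega(\eta)]$, its curvature function is $\kappa(u)(X,Y)=K(\omega_u^{-1}(X),\omega_u^{-1}(Y))$ for $X,Y\in\mathfrak g$, and it is \emph{torsion-free} if $K$ has values in $\mathfrak p$. The form $\omega$ extends uniquely to a $G$-principal connection $\hat\omega$ on $\hat{\mathcal G}=\mathcal G\times_PG$. Let $\mathcal O$ be a homogeneous space of $G$. A \emph{holonomy reduction of type $\mathcal O$} is a parallel section of $\mathcal G\times_P\mathcal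 O=\hat{\mathcal G}\times_G\mathcal O$, i.e. a smooth $G$-equivariant map $s:\hat{\mathcal G}\to\mathcal O$, $s(\hat u\cdot g)=g^{-1}\cdot s(\hat u)$, whose derivative vanishes on the $\hat\omega$-horizontal vectors. The \emph{$P$-type} of $x\in M$ is the $P$-orbit $s(\mathcal G_x)\subset\mathcal O$. For a $P$-orbit $i\subset\mathcal O$ the \emph{curved orbit} $M_i\subset M$ is the set of all points of $P$-type $i$. For $\alpha\in\mathcal O$ let $G_\alpha$ be its stabiliser, $\mathfrak g_\alpha$ the Lie algebra of $G_\alpha$, and $P_\alpha=G_\alpha\cap P$. A subset of $M$ is an \emph{initial submanifold} if it is the image of an injective immersion $j:N\to M$ of a manifold $N$ such that any map $f$ from a manifold to $N$ is smooth as soon as $j\circ f$ is smooth. \textbf{Theorem.} Let $(\mathcal G\to M,\omega)$ be a Cartan geometry of type $(G,P)$ with a holonomy reduction $s$ of type $\mathcal O$, and let $i\subset\mathcal O$ be a $P$-orbit such that $M_i\neq\emptyset$. (i) For each $\alpha\in i$ and each $x\in M_i$ there are open neighbourhoods $N$ of $x$ in $M$ and $N'$ of $eP$ in $G/P$ and a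 diffeomorphism $\varphi:N\to N'$ with $\varphi(x)=eP$ and $\varphi(M_i\cap N)=(G_\alpha\cdot eP)\cap N'$. In particular, $M_i$ is an initial submanifold of $M$. (ii) $M_i$ carries a canonical Cartan geometry: for each $\alpha\in i$ there is a Cartan geometry $(\mathcal G_\alpha\to M_i,\omega_\alpha)$ of type $(G_\alpha,P_\alpha)$ and a $P_\alpha$-equivariant embedding $\mathbf j_\alpha:\mathcal G_\alpha\to\mathcal G|_{M_i}$ over $M_i$, with image $\{u\in\mathcal G: s(u)=\alpha\}$, such that $\mathbf j_\alpha^*\omega=\omega_\alpha$. These geometries do not depend on the choices: for $b\in P$ the principal right action of $b^{-1}$ on $\mathcal G$ induces a diffeomorphism $\mathcal G_\alpha\to\mathcal G_{b\cdot\alpha}$ over $M_i$, which is equivariant over the isomorphism $P_\alpha\to P_{b\cdot\alpha}$ given by conjugation by $b$ and compatible with $\omega_\alpha$ and $\omega_{b\cdot\alpha}$ via $\mathrm{Ad}(b):\mathfrak g_\alpha\to\mathfrak g_{b\cdot\alpha}$. (iii) The curvatures $K$ of $\omega$ and $K_\alpha$ of $\omega_\alpha$ satisfy $K_\alpha=\mathbf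 j_\alpha^*K$. In particular, if $\omega$ is torsion-free, so is $\omega_\alpha$. For the curvature functions $\kappa$ and $\kappa_\alpha$ and each $u\in\mathcal G_\alpha$, the restriction of $\kappa(\mathbf j_\alpha(u))$ to $\mathfrak g_\alpha$ descends to $\Lambda^2(\mathfrak g_\alpha/(\mathfrak g_\alpha\cap\mathfrak p))$, has values in $\mathfrak g_\alpha$, and coincides with $\kappa_\alpha(u)$. -/

import Mathlib

open scoped Manifold ContDiff Topology
open Set Topology

noncomputable section

namespace CurvedOrbit

universe uG uM uB uO v₁ v₂ v₃ v₄

/-! ### Forms, adjoint action, Lie subgroups, initial submanifolds -/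

section OneForms

variable {E : Type*} [NormedAddCommGroup E] [NormedSpace ℝ E]
  {B : Type*} [TopologicalSpace B] [ChartedSpace E B]
  {F : Type*} [NormedAddCommGroup F] [NormedSpace ℝ F]

/-- The expression of an `F`-valued one-form `θ` on the manifold `B` in the preferred chart `φ`
around `u`: the pullback of `θ` along `φ⁻¹`. -/
def formInChart (θ : ∀ u : B, TangentSpace 𝓘(ℝ, E) u →L[ℝ] F) (u : B) : E → E →L[ℝ] F :=
  fun x => (θ ((extChartAt 𝓘(ℝ, E) u).symm x)).comp
    (mfderiv 𝓘(ℝ, E) 𝓘(ℝ, E) (extChartAt 𝓘(ℝ, E) u).symm x)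

/-- The exterior derivative of an `F`-valued one-form on a manifold, computed in a chart:
`dθ(ξ, η) = (D_ξ θ)(η) - (D_η θ)(ξ)`. With this normalisation,
`dθ(X, Y) = X(θ(Y)) - Y(θ(X)) - θ([X, Y])` for vector fields. -/
def extDerivForm (θ : ∀ u : B, TangentSpace 𝓘(ℝ, E) u →L[ℝ] F) (u : B)
    (ξ η : TangentSpace 𝓘(ℝ, E) u) : F :=
  let dφ : TangentSpace 𝓘(ℝ, E) u → E := mfderiv 𝓘(ℝ, E) 𝓘(ℝ, E) (extChartAt 𝓘(ℝ, E) u) u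
  let D : E →L[ℝ] E →L[ℝ] F := fderiv ℝ (formInChart θ u) (extChartAt 𝓘(ℝ, E) u u)
  D (dφ ξ) (dφ η) - D (dφ η) (dφ ξ)

end OneForms

section LieGroups

variable {EG : Type*} [NormedAddCommGroup EG] [NormedSpace ℝ EG]
  {G : Type*} [Group G] [TopologicalSpace G] [ChartedSpace EG G]

variable (EG) in
/-- The adjoint action of `g` on the Lie algebra of `G`: the derivative at `1` of conjugation
by `g`. -/
def Ad (g : G) (X : GroupLieAlgebra 𝓘(ℝ, EG) G) : GroupLieAlgebra 𝓘(ℝ, EG) G :=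
  mfderiv 𝓘(ℝ, EG) 𝓘(ℝ, EG) (fun x : G => g * x * g⁻¹) 1 X

variable (EG) in
/-- The left Maurer-Cartan form of `G`: `T_g G → 𝔤` is the derivative of left translation
by `g⁻¹`. -/
def maurerCartan (g : G) (Z : TangentSpace 𝓘(ℝ, EG) g) : GroupLieAlgebra 𝓘(ℝ, EG) G :=
  mfderiv 𝓘(ℝ, EG) 𝓘(ℝ, EG) (fun x : G => g⁻¹ * x) g Z

/-- The given manifold structure on the subgroup `H` of `G` (for the subspace topology) is its
structure of a closed Lie subgroup. -/
structure IsClosedLieSubgroup (EG : Type*) [NormedAddCommGroup EG] [NormedSpace ℝ EG]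
    (EH : Type*) [NormedAddCommGroup EH] [NormedSpace ℝ EH]
    {G : Type*} [Group G] [TopologicalSpace G] [ChartedSpace EG G]
    (H : Subgroup G) [ChartedSpace EH H] : Prop where
  isClosed : IsClosed (H : Set G)
  lieGroup : LieGroup 𝓘(ℝ, EH) ∞ H
  isSmoothEmbedding :
    Manifold.IsSmoothEmbedding 𝓘(ℝ, EH) 𝓘(ℝ, EG) ∞ (Subtype.val : H → G)

/-- The inclusion of Lie algebras `𝔥 → 𝔤` for a Lie subgroup `H` of `G`: the derivative at `1` of
the inclusion `H → G`. -/
def lieInclusion (EG : Type*) [NormedAddCommGroup EG] [NormedSpace ℝ EG]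
    (EH : Type*) [NormedAddCommGroup EH] [NormedSpace ℝ EH]
    {G : Type*} [Group G] [TopologicalSpace G] [ChartedSpace EG G]
    (H : Subgroup G) [ChartedSpace EH H] (X : GroupLieAlgebra 𝓘(ℝ, EH) H) :
    GroupLieAlgebra 𝓘(ℝ, EG) G :=
  mfderiv 𝓘(ℝ, EH) 𝓘(ℝ, EG) (Subtype.val : H → G) 1 X

end LieGroups

section Initial

/-- A structure of initial submanifold on a subset `S` of a manifold `M`: a manifold `Carrier`
with an injective immersion onto `S` such that a map into `Carrier` is smooth as soon as it is
smooth as a map into `M`. As smoothness is local, it is enough to test this on maps which are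
defined on open subsets of the spaces `ℝⁿ`. Such a structure is unique up to a unique
diffeomorphism compatible with the inclusions. -/
structure InitialSubmanifold {EM : Type v₁} [NormedAddCommGroup EM] [NormedSpace ℝ EM]
    {M : Type uM} [TopologicalSpace M] [ChartedSpace EM M] (S : Set M) where
  dim : ℕ
  Carrier : Type uM
  [top : TopologicalSpace Carrier]
  [charted : ChartedSpace (EuclideanSpace ℝ (Fin dim)) Carrier]
  [isManifold : IsManifold (𝓡 dim) ∞ Carrier]
  [t2 : T2Space Carrier]
  [secondCountable : SecondCountableTopology Carrier]
  incl : Carrier → M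
  injective : Function.Injective incl
  range_eq : range incl = S
  isImmersion : Manifold.IsImmersion (𝓡 dim) 𝓘(ℝ, EM) ∞ incl
  initial : ∀ (n : ℕ) (U : Set (EuclideanSpace ℝ (Fin n))) (f : EuclideanSpace ℝ (Fin n) → Carrier),
    IsOpen U → ContMDiffOn (𝓡 n) 𝓘(ℝ, EM) ∞ (fun z => incl (f z)) U →
      ContMDiffOn (𝓡 n) (𝓡 dim) ∞ f U

attribute [instance] InitialSubmanifold.top InitialSubmanifold.charted
  InitialSubmanifold.isManifold InitialSubmanifold.t2 InitialSubmanifold.secondCountable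

end Initial

/-! ### Cartan geometries -/

/-- A Cartan geometry of type `(G, P)` with total space `B` on the manifold `M`: a `P`-principal
bundle `proj : B → M`, with right action `act`, and a Cartan connection `form`. -/
structure CartanGeometry (EG : Type*) [NormedAddCommGroup EG] [NormedSpace ℝ EG]
    (EP : Type*) [NormedAddCommGroup EP] [NormedSpace ℝ EP]
    (EB : Type*) [NormedAddCommGroup EB] [NormedSpace ℝ EB]
    (EM : Type*) [NormedAddCommGroup EM] [NormedSpace ℝ EM]
    {G : Type*} [Group G] [TopologicalSpace G] [ChartedSpace EG G]
    (P : Subgroup G) [ChartedSpace EP P]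
    (B : Type*) [TopologicalSpace B] [ChartedSpace EB B] [IsManifold 𝓘(ℝ, EB) ∞ B]
    (M : Type*) [TopologicalSpace M] [ChartedSpace EM M] where
  /-- The bundle projection. -/
  proj : B → M
  /-- The principal right action. -/
  act : B → P → B
  act_one : ∀ u, act u 1 = u
  act_mul : ∀ u p q, act u (p * q) = act (act u p) q
  /-- Smooth local trivialisations `proj ⁻¹ U ≅ U × P` which are compatible with the projections to
  `U` and with the right actions of `P`. -/
  locallyTrivial : ∀ x : M, ∃ (U : Set M) (Φ : OpenPartialHomeomorph B (M × P)),
    IsOpen U ∧ x ∈ U ∧ Φ.source = proj ⁻¹' U ∧ Φ.target = U ×ˢ univ ∧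
    ContMDiffOn 𝓘(ℝ, EB) (𝓘(ℝ, EM).prod 𝓘(ℝ, EP)) ∞ Φ Φ.source ∧
    ContMDiffOn (𝓘(ℝ, EM).prod 𝓘(ℝ, EP)) 𝓘(ℝ, EB) ∞ Φ.symm Φ.target ∧
    ∀ u ∈ Φ.source, (Φ u).1 = proj u ∧
      ∀ p : P, act u p ∈ Φ.source ∧ Φ (act u p) = ((Φ u).1, (Φ u).2 * p)
  /-- The Cartan connection, a one-form with values in the Lie algebra of `G`. -/
  form : ∀ u : B, TangentSpace 𝓘(ℝ, EB) u →L[ℝ] GroupLieAlgebra 𝓘(ℝ, EG) G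
  /-- Smoothness of the one-form, as a function on the tangent bundle. -/
  smooth_form : ContMDiff (M' := EG) 𝓘(ℝ, EB).tangent 𝓘(ℝ, EG) ∞
    (fun ξ : TangentBundle 𝓘(ℝ, EB) B => form ξ.1 ξ.2)
  /-- Equivariance. -/
  form_act : ∀ (u : B) (p : P) (ξ : TangentSpace 𝓘(ℝ, EB) u),
    form (act u p) (mfderiv 𝓘(ℝ, EB) 𝓘(ℝ, EB) (fun u' => act u' p) u ξ) =
      Ad EG ((p : G)⁻¹) (form u ξ)
  /-- Reproduction of the generators of fundamental vector fields. The fundamental field generated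
  by `Y` is the derivative of `p ↦ u · p` at `1` in the direction `Y`. -/
  form_fundamental : ∀ (u : B) (Y : GroupLieAlgebra 𝓘(ℝ, EP) P),
    form (act u 1) (mfderiv 𝓘(ℝ, EP) 𝓘(ℝ, EB) (fun p : P => act u p) 1 Y) =
      lieInclusion EG EP P Y
  /-- The Cartan connection is a linear isomorphism on each tangent space. -/
  form_bijective : ∀ u : B, Function.Bijective (form u)

namespace CartanGeometry

variable {EG : Type*} [NormedAddCommGroup EG] [NormedSpace ℝ EG]
  {EP : Type*} [NormedAddCommGroup EP] [NormedSpace ℝ EP]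
  {EB : Type*} [NormedAddCommGroup EB] [NormedSpace ℝ EB]
  {EM : Type*} [NormedAddCommGroup EM] [NormedSpace ℝ EM]
  {G : Type*} [Group G] [TopologicalSpace G] [ChartedSpace EG G]
  {P : Subgroup G} [ChartedSpace EP P]
  {B : Type*} [TopologicalSpace B] [ChartedSpace EB B] [IsManifold 𝓘(ℝ, EB) ∞ B]
  {M : Type*} [TopologicalSpace M] [ChartedSpace EM M]

/-- The exterior derivative `dω` of the Cartan connection. -/
def dForm (C : CartanGeometry EG EP EB EM P B M) (u : B) (ξ η : TangentSpace 𝓘(ℝ, EB) u) :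
    GroupLieAlgebra 𝓘(ℝ, EG) G :=
  extDerivForm (F := EG) C.form u ξ η

/-- The curvature `K(ξ, η) = dω(ξ, η) + [ω(ξ), ω(η)]`. -/
def curvature (C : CartanGeometry EG EP EB EM P B M) (u : B) (ξ η : TangentSpace 𝓘(ℝ, EB) u) :
    GroupLieAlgebra 𝓘(ℝ, EG) G :=
  C.dForm u ξ η + ⁅C.form u ξ, C.form u η⁆

/-- The inverse of the linear isomorphism `ω_u : T_u B → 𝔤`. -/
def formInv (C : CartanGeometry EG EP EB EM P B M) (u : B) :
    GroupLieAlgebra 𝓘(ℝ, EG) G → TangentSpace 𝓘(ℝ, EB) u :=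
  (LinearEquiv.ofBijective (C.form u).toLinearMap (C.form_bijective u)).symm

/-- The curvature function `κ(u)(X, Y) = K(ω_u⁻¹(X), ω_u⁻¹(Y))`. -/
def curvatureFunction (C : CartanGeometry EG EP EB EM P B M) (u : B)
    (X Y : GroupLieAlgebra 𝓘(ℝ, EG) G) : GroupLieAlgebra 𝓘(ℝ, EG) G :=
  C.curvature u (C.formInv u X) (C.formInv u Y)

/-- A Cartan geometry is torsion free if its curvature has values in the Lie algebra of `P`. -/
def TorsionFree (C : CartanGeometry EG EP EB EM P B M) : Prop :=
  ∀ (u : B) (ξ η : TangentSpace 𝓘(ℝ, EB) u),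
    C.curvature u ξ η ∈ range (lieInclusion EG EP P)

/-- The extended bundle is `B ×_P G`, the set of classes `[u, g]` with `[u · p, g] = [u, p g]`.
The `G`-principal connection on it which restricts to `ω` on `B = {[u, 1]}` pulls back along
`B × G → B ×_P G` to the one-form `Ad(g⁻¹) ω_u(ξ) + g⁻¹ Z`, for `(ξ, Z)` tangent to `B × G`
at `(u, g)`. -/
def extendedForm (C : CartanGeometry EG EP EB EM P B M) (u : B) (g : G)
    (ξ : TangentSpace 𝓘(ℝ, EB) u) (Z : TangentSpace 𝓘(ℝ, EG) g) : GroupLieAlgebra 𝓘(ℝ, EG) G :=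
  Ad EG g⁻¹ (C.form u ξ) + maurerCartan EG g Z

/-- A holonomy reduction of type `O`, i.e. a parallel section of the bundle
`B ×_P O = (B ×_P G) ×_G O`. Sections are described by smooth maps `s : B → O` with
`s (u · p) = p⁻¹ • s u`; the corresponding `G`-equivariant map on `B ×_P G` is
`[u, g] ↦ g⁻¹ • s u`. The section is parallel if the derivative of this map vanishes on all tangent
vectors which are horizontal for the extended connection. -/
structure HolonomyReduction {EO : Type*} [NormedAddCommGroup EO] [NormedSpace ℝ EO]
    {O : Type*} [TopologicalSpace O] [ChartedSpace EO O] [MulAction G O]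
    (C : CartanGeometry EG EP EB EM P B M) (s : B → O) : Prop where
  smooth : ContMDiff 𝓘(ℝ, EB) 𝓘(ℝ, EO) ∞ s
  equivariant : ∀ (u : B) (p : P), s (C.act u p) = (p : G)⁻¹ • s u
  parallel : ∀ (u : B) (g : G) (ξ : TangentSpace 𝓘(ℝ, EB) u) (Z : TangentSpace 𝓘(ℝ, EG) g),
    C.extendedForm u g ξ Z = 0 →
      mfderiv (𝓘(ℝ, EB).prod 𝓘(ℝ, EG)) 𝓘(ℝ, EO) (fun w : B × G => w.2⁻¹ • s w.1) (u, g)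
        ((ξ, Z) : EB × EG) = 0

/-- The `P`-type of a point `x` with respect to `s`: the image under `s` of the fibre over `x`. -/
def pType {O : Type*} (C : CartanGeometry EG EP EB EM P B M) (s : B → O) (x : M) : Set O :=
  s '' (C.proj ⁻¹' {x})

/-- The curved orbit `M_i`: all points of `P`-type `i`. -/
def curvedOrbit {O : Type*} (C : CartanGeometry EG EP EB EM P B M) (s : B → O) (i : Set O) :
    Set M :=
  {x | C.pType s x = i}

end CartanGeometry

/-! ### Induced Cartan geometries on curved orbits -/

/-- The subgroup `P_α = G_α ∩ P` of the stabiliser `G_α`. -/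
abbrev stabP {G : Type*} [Group G] (P : Subgroup G) {O : Type*} [MulAction G O] (α : O) :
    Subgroup (MulAction.stabilizer G α) :=
  P.subgroupOf (MulAction.stabilizer G α)

/-- The inclusion of `P_α` into `P`. -/
def stabPIncl {G : Type*} [Group G] (P : Subgroup G) {O : Type*} [MulAction G O] (α : O)
    (q : stabP P α) : P :=
  ⟨(q : MulAction.stabilizer G α), q.2⟩

section Induced

variable {EG : Type v₁} [NormedAddCommGroup EG] [NormedSpace ℝ EG]
  {EP : Type v₂} [NormedAddCommGroup EP] [NormedSpace ℝ EP]
  {EB : Type v₃} [NormedAddCommGroup EB] [NormedSpace ℝ EB]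
  {EM : Type v₄} [NormedAddCommGroup EM] [NormedSpace ℝ EM]
  {G : Type uG} [Group G] [TopologicalSpace G] [ChartedSpace EG G]
  {P : Subgroup G} [ChartedSpace EP P]
  {B : Type uB} [TopologicalSpace B] [ChartedSpace EB B] [IsManifold 𝓘(ℝ, EB) ∞ B]
  {M : Type uM} [TopologicalSpace M] [ChartedSpace EM M]
  {O : Type uO} [MulAction G O]

/-- The Cartan geometry of type `(G_α, P_α)` induced on the initial submanifold `N` of `M` by
`s : B → O`. It consists of the structures of closed Lie subgroups on `G_α` and `P_α`, of a Cartan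
geometry `geom` of type `(G_α, P_α)` on `N`, and of an embedding `incl` of its total space over `N`
as a principal subbundle into the restriction `B|_N = {(y, u) ∈ N × B : u lies over y}`, with image
`{u : s u = α}`, along which the Cartan connection of `C` pulls back to the one of `geom`. -/
structure InducedGeometry (C : CartanGeometry EG EP EB EM P B M) (s : B → O) {S : Set M}
    (N : InitialSubmanifold (EM := EM) S) (α : O) where
  dimH : ℕ
  [chartedH : ChartedSpace (EuclideanSpace ℝ (Fin dimH)) (MulAction.stabilizer G α)]
  lieH : IsClosedLieSubgroup EG (EuclideanSpace ℝ (Fin dimH)) (MulAction.stabilizer G α)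
  dimP : ℕ
  [chartedP : ChartedSpace (EuclideanSpace ℝ (Fin dimP)) (stabP P α)]
  lieP : IsClosedLieSubgroup (EuclideanSpace ℝ (Fin dimH)) (EuclideanSpace ℝ (Fin dimP))
    (stabP P α)
  dimTotal : ℕ
  Total : Type uB
  [top : TopologicalSpace Total]
  [charted : ChartedSpace (EuclideanSpace ℝ (Fin dimTotal)) Total]
  [isManifold : IsManifold (𝓡 dimTotal) ∞ Total]
  [t2 : T2Space Total]
  [secondCountable : SecondCountableTopology Total]
  /-- The induced Cartan geometry. -/
  geom : CartanGeometry (EuclideanSpace ℝ (Fin dimH)) (EuclideanSpace ℝ (Fin dimP))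
    (EuclideanSpace ℝ (Fin dimTotal)) (EuclideanSpace ℝ (Fin N.dim)) (stabP P α) Total N.Carrier
  /-- The embedding into the ambient Cartan bundle. -/
  incl : Total → B
  proj_incl : ∀ v, C.proj (incl v) = N.incl (geom.proj v)
  incl_act : ∀ v (q : stabP P α), incl (geom.act v q) = C.act (incl v) (stabPIncl P α q)
  isSmoothEmbedding : Manifold.IsSmoothEmbedding (𝓡 dimTotal) ((𝓡 N.dim).prod 𝓘(ℝ, EB)) ∞
    (fun v => (geom.proj v, incl v))
  range_incl : range incl = {u | C.proj u ∈ S ∧ s u = α}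
  form_incl : ∀ v (ξ : TangentSpace (𝓡 dimTotal) v),
    C.form (incl v) (mfderiv (𝓡 dimTotal) 𝓘(ℝ, EB) incl v ξ) =
      lieInclusion EG (EuclideanSpace ℝ (Fin dimH)) (MulAction.stabilizer G α) (geom.form v ξ)

attribute [instance] InducedGeometry.chartedH InducedGeometry.chartedP InducedGeometry.top
  InducedGeometry.charted InducedGeometry.isManifold InducedGeometry.t2
  InducedGeometry.secondCountable

namespace InducedGeometry

variable {C : CartanGeometry EG EP EB EM P B M} {s : B → O} {S : Set M}
  {N : InitialSubmanifold (EM := EM) S} {α : O}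

/-- The inclusion `𝔤_α → 𝔤`. -/
def lieIncl (D : InducedGeometry C s N α) :
    GroupLieAlgebra (𝓡 D.dimH) (MulAction.stabilizer G α) → GroupLieAlgebra 𝓘(ℝ, EG) G :=
  lieInclusion EG (EuclideanSpace ℝ (Fin D.dimH)) (MulAction.stabilizer G α)

/-- The tangent map of the embedding of the induced Cartan bundle into the ambient one. -/
def tangentIncl (D : InducedGeometry C s N α) (v : D.Total) (ξ : TangentSpace (𝓡 D.dimTotal) v) :
    TangentSpace 𝓘(ℝ, EB) (D.incl v) :=
  mfderiv (𝓡 D.dimTotal) 𝓘(ℝ, EB) D.incl v ξ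

/-- For `b ∈ P`, the geometries induced for the representatives `α` and `b • α` are isomorphic over
`N` via the principal right action of `b⁻¹`; here `(G_α, P_α)` and `(G_{b • α}, P_{b • α})` are
identified by conjugation with `b`, and their Lie algebras by `Ad b`. -/
def IsTranslate (b : P) (D : InducedGeometry C s N α) (D' : InducedGeometry C s N ((b : G) • α))
    (Ψ : Diffeomorph (𝓡 D.dimTotal) (𝓡 D'.dimTotal) D.Total D'.Total ∞) : Prop :=
  (∀ v, D'.incl (Ψ v) = C.act (D.incl v) b⁻¹) ∧
  (∀ v, D'.geom.proj (Ψ v) = D.geom.proj v) ∧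
  (∀ v (q : stabP P α) (q' : stabP P ((b : G) • α)),
    stabPIncl P _ q' = b * stabPIncl P α q * b⁻¹ →
      Ψ (D.geom.act v q) = D'.geom.act (Ψ v) q') ∧
  (∀ v (ξ : TangentSpace (𝓡 D.dimTotal) v),
    D'.lieIncl (D'.geom.form (Ψ v) (mfderiv (𝓡 D.dimTotal) (𝓡 D'.dimTotal) Ψ v ξ)) =
      Ad EG (b : G) (D.lieIncl (D.geom.form v ξ)))

end InducedGeometry

end Induced

end CurvedOrbit

end

open CurvedOrbit

/-!
# Curved orbits of holonomy reductions of Cartan geometries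

Write `B` for the total space of the Cartan bundle and `ω` for the Cartan connection. Since a
holonomy reduction `s` is parallel, its derivative at `u` is minus the infinitesimal action of `ω`
on `O` (`HolonomyReduction.md_eq`). As `ω` is surjective at each point and `G` acts transitively on
`O`, the map `s` is a submersion. By equivariance, `M_i` is the projection of the level set
`{s = α}`, for each `α ∈ i`.

*Local form.* Near a point `u` with `s u = α`, there is a smooth map `f` to `G` such that `f u = 1`,
the derivative of `f` at `u` is `ω` and `f • s` is constant with value `α`
(`HolonomyReduction.exists_development`): in this respect `f` imitates a map to the flat model `G`.
Composing `f` with a local section of the Cartan bundle and with `G → G ⧸ P`, one gets a map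
`φ : M → G ⧸ P` whose derivative is an isomorphism, as `ω` identifies the tangent spaces of `M` with
`𝔤 / 𝔭`. The relation `f • s = α` says exactly that a point is over `{s = α}` if and only if its
image is in the orbit of the stabiliser of `α` (`HolonomyReduction.exists_local_form`). The smooth
structure of `G ⧸ P` comes from a slice for the right action of `P` on `G` (`CosetSlice`).

*Initial submanifold.* As orbit maps have constant rank, `O` has charts adapted to the `P`-orbits
(`OrbitChart`). Moving a local section of the Cartan bundle along the `P`-orbits, one can achieve
that `s` takes values in a transversal of the orbit of `α`
(`HolonomyReduction.exists_adapted_section`). Locally, this expresses the curved orbit by a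
submersion `τ` from `M` to the transversal. Since `P` is second countable, its orbit meets the
transversal in a countable set, so `τ` is locally constant along any continuous map from a locally
connected space to `M` with values in the curved orbit. Hence the plaques `{τ = 0}` make the curved
orbit into a manifold, whose topology is the quotient topology from `{s = α}` (`Leaf`), and maps to
it are smooth as soon as they are smooth into `M` (`HolonomyReduction.continuousOn_leaf`,
`HolonomyReduction.nonempty_initialSubmanifold`).

*Induced geometry.* The level set `{s = α}` is a submanifold of `B` on which `P_α` acts, and the
adapted sections show that it is a principal bundle over `M_i`. Tangent vectors of `{s = α}` are
those in the kernel of the derivative of `s`, that is, those which `ω` maps to the kernel `𝔤_α` of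
the infinitesimal action at `α`. So `ω` restricts to a Cartan connection
(`HolonomyReduction.nonempty_inducedGeometry`). The right action of `b⁻¹` maps `{s = α}` to
`{s = b • α}`, and all compatibilities follow from the equivariance of `ω`
(`InducedGeometry.exists_isTranslate`).

*Curvature.* The exterior derivative commutes with pullbacks (`extD_pullback`). Applied to the
Maurer-Cartan form and the Maurer-Cartan equation (`extD_mc`), this shows that the inclusion of the
Lie algebra of a Lie subgroup preserves brackets (`md_val_lieBr`); applied to `ω`, it then shows
that the curvature of the induced geometry is the pullback of the curvature
(`InducedGeometry.lie_curvature`). The curvature is horizontal because the exterior derivatives of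
`ω` and of the Maurer-Cartan form, with a fundamental field inserted, are given by the same formula
(`CartanGeometry.curvature_fundamental`). Torsion-freeness is inherited because the Lie algebra of
`P_α` is the intersection of `𝔤_α` and `𝔭` (`mem_range_lieInclusion_stabP`).
-/


noncomputable section

set_option linter.unusedSectionVars false

namespace CurvedOrbit

/-! ### Derivatives and the inverse function theorem -/

section Calculus

variable {E : Type*} [NormedAddCommGroup E] [NormedSpace ℝ E]
  {E' : Type*} [NormedAddCommGroup E'] [NormedSpace ℝ E']
  {E'' : Type*} [NormedAddCommGroup E''] [NormedSpace ℝ E'']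
  {H : Type*} [TopologicalSpace H] {H' : Type*} [TopologicalSpace H']
  {H'' : Type*} [TopologicalSpace H'']
  {I : ModelWithCorners ℝ E H} {J : ModelWithCorners ℝ E' H'} {L : ModelWithCorners ℝ E'' H''}
  {M : Type*} [TopologicalSpace M] [ChartedSpace H M]
  {N : Type*} [TopologicalSpace N] [ChartedSpace H' N]
  {Q : Type*} [TopologicalSpace Q] [ChartedSpace H'' Q]

variable (I J) in
/-- The derivative `mfderiv` of a map between manifolds as a linear map between the model vector
spaces of the manifolds, to which the tangent spaces are definitionally equal. -/
def md (f : M → N) (x : M) : E →L[ℝ] E' := mfderiv I J f x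

theorem md_comp {g : N → Q} {f : M → N} (x : M) (hg : MDifferentiableAt J L g (f x))
    (hf : MDifferentiableAt I J f x) :
    md I L (fun y => g (f y)) x = (md J L g (f x)).comp (md I J f x) :=
  mfderiv_comp x hg hf

theorem md_comp_apply {g : N → Q} {f : M → N} (x : M) (hg : MDifferentiableAt J L g (f x))
    (hf : MDifferentiableAt I J f x) (v : E) :
    md I L (fun y => g (f y)) x v = md J L g (f x) (md I J f x v) := by
  rw [md_comp x hg hf]; rfl

theorem md_id (x : M) : md I I (fun y : M => y) x = ContinuousLinearMap.id ℝ E := mfderiv_id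

theorem md_const (c : N) (x : M) : md I J (fun _ : M => c) x = 0 := mfderiv_const

theorem md_congr {f g : M → N} {x : M} (h : f =ᶠ[𝓝 x] g) : md I J f x = md I J g x :=
  h.mfderiv_eq

theorem md_congr_of_isOpen {f g : M → N} {U : Set M} (hU : IsOpen U) (h : EqOn f g U) {x : M}
    (hx : x ∈ U) : md I J f x = md I J g x :=
  md_congr (Filter.eventuallyEq_of_mem (hU.mem_nhds hx) h)

theorem md_eq_fderiv (f : E → E') (x : E) : md 𝓘(ℝ, E) 𝓘(ℝ, E') f x = fderiv ℝ f x :=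
  mfderiv_eq_fderiv

theorem ContMDiffOn.mdiffAt {f : M → N} {U : Set M} (hf : ContMDiffOn I J ∞ f U)
    (hU : IsOpen U) {x : M} (hx : x ∈ U) : MDifferentiableAt I J f x :=
  (hf.contMDiffAt (hU.mem_nhds hx)).mdifferentiableAt (by simp)

/-- A pair of mutually inverse diffeomorphisms between open subsets of two manifolds. -/
def IsPDiffeo (I : ModelWithCorners ℝ E H) (J : ModelWithCorners ℝ E' H')
    (Φ : OpenPartialHomeomorph M N) : Prop :=
  ContMDiffOn I J ∞ Φ Φ.source ∧ ContMDiffOn J I ∞ Φ.symm Φ.target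

theorem IsPDiffeo.symm {Φ : OpenPartialHomeomorph M N} (h : IsPDiffeo I J Φ) :
    IsPDiffeo J I Φ.symm :=
  ⟨h.2, by simpa using h.1⟩

theorem IsPDiffeo.trans {Φ : OpenPartialHomeomorph M N} {Ψ : OpenPartialHomeomorph N Q}
    (h : IsPDiffeo I J Φ) (h' : IsPDiffeo J L Ψ) : IsPDiffeo I L (Φ.trans Ψ) := by
  constructor
  · have := h'.1.comp (h.1.mono (s := Φ.source) (t := (Φ.trans Ψ).source)
      (by simp)) (by intro x hx; simp at hx; exact hx.2)
    simpa using this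
  · have := h.2.comp (h'.2.mono (t := (Φ.trans Ψ).target)
      (by simp)) (by intro x hx; simp at hx; exact hx.2)
    simpa using this

theorem IsPDiffeo.restrOpen {Φ : OpenPartialHomeomorph M N} (h : IsPDiffeo I J Φ) {U : Set M}
    (hU : IsOpen U) : IsPDiffeo I J (Φ.restrOpen U hU) := by
  refine ⟨h.1.mono ?_, h.2.mono ?_⟩
  · simp
  · intro x hx
    simp at hx
    exact hx.1

theorem IsPDiffeo.mdiffAt {Φ : OpenPartialHomeomorph M N} (h : IsPDiffeo I J Φ) {x : M}
    (hx : x ∈ Φ.source) : MDifferentiableAt I J Φ x :=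
  ContMDiffOn.mdiffAt h.1 Φ.open_source hx

theorem IsPDiffeo.md_symm_comp {Φ : OpenPartialHomeomorph M N} (h : IsPDiffeo I J Φ) {x : M}
    (hx : x ∈ Φ.source) (v : E) : md J I Φ.symm (Φ x) (md I J Φ x v) = v := by
  rw [← md_comp_apply x (h.symm.mdiffAt (Φ.map_source hx)) (h.mdiffAt hx),
    md_congr_of_isOpen Φ.open_source (g := fun y => y) (fun y hy => Φ.left_inv hy) hx, md_id]
  rfl

theorem IsPDiffeo.md_comp_symm {Φ : OpenPartialHomeomorph M N} (h : IsPDiffeo I J Φ) {x : M}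
    (hx : x ∈ Φ.source) (v : E') : md I J Φ x (md J I Φ.symm (Φ x) v) = v := by
  have := h.symm.md_symm_comp (Φ.map_source hx) v
  simpa [Φ.left_inv hx] using this

theorem IsPDiffeo.md_bijective {Φ : OpenPartialHomeomorph M N} (h : IsPDiffeo I J Φ) {x : M}
    (hx : x ∈ Φ.source) : Function.Bijective (md I J Φ x) :=
  Function.bijective_iff_has_inverse.2
    ⟨md J I Φ.symm (Φ x), fun v => h.md_symm_comp hx v, fun v => h.md_comp_symm hx v⟩

variable (I) in
/-- The preferred chart at a point of a manifold without boundary, as a partial homeomorphism into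
the model vector space. -/
def echart [I.Boundaryless] (x : M) : OpenPartialHomeomorph M E :=
  (chartAt H x).trans I.toHomeomorph.toOpenPartialHomeomorph

theorem echart_coe [I.Boundaryless] (x : M) : (echart I x : M → E) = extChartAt I x := by
  ext y; simp [echart, ModelWithCorners.toHomeomorph]

theorem echart_coe_symm [I.Boundaryless] (x : M) :
    ((echart I x).symm : E → M) = (extChartAt I x).symm := by
  ext y; simp [echart, ModelWithCorners.toHomeomorph]

theorem echart_source [I.Boundaryless] (x : M) : (echart I x).source = (extChartAt I x).source := by
  simp [echart]

theorem echart_target [I.Boundaryless] (x : M) : (echart I x).target = (extChartAt I x).target := by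
  ext y
  have : y ∈ range I := by rw [I.range_eq_univ]; trivial
  simpa [echart, extChartAt] using fun _ => this

theorem mem_echart_source [I.Boundaryless] (x : M) : x ∈ (echart I x).source := by
  simp [echart_source]

theorem isPDiffeo_echart [I.Boundaryless] [IsManifold I ∞ M] (x : M) :
    IsPDiffeo I 𝓘(ℝ, E) (echart I x) := by
  constructor
  · rw [echart_coe, echart_source, extChartAt_source]
    exact contMDiffOn_extChartAt
  · rw [echart_coe_symm, echart_target]
    exact contMDiffOn_extChartAt_symm x

end Calculus

section InverseFunction

variable {E : Type*} [NormedAddCommGroup E] [NormedSpace ℝ E] [FiniteDimensional ℝ E]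
  {E' : Type*} [NormedAddCommGroup E'] [NormedSpace ℝ E'] [FiniteDimensional ℝ E']

/-- The inverse function theorem for smooth maps between vector spaces, with smoothness of the
inverse on its whole domain. -/
theorem exists_isPDiffeo_of_bijective_fderiv {f : E → E'} {U : Set E} (hU : IsOpen U)
    (hf : ContDiffOn ℝ ∞ f U) {x : E} (hx : x ∈ U) (hbij : Function.Bijective (fderiv ℝ f x)) :
    ∃ Φ : OpenPartialHomeomorph E E', x ∈ Φ.source ∧ Φ.source ⊆ U ∧ (Φ : E → E') = f ∧
      IsPDiffeo 𝓘(ℝ, E) 𝓘(ℝ, E') Φ := by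
  have hfat : ∀ y ∈ U, ContDiffAt ℝ ∞ f y := fun y hy => hf.contDiffAt (hU.mem_nhds hy)
  let e : E ≃L[ℝ] E' := (LinearEquiv.ofBijective (fderiv ℝ f x).toLinearMap
      hbij).toContinuousLinearEquiv
  have he : HasFDerivAt f (e : E →L[ℝ] E') x := by
    have : (e : E →L[ℝ] E') = fderiv ℝ f x := by ext v; rfl
    rw [this]
    exact ((hfat x hx).differentiableAt (by simp)).hasFDerivAt
  let Φ₀ := (hfat x hx).toOpenPartialHomeomorph f he (by simp)
  have hΦ₀ : (Φ₀ : E → E') = f := rfl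
  have hxΦ : x ∈ Φ₀.source := (hfat x hx).mem_toOpenPartialHomeomorph_source he (by simp)
  -- restrict to the open set of points where the derivative is invertible
  let W : Set E := U ∩ (fderiv ℝ f) ⁻¹' (range ((↑) : (E ≃L[ℝ] E') → E →L[ℝ] E'))
  have hW : IsOpen W :=
    (hf.continuousOn_fderiv_of_isOpen hU (by simp)).isOpen_inter_preimage hU
      ContinuousLinearEquiv.isOpen
  have hxW : x ∈ W := ⟨hx, e, by ext v; rfl⟩
  refine ⟨Φ₀.restrOpen W hW, ⟨hxΦ, hxW⟩, fun y hy => hy.2.1, rfl, ?_, ?_⟩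
  · rw [contMDiffOn_iff_contDiffOn]
    exact hf.mono fun y hy => hy.2.1
  · rw [contMDiffOn_iff_contDiffOn]
    intro y hy
    have hy' : (Φ₀.restrOpen W hW).symm y ∈ (Φ₀.restrOpen W hW).source :=
      (Φ₀.restrOpen W hW).map_target hy
    obtain ⟨hyU, e', he'⟩ := hy'.2
    refine ContDiffAt.contDiffWithinAt ?_
    refine (Φ₀.restrOpen W hW).contDiffAt_symm (f₀' := e') hy ?_ (hfat _ hyU)
    rw [he']
    exact ((hfat _ hyU).differentiableAt (by simp)).hasFDerivAt

variable {H : Type*} [TopologicalSpace H] {H' : Type*} [TopologicalSpace H']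
  {I : ModelWithCorners ℝ E H} {J : ModelWithCorners ℝ E' H'} [I.Boundaryless] [J.Boundaryless]
  {M : Type*} [TopologicalSpace M] [ChartedSpace H M] [IsManifold I ∞ M]
  {N : Type*} [TopologicalSpace N] [ChartedSpace H' N] [IsManifold J ∞ N]

/-- The inverse function theorem for smooth maps between manifolds. -/
theorem exists_isPDiffeo_of_bijective_md {f : M → N} {U : Set M} (hU : IsOpen U)
    (hf : ContMDiffOn I J ∞ f U) {x : M} (hx : x ∈ U) (hbij : Function.Bijective (md I J f x)) :
    ∃ Φ : OpenPartialHomeomorph M N, x ∈ Φ.source ∧ Φ.source ⊆ U ∧ EqOn Φ f Φ.source ∧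
      IsPDiffeo I J Φ := by
  let φ := echart I x
  let ψ := echart J (f x)
  have hφ : IsPDiffeo I 𝓘(ℝ, E) φ := isPDiffeo_echart x
  have hψ : IsPDiffeo J 𝓘(ℝ, E') ψ := isPDiffeo_echart (f x)
  have hxφ : x ∈ φ.source := mem_echart_source x
  have hxψ : f x ∈ ψ.source := mem_echart_source (f x)
  let V : Set M := U ∩ f ⁻¹' ψ.source
  have hV : IsOpen V := hf.continuousOn.isOpen_inter_preimage hU ψ.open_source
  let W : Set E := φ.target ∩ φ.symm ⁻¹' V
  have hW : IsOpen W := φ.symm.isOpen_inter_preimage hV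
  let g : E → E' := fun z => ψ (f (φ.symm z))
  have hg : ContMDiffOn 𝓘(ℝ, E) 𝓘(ℝ, E') ∞ g W :=
    hψ.1.comp (hf.comp (hφ.2.mono inter_subset_left) fun z hz => hz.2.1) fun z hz => hz.2.2
  have hxW : φ x ∈ W := ⟨φ.map_source hxφ, by
    show φ.symm (φ x) ∈ V
    rw [φ.left_inv hxφ]; exact ⟨hx, hxψ⟩⟩
  have hbij' : Function.Bijective (fderiv ℝ g (φ x)) := by
    rw [← md_eq_fderiv]
    have h1 : MDifferentiableAt 𝓘(ℝ, E) I φ.symm (φ x) := hφ.symm.mdiffAt (φ.map_source hxφ)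
    have h2 : MDifferentiableAt I J f (φ.symm (φ x)) := by
      rw [φ.left_inv hxφ]; exact ContMDiffOn.mdiffAt hf hU hx
    have h3 : MDifferentiableAt J 𝓘(ℝ, E') ψ (f (φ.symm (φ x))) := by
      rw [φ.left_inv hxφ]; exact hψ.mdiffAt hxψ
    rw [md_comp (J := J) (f := fun z => f (φ.symm z)) (φ x) h3 (h2.comp _ h1),
      md_comp (g := f) (f := φ.symm) (φ x) h2 h1, φ.left_inv hxφ]
    exact (hψ.md_bijective hxψ).comp (hbij.comp (hφ.symm.md_bijective (φ.map_source hxφ)))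
  obtain ⟨Φ, h1, h2, h3, h4⟩ := exists_isPDiffeo_of_bijective_fderiv hW
    (contMDiffOn_iff_contDiffOn.1 hg) hxW hbij'
  have key : ∀ y, y ∈ φ.source → φ y ∈ Φ.source → y ∈ V := by
    intro y hy hy'
    have := (h2 hy').2
    simpa [φ.left_inv hy] using this
  refine ⟨(φ.trans Φ).trans ψ.symm, ?_, ?_, ?_, (hφ.trans h4).trans hψ.symm⟩
  · simp only [OpenPartialHomeomorph.trans_source, OpenPartialHomeomorph.coe_trans]
    refine ⟨⟨hxφ, h1⟩, ?_⟩
    simp only [mem_preimage, Function.comp, OpenPartialHomeomorph.symm_source, h3, g]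
    rw [φ.left_inv hxφ]; exact ψ.map_source hxψ
  · rintro y ⟨⟨hy, hy'⟩, -⟩
    exact (key y hy hy').1
  · rintro y ⟨⟨hy, hy'⟩, -⟩
    have hyV := key y hy hy'
    simp only [OpenPartialHomeomorph.coe_trans, Function.comp, h3, g]
    rw [φ.left_inv hy]
    exact ψ.left_inv hyV.2

end InverseFunction

/-! ### Slices, immersions and submersions -/

section LinearAlgebra

variable {E : Type*} [NormedAddCommGroup E] [NormedSpace ℝ E] [FiniteDimensional ℝ E]
  {V : Type*} [NormedAddCommGroup V] [NormedSpace ℝ V] [FiniteDimensional ℝ V]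

/-- A surjective linear map is the first component of an isomorphism; the second component is
an isomorphism of its kernel, extended by zero on a complement. -/
theorem exists_prod_bijective {L : E →L[ℝ] V} (hL : Function.Surjective L) {k : ℕ}
    (hk : k + Module.finrank ℝ V = Module.finrank ℝ E) :
    ∃ p : E →L[ℝ] EuclideanSpace ℝ (Fin k), Function.Bijective (L.prod p) := by
  obtain ⟨C, hC⟩ := Submodule.exists_isCompl (LinearMap.ker L.toLinearMap)
  have hker : Module.finrank ℝ (LinearMap.ker L.toLinearMap) = k := by
    have h1 := L.toLinearMap.finrank_range_add_finrank_ker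
    rw [LinearMap.range_eq_top.2 hL, finrank_top] at h1
    omega
  let e : LinearMap.ker L.toLinearMap ≃ₗ[ℝ] EuclideanSpace ℝ (Fin k) :=
    LinearEquiv.ofFinrankEq _ _ (by simp [hker])
  let π := Submodule.projectionOnto _ _ hC
  let p : E →L[ℝ] EuclideanSpace ℝ (Fin k) := (e.toLinearMap.comp π).toContinuousLinearMap
  refine ⟨p, ?_⟩
  have hinj : Function.Injective (L.prod p).toLinearMap := by
    rw [← LinearMap.ker_eq_bot, LinearMap.ker_eq_bot']
    intro v hv
    have h1 : L v = 0 := congrArg Prod.fst hv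
    have h2 : e (π v) = 0 := congrArg Prod.snd hv
    have h3 : π v = 0 := by simpa using h2
    have h4 : π v = ⟨v, h1⟩ := Submodule.projectionOnto_apply_left hC ⟨v, h1⟩
    rw [h4] at h3
    exact congrArg Subtype.val h3
  refine ⟨hinj, ?_⟩
  exact (LinearMap.injective_iff_surjective_of_finrank_eq_finrank
    (by simp [← hk, add_comm])).1 hinj

/-- An injective linear map extends to an isomorphism on a product, by a parametrization of a
complement of its range. -/
theorem exists_coprod_bijective {L : E →L[ℝ] V} (hL : Function.Injective L) {k : ℕ}
    (hk : Module.finrank ℝ E + k = Module.finrank ℝ V) :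
    ∃ q : EuclideanSpace ℝ (Fin k) →L[ℝ] V, Function.Bijective (L.coprod q) := by
  obtain ⟨C, hC⟩ := Submodule.exists_isCompl (LinearMap.range L.toLinearMap)
  have hr : Module.finrank ℝ (LinearMap.range L.toLinearMap) = Module.finrank ℝ E :=
    LinearMap.finrank_range_of_inj hL
  have hCk : Module.finrank ℝ C = k := by
    have := Submodule.finrank_add_eq_of_isCompl hC
    omega
  let e : EuclideanSpace ℝ (Fin k) ≃ₗ[ℝ] C := LinearEquiv.ofFinrankEq _ _ (by simp [hCk])
  let q : EuclideanSpace ℝ (Fin k) →L[ℝ] V := (C.subtype.comp e.toLinearMap).toContinuousLinearMap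
  refine ⟨q, ?_⟩
  have hinj : Function.Injective (L.coprod q).toLinearMap := by
    rw [← LinearMap.ker_eq_bot, LinearMap.ker_eq_bot']
    rintro ⟨v, w⟩ hv
    have hv' : L v + (e w : V) = 0 := hv
    have h1 : L v = 0 ∧ (e w : V) = 0 := by
      have hmem : L v ∈ C := by
        rw [eq_neg_of_add_eq_zero_left hv']; exact C.neg_mem (e w).2
      have h0 : L v = 0 := by
        have := hC.disjoint
        rw [Submodule.disjoint_def] at this
        exact this _ ⟨v, rfl⟩ hmem
      exact ⟨h0, by simpa [h0] using hv'⟩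
    have h2 : v = 0 := hL (by simpa using h1.1)
    have h3 : w = 0 := by
      have : e w = 0 := Subtype.ext h1.2
      simpa using this
    simp [h2, h3]
  refine ⟨hinj, ?_⟩
  exact (LinearMap.injective_iff_surjective_of_finrank_eq_finrank (by simp [← hk])).1 hinj

end LinearAlgebra

section Slices

variable {E : Type*} [NormedAddCommGroup E] [NormedSpace ℝ E] [FiniteDimensional ℝ E]
  {E' : Type*} [NormedAddCommGroup E'] [NormedSpace ℝ E'] [FiniteDimensional ℝ E']
  {V : Type*} [NormedAddCommGroup V] [NormedSpace ℝ V] [FiniteDimensional ℝ V]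
  {H : Type*} [TopologicalSpace H] {H' : Type*} [TopologicalSpace H']
  {I : ModelWithCorners ℝ E H} {J : ModelWithCorners ℝ E' H'} [I.Boundaryless] [J.Boundaryless]
  {M : Type*} [TopologicalSpace M] [ChartedSpace H M] [IsManifold I ∞ M]
  {N : Type*} [TopologicalSpace N] [ChartedSpace H' N] [IsManifold J ∞ N]

theorem md_prodMk_vec {W : Type*} [NormedAddCommGroup W] [NormedSpace ℝ W] {f : M → V} {g : M → W}
    {x : M} (hf : MDifferentiableAt I 𝓘(ℝ, V) f x) (hg : MDifferentiableAt I 𝓘(ℝ, W) g x) :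
    md I 𝓘(ℝ, V × W) (fun y => (f y, g y)) x
      = (md I 𝓘(ℝ, V) f x).prod (md I 𝓘(ℝ, W) g x) :=
  HasMFDerivAt.mfderiv (I' := 𝓘(ℝ, V × W)) (f := fun y => (f y, g y))
    (f' := (md I 𝓘(ℝ, V) f x).prod (md I 𝓘(ℝ, W) g x))
    ⟨hf.continuousAt.prodMk hg.continuousAt, hf.hasMFDerivAt.2.prodMk hg.hasMFDerivAt.2⟩

section Products

variable {E'' : Type*} [NormedAddCommGroup E''] [NormedSpace ℝ E'']
  {H'' : Type*} [TopologicalSpace H''] {L : ModelWithCorners ℝ E'' H''}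
  {Q : Type*} [TopologicalSpace Q] [ChartedSpace H'' Q]

theorem md_prodMk {f : M → N} {g : M → Q} {x : M} (hf : MDifferentiableAt I J f x)
    (hg : MDifferentiableAt I L g x) :
    md I (J.prod L) (fun y => (f y, g y)) x = (md I J f x).prod (md I L g x) :=
  mfderiv_prodMk hf hg

/-- The derivative of a map on a product is the sum of its partial derivatives. -/
theorem md_prod_apply {f : M × N → Q} {x : M} {y : N}
    (hf : MDifferentiableAt (I.prod J) L f (x, y)) (v : E) (w : E') :
    md (I.prod J) L f (x, y) (v, w) =
      md I L (fun x' => f (x', y)) x v + md J L (fun y' => f (x, y')) y w := by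
  have h1 : MDifferentiableAt I (I.prod J) (fun x' : M => (x', y)) x :=
    mdifferentiableAt_id.prodMk mdifferentiableAt_const
  have h2 : MDifferentiableAt J (I.prod J) (fun y' : N => (x, y')) y :=
    mdifferentiableAt_const.prodMk mdifferentiableAt_id
  rw [md_comp_apply (g := f) (f := fun x' : M => (x', y)) x hf h1,
    md_comp_apply (g := f) (f := fun y' : N => (x, y')) y hf h2, ← map_add,
    md_prodMk (f := fun x' : M => x') mdifferentiableAt_id mdifferentiableAt_const,
    md_prodMk (g := fun y' : N => y') mdifferentiableAt_const mdifferentiableAt_id,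
    md_id, md_id, md_const, md_const]
  simp

end Products


/-- A map to a vector space which is a submersion at `x` is the first component of a chart. -/
theorem exists_slice {F : M → V} {U : Set M} (hU : IsOpen U)
    (hF : ContMDiffOn I 𝓘(ℝ, V) ∞ F U) {x : M} (hx : x ∈ U)
    (hsurj : Function.Surjective (md I 𝓘(ℝ, V) F x)) {k : ℕ}
    (hk : k + Module.finrank ℝ V = Module.finrank ℝ E) :
    ∃ Ψ : OpenPartialHomeomorph M (V × EuclideanSpace ℝ (Fin k)), x ∈ Ψ.source ∧ Ψ.source ⊆ U ∧
      IsPDiffeo I 𝓘(ℝ, V × EuclideanSpace ℝ (Fin k)) Ψ ∧ ∀ y ∈ Ψ.source, (Ψ y).1 = F y := by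
  let φ := echart I x
  have hφ : IsPDiffeo I 𝓘(ℝ, E) φ := isPDiffeo_echart x
  have hxφ : x ∈ φ.source := mem_echart_source x
  -- choose the linear map on the kernel of the derivative, read in the chart
  obtain ⟨p, hp⟩ := exists_prod_bijective (L := (md I 𝓘(ℝ, V) F x).comp
    (md 𝓘(ℝ, E) I φ.symm (φ x)))
    (hsurj.comp (hφ.symm.md_bijective (φ.map_source hxφ)).surjective) hk
  let g : M → V × EuclideanSpace ℝ (Fin k) := fun y => (F y, p (φ y))
  have hpφ : ContMDiffOn I 𝓘(ℝ, EuclideanSpace ℝ (Fin k)) ∞ (fun y => p (φ y)) φ.source :=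
    p.contMDiff.comp_contMDiffOn hφ.1
  have hg : ContMDiffOn I 𝓘(ℝ, V × EuclideanSpace ℝ (Fin k)) ∞ g (U ∩ φ.source) :=
    (hF.mono inter_subset_left).prodMk_space (hpφ.mono inter_subset_right)
  have hmd : md I 𝓘(ℝ, V × EuclideanSpace ℝ (Fin k)) g x =
      (((md I 𝓘(ℝ, V) F x).comp (md 𝓘(ℝ, E) I φ.symm (φ x))).prod p).comp
        (md I 𝓘(ℝ, E) φ x) := by
    rw [show g = fun y => (F y, p (φ y)) from rfl,
      md_prodMk_vec (ContMDiffOn.mdiffAt hF hU hx) (ContMDiffOn.mdiffAt hpφ φ.open_source hxφ)]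
    ext v
    · simp [hφ.md_symm_comp hxφ]
    · have h1 : MDifferentiableAt 𝓘(ℝ, E) 𝓘(ℝ, EuclideanSpace ℝ (Fin k)) p (φ x) :=
        p.contMDiff.contMDiffAt (n := ∞) |>.mdifferentiableAt (by simp)
      have h2 := md_comp_apply (g := p) (f := φ) x h1 (hφ.mdiffAt hxφ) v
      rw [md_eq_fderiv, p.fderiv] at h2
      exact congrFun (congrArg WithLp.ofLp h2) _
  obtain ⟨Ψ, h1, h2, h3, h4⟩ := exists_isPDiffeo_of_bijective_md (hU.inter φ.open_source) hg
    ⟨hx, hxφ⟩ (by rw [hmd]; exact hp.comp (hφ.md_bijective hxφ))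
  exact ⟨Ψ, h1, h2.trans inter_subset_left, h4, fun y hy => by rw [h3 hy]⟩

end Slices

section ImmersionCriterion

open Manifold

variable {E : Type*} [NormedAddCommGroup E] [NormedSpace ℝ E] [FiniteDimensional ℝ E]
  {E' : Type*} [NormedAddCommGroup E'] [NormedSpace ℝ E'] [FiniteDimensional ℝ E']
  {H' : Type*} [TopologicalSpace H']
  {J : ModelWithCorners ℝ E' H'} [J.Boundaryless]
  {M : Type*} [TopologicalSpace M] [ChartedSpace E M] [IsManifold 𝓘(ℝ, E) ∞ M]
  {N : Type*} [TopologicalSpace N] [ChartedSpace H' N] [IsManifold J ∞ N]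

theorem isPDiffeo_modelWithCorners :
    IsPDiffeo J 𝓘(ℝ, E') J.toHomeomorph.toOpenPartialHomeomorph := by
  refine ⟨J.contMDiff.contMDiffOn, ?_⟩
  have := J.contMDiffOn_symm (n := ∞)
  rw [J.range_eq_univ] at this
  exact this

/-- A smooth map between finite dimensional manifolds with injective derivatives is an
immersion. -/
theorem isImmersion_of_injective_md {f : M → N} (hf : ContMDiff 𝓘(ℝ, E) J ∞ f)
    (hinj : ∀ x, Function.Injective (md 𝓘(ℝ, E) J f x)) : IsImmersion 𝓘(ℝ, E) J ∞ f := by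
  let k := Module.finrank ℝ E' - Module.finrank ℝ E
  suffices IsImmersionOfComplement (EuclideanSpace ℝ (Fin k)) 𝓘(ℝ, E) J ∞ f from this.isImmersion
  intro x
  let φ := echart 𝓘(ℝ, E) x
  let ψ := echart J (f x)
  have hφ : IsPDiffeo 𝓘(ℝ, E) 𝓘(ℝ, E) φ := isPDiffeo_echart x
  have hψ : IsPDiffeo J 𝓘(ℝ, E') ψ := isPDiffeo_echart (f x)
  have hxφ : x ∈ φ.source := mem_echart_source x
  have hxψ : f x ∈ ψ.source := mem_echart_source (f x)
  let W : Set E := φ.target ∩ φ.symm ⁻¹' (f ⁻¹' ψ.source)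
  have hW : IsOpen W := φ.symm.isOpen_inter_preimage (ψ.open_source.preimage hf.continuous)
  let g : E → E' := fun z => ψ (f (φ.symm z))
  have hg : ContMDiffOn 𝓘(ℝ, E) 𝓘(ℝ, E') ∞ g W :=
    hψ.1.comp (hf.comp_contMDiffOn (hφ.2.mono inter_subset_left)) fun z hz => hz.2
  have hxW : φ x ∈ W := ⟨φ.map_source hxφ, by
    show f (φ.symm (φ x)) ∈ ψ.source
    rwa [φ.left_inv hxφ]⟩
  have hinj' : Function.Injective (fderiv ℝ g (φ x)) := by
    rw [← md_eq_fderiv]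
    have h1 : MDifferentiableAt 𝓘(ℝ, E) 𝓘(ℝ, E) φ.symm (φ x) :=
      hφ.symm.mdiffAt (φ.map_source hxφ)
    have h2 : MDifferentiableAt 𝓘(ℝ, E) J f (φ.symm (φ x)) :=
      hf.mdifferentiableAt (by simp)
    have h3 : MDifferentiableAt J 𝓘(ℝ, E') ψ (f (φ.symm (φ x))) := by
      rw [φ.left_inv hxφ]; exact hψ.mdiffAt hxψ
    rw [md_comp (J := J) (f := fun z => f (φ.symm z)) (φ x) h3 (h2.comp _ h1),
      md_comp (g := f) (f := φ.symm) (φ x) h2 h1, φ.left_inv hxφ]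
    exact (hψ.md_bijective hxψ).injective.comp
      ((hinj x).comp (hφ.symm.md_bijective (φ.map_source hxφ)).injective)
  have hdim : Module.finrank ℝ E + k = Module.finrank ℝ E' := by
    have := LinearMap.finrank_le_finrank_of_injective (f := (fderiv ℝ g (φ x)).toLinearMap) hinj'
    omega
  obtain ⟨q, hq⟩ := exists_coprod_bijective hinj' hdim
  let F := EuclideanSpace ℝ (Fin k)
  let e : (E × F) ≃L[ℝ] E' :=
    (LinearEquiv.ofBijective ((fderiv ℝ g (φ x)).coprod q).toLinearMap hq).toContinuousLinearEquiv
  -- straighten the image with the map `(a, b) ↦ g a + q b`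
  let Θ : E × F → E' := fun z => g z.1 + q z.2
  have hΘ : ContDiffOn ℝ ∞ Θ (Prod.fst ⁻¹' W) :=
    ((contMDiffOn_iff_contDiffOn.1 hg).comp contDiff_fst.contDiffOn fun z hz => hz).add
      (q.contDiff.comp contDiff_snd).contDiffOn
  have hΘd : fderiv ℝ Θ (φ x, 0) = (fderiv ℝ g (φ x)).coprod q := by
    have h1 : HasFDerivAt g (fderiv ℝ g (φ x)) ((φ x, (0 : F)) : E × F).1 :=
      ((contMDiffOn_iff_contDiffOn.1 hg).contDiffAt (hW.mem_nhds hxW)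
        |>.differentiableAt (by simp)).hasFDerivAt
    have h2 := (h1.comp (φ x, (0 : F)) hasFDerivAt_fst).add
      ((q.hasFDerivAt (x := (0 : F))).comp (φ x, (0 : F)) hasFDerivAt_snd)
    rw [show Θ = (g ∘ Prod.fst) + (q ∘ Prod.snd) from rfl, h2.fderiv]
    rfl
  obtain ⟨Φ, hΦx, hΦs, hΦe, hΦ⟩ := exists_isPDiffeo_of_bijective_fderiv
    (hW.preimage continuous_fst) hΘ (x := (φ x, (0 : F))) hxW (by rw [hΘd]; exact hq)
  let D : Set M := φ.source ∩ φ ⁻¹' ((fun a : E => ((a, (0 : F)) : E × F)) ⁻¹' Φ.source)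
  have hD : IsOpen D := φ.isOpen_inter_preimage (Φ.open_source.preimage (by fun_prop))
  let dom : OpenPartialHomeomorph M E := φ.restrOpen D hD
  have hdom : IsPDiffeo 𝓘(ℝ, E) 𝓘(ℝ, E) dom := hφ.restrOpen hD
  have he : IsPDiffeo 𝓘(ℝ, E × F) 𝓘(ℝ, E') e.toHomeomorph.toOpenPartialHomeomorph :=
    ⟨e.contDiff.contMDiff.contMDiffOn, e.symm.contDiff.contMDiff.contMDiffOn⟩
  let cod : OpenPartialHomeomorph N H' := ((ψ.trans Φ.symm).trans
    e.toHomeomorph.toOpenPartialHomeomorph).trans J.toHomeomorph.toOpenPartialHomeomorph.symm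
  have hcod : IsPDiffeo J J cod :=
    ((hψ.trans hΦ.symm).trans he).trans isPDiffeo_modelWithCorners.symm
  have key : ∀ y ∈ D, f y ∈ ψ.source ∧ ψ (f y) = Φ (φ y, 0) := by
    rintro y ⟨hy, hy'⟩
    have h1 : φ y ∈ W := hΦs hy'
    have h2 : f (φ.symm (φ y)) ∈ ψ.source := h1.2
    rw [φ.left_inv hy] at h2
    refine ⟨h2, ?_⟩
    simp [hΦe, Θ, g, φ.left_inv hy]
  have hxD : x ∈ D := ⟨hxφ, hΦx⟩
  refine IsImmersionAtOfComplement.mk_of_continuousAt hf.continuous.continuousAt e dom cod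
    ⟨hxφ, hxD⟩ ?_ ((IsManifold.mem_maximalAtlas_iff_contMDiffOn dom).2 hdom)
    ((IsManifold.mem_maximalAtlas_iff_contMDiffOn cod).2 hcod) ?_
  · simp only [cod, OpenPartialHomeomorph.trans_source]
    refine ⟨⟨⟨hxψ, ?_⟩, trivial⟩, trivial⟩
    show ψ (f x) ∈ Φ.target
    rw [(key x hxD).2]
    exact Φ.map_source hΦx
  · intro z hz
    have hz' : z ∈ dom.target := by simpa using hz
    have hy : dom.symm z ∈ D := (dom.map_target hz').2
    have hz2 : φ (dom.symm z) = z := dom.right_inv hz'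
    have : (dom.extend 𝓘(ℝ, E)).symm z = dom.symm z := by simp
    simp only [Function.comp]
    rw [this]
    have h3 : (cod.extend J) (f (dom.symm z)) = e (Φ.symm (ψ (f (dom.symm z)))) := by
      simp only [cod, OpenPartialHomeomorph.extend_coe, Function.comp,
        OpenPartialHomeomorph.coe_trans]
      exact J.right_inv (by rw [J.range_eq_univ]; trivial)
    rw [h3, (key _ hy).2, Φ.left_inv hy.2, hz2]

/-- A smooth map between finite dimensional manifolds with surjective derivatives is a
submersion. -/
theorem isSubmersion_of_surjective_md {N : Type*} [TopologicalSpace N] [ChartedSpace E' N]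
    [IsManifold 𝓘(ℝ, E') ∞ N]
    {f : M → N} (hf : ContMDiff 𝓘(ℝ, E) 𝓘(ℝ, E') ∞ f)
    (hsurj : ∀ x, Function.Surjective (md 𝓘(ℝ, E) 𝓘(ℝ, E') f x)) :
    IsSubmersion 𝓘(ℝ, E) 𝓘(ℝ, E') ∞ f := by
  let k := Module.finrank ℝ E - Module.finrank ℝ E'
  suffices IsSubmersionOfComplement (EuclideanSpace ℝ (Fin k)) 𝓘(ℝ, E) 𝓘(ℝ, E') ∞ f from
    this.isSubmersion
  intro x
  have hdim : k + Module.finrank ℝ E' = Module.finrank ℝ E := by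
    have := LinearMap.finrank_le_finrank_of_surjective
      (f := (md 𝓘(ℝ, E) 𝓘(ℝ, E') f x).toLinearMap) (hsurj x)
    omega
  let ψ := echart 𝓘(ℝ, E') (f x)
  have hψ : IsPDiffeo 𝓘(ℝ, E') 𝓘(ℝ, E') ψ := isPDiffeo_echart (f x)
  have hxψ : f x ∈ ψ.source := mem_echart_source (f x)
  have hU : IsOpen (f ⁻¹' ψ.source) := ψ.open_source.preimage hf.continuous
  have hF : ContMDiffOn 𝓘(ℝ, E) 𝓘(ℝ, E') ∞ (fun y => ψ (f y)) (f ⁻¹' ψ.source) :=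
    hψ.1.comp hf.contMDiffOn fun y hy => hy
  have hs : Function.Surjective (md 𝓘(ℝ, E) 𝓘(ℝ, E') (fun y => ψ (f y)) x) := by
    rw [md_comp x (hψ.mdiffAt hxψ) (hf.mdifferentiableAt (by simp))]
    exact (hψ.md_bijective hxψ).surjective.comp (hsurj x)
  obtain ⟨Ψ, h1, h2, h3, h4⟩ := exists_slice hU hF (x := x) hxψ hs hdim
  let F := EuclideanSpace ℝ (Fin k)
  let e : E ≃L[ℝ] (E' × F) := (LinearEquiv.ofFinrankEq _ _ (by
    simp only [Module.finrank_prod, F, finrank_euclideanSpace, Fintype.card_fin]; omega)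
    ).toContinuousLinearEquiv
  have he : IsPDiffeo 𝓘(ℝ, E' × F) 𝓘(ℝ, E) e.symm.toHomeomorph.toOpenPartialHomeomorph :=
    ⟨e.symm.contDiff.contMDiff.contMDiffOn, e.contDiff.contMDiff.contMDiffOn⟩
  let dom := Ψ.trans e.symm.toHomeomorph.toOpenPartialHomeomorph
  have hdom : IsPDiffeo 𝓘(ℝ, E) 𝓘(ℝ, E) dom := h3.trans he
  refine IsSubmersionAtOfComplement.mk_of_continuousAt hf.continuous.continuousAt e dom ψ
    ⟨h1, trivial⟩ hxψ ((IsManifold.mem_maximalAtlas_iff_contMDiffOn dom).2 hdom)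
    ((IsManifold.mem_maximalAtlas_iff_contMDiffOn ψ).2 hψ) ?_
  intro z hz
  have hz' : z ∈ dom.target := by simpa using hz
  have hy : dom.symm z ∈ Ψ.source := (dom.map_target hz').1
  have hz2 : e.symm (Ψ (dom.symm z)) = z := dom.right_inv hz'
  have : (dom.extend 𝓘(ℝ, E)).symm z = dom.symm z := by simp
  simp only [Function.comp]
  rw [this, OpenPartialHomeomorph.extend_coe]
  show ψ (f (dom.symm z)) = _
  rw [← h4 _ hy, ← e.symm_apply_eq.1 hz2]

end ImmersionCriterion

/-! ### Submanifolds -/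

section Submanifold

variable {E : Type*} [NormedAddCommGroup E] [NormedSpace ℝ E] [FiniteDimensional ℝ E]
  {M : Type*} [TopologicalSpace M] [ChartedSpace E M] [IsManifold 𝓘(ℝ, E) ∞ M]
  {N : Type*} [TopologicalSpace N]

/-- Data which make a topological space `N` with a map `j : N → M` to a manifold into a
`k`-dimensional manifold such that `j` is an immersion: charts of `N` such that `j` is smooth in
these charts, and which extend to smooth maps on open subsets of `M`. -/
structure SubmanifoldAtlas (E : Type*) [NormedAddCommGroup E] [NormedSpace ℝ E]
    {M : Type*} [TopologicalSpace M] [ChartedSpace E M]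
    {N : Type*} [TopologicalSpace N] (j : N → M) (k : ℕ) where
  chart : N → OpenPartialHomeomorph N (EuclideanSpace ℝ (Fin k))
  mem_source : ∀ n, n ∈ (chart n).source
  /-- An extension of the chart to an open subset `dom` of `M`. -/
  ext : N → M → EuclideanSpace ℝ (Fin k)
  dom : N → Set M
  isOpen_dom : ∀ n, IsOpen (dom n)
  mapsTo_dom : ∀ n, ∀ y ∈ (chart n).source, j y ∈ dom n
  smooth_symm : ∀ n, ContMDiffOn (𝓡 k) 𝓘(ℝ, E) ∞ (fun z => j ((chart n).symm z)) (chart n).target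
  smooth_ext : ∀ n, ContMDiffOn 𝓘(ℝ, E) (𝓡 k) ∞ (ext n) (dom n)
  ext_eq : ∀ n, ∀ y ∈ (chart n).source, ext n (j y) = chart n y

namespace SubmanifoldAtlas

variable {j : N → M} {k : ℕ} (A : SubmanifoldAtlas E j k)

/-- The manifold structure given by a submanifold atlas. -/
@[reducible] def chartedSpace : ChartedSpace (EuclideanSpace ℝ (Fin k)) N where
  atlas := range A.chart
  chartAt := A.chart
  mem_chart_source := A.mem_source
  chart_mem_atlas n := mem_range_self n

theorem isManifold : letI := A.chartedSpace; IsManifold (𝓡 k) ∞ N := by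
  let := A.chartedSpace
  refine isManifold_of_contDiffOn _ _ _ ?_
  rintro _ _ ⟨n, rfl⟩ ⟨n', rfl⟩
  simp only [modelWithCornersSelf_coe, modelWithCornersSelf_coe_symm, Function.comp_id,
    Function.id_comp, preimage_id, range_id, inter_univ]
  have h : ContMDiffOn (𝓡 k) (𝓡 k) ∞ (fun z => A.ext n' (j ((A.chart n).symm z)))
      ((A.chart n).symm.trans (A.chart n')).source := by
    refine (A.smooth_ext n').comp ((A.smooth_symm n).mono ?_) ?_
    · intro z hz; exact hz.1
    · intro z hz; exact A.mapsTo_dom n' _ hz.2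
  exact (contMDiffOn_iff_contDiffOn.1 h).congr fun z hz => (A.ext_eq n' _ hz.2).symm

theorem contMDiff : letI := A.chartedSpace; ContMDiff (𝓡 k) 𝓘(ℝ, E) ∞ j := by
  let := A.chartedSpace
  have := A.isManifold
  intro n
  have h1 : ContMDiffOn (𝓡 k) (𝓡 k) ∞ (A.chart n) (A.chart n).source := contMDiffOn_chart (x := n)
  have h2 := ((A.smooth_symm n).comp h1 fun y hy => (A.chart n).map_source hy).congr
    (f₁ := j) fun y hy => by simp [Function.comp, (A.chart n).left_inv hy]
  exact h2.contMDiffAt ((A.chart n).open_source.mem_nhds (A.mem_source n))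

theorem injective_md : letI := A.chartedSpace; ∀ n, Function.Injective (md (𝓡 k) 𝓘(ℝ, E) j n) := by
  let := A.chartedSpace
  have := A.isManifold
  intro n
  have h1 : ContMDiffOn (𝓡 k) (𝓡 k) ∞ (A.chart n) (A.chart n).source := contMDiffOn_chart (x := n)
  have h2 : ContMDiffOn (𝓡 k) (𝓡 k) ∞ (A.chart n).symm (A.chart n).target :=
    contMDiffOn_chart_symm (x := n)
  have hb : Function.Bijective (md (𝓡 k) (𝓡 k) (A.chart n) n) :=
    IsPDiffeo.md_bijective ⟨h1, h2⟩ (A.mem_source n)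
  rw [md_congr_of_isOpen (A.chart n).open_source (g := fun y => A.ext n (j y))
    (fun y hy => (A.ext_eq n y hy).symm) (A.mem_source n),
    md_comp n (ContMDiffOn.mdiffAt (A.smooth_ext n) (A.isOpen_dom n)
      (A.mapsTo_dom n n (A.mem_source n))) (A.contMDiff.mdifferentiableAt (by simp))] at hb
  exact Function.Injective.of_comp hb.injective

theorem isImmersion : letI := A.chartedSpace; Manifold.IsImmersion (𝓡 k) 𝓘(ℝ, E) ∞ j := by
  let := A.chartedSpace
  have := A.isManifold
  exact isImmersion_of_injective_md A.contMDiff A.injective_md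

end SubmanifoldAtlas

/-- Construction of a submanifold atlas from slice charts: around each point `n` of `N` there is an
open set `D` which `j` maps homeomorphically onto a level set `{y | (Ψ y).1 = a}`, where `Ψ` is a
chart of `M` with values in a product. The map `ι` is the inverse of `j` on the level set. -/
theorem exists_submanifoldAtlas {j : N → M} (hj : Continuous j) {k : ℕ}
    {V : Type*} [NormedAddCommGroup V] [NormedSpace ℝ V]
    (h : ∀ n : N, ∃ (Ψ : OpenPartialHomeomorph M (V × EuclideanSpace ℝ (Fin k))) (a : V)
      (D : Set N) (ι : M → N),
      IsPDiffeo 𝓘(ℝ, E) 𝓘(ℝ, V × EuclideanSpace ℝ (Fin k)) Ψ ∧ n ∈ D ∧ IsOpen D ∧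
      (∀ y ∈ D, j y ∈ Ψ.source ∧ (Ψ (j y)).1 = a ∧ ι (j y) = y) ∧
      (∀ m ∈ Ψ.source, (Ψ m).1 = a → ι m ∈ D ∧ j (ι m) = m) ∧
      ContinuousOn ι {m | m ∈ Ψ.source ∧ (Ψ m).1 = a}) :
    Nonempty (SubmanifoldAtlas E j k) := by
  choose Ψ a D ι hΨ hnD hD h1 h2 hι using h
  have hc : ∀ n, Continuous (fun z : EuclideanSpace ℝ (Fin k) => (a n, z)) := fun n => by fun_prop
  have hsl : ∀ n z, (a n, z) ∈ (Ψ n).target →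
      (Ψ n).symm (a n, z) ∈ (Ψ n).source ∧ (Ψ n ((Ψ n).symm (a n, z))).1 = a n := fun n z hz =>
    ⟨(Ψ n).map_target hz, by rw [(Ψ n).right_inv hz]⟩
  have hsymm : ∀ n, ContMDiffOn (𝓡 k) 𝓘(ℝ, E) ∞ (fun z => (Ψ n).symm (a n, z))
      {z | (a n, z) ∈ (Ψ n).target} := fun n =>
    (hΨ n).2.comp (t := (Ψ n).target) (f := fun z => (a n, z))
      ((contDiff_const.prodMk contDiff_id).contMDiff.contMDiffOn) fun z hz => hz
  let c : N → OpenPartialHomeomorph N (EuclideanSpace ℝ (Fin k)) := fun n =>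
    { toFun := fun y => (Ψ n (j y)).2
      invFun := fun z => ι n ((Ψ n).symm (a n, z))
      source := D n
      target := {z | (a n, z) ∈ (Ψ n).target}
      map_source' := fun y hy => by
        obtain ⟨hy1, hy2, -⟩ := h1 n y hy
        show (a n, (Ψ n (j y)).2) ∈ (Ψ n).target
        rw [← hy2]; exact (Ψ n).map_source hy1
      map_target' := fun z hz => (h2 n _ (hsl n z hz).1 (hsl n z hz).2).1
      left_inv' := fun y hy => by
        obtain ⟨hy1, hy2, hy3⟩ := h1 n y hy
        have : (a n, (Ψ n (j y)).2) = Ψ n (j y) := by rw [← hy2]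
        simp only [this, (Ψ n).left_inv hy1, hy3]
      right_inv' := fun z hz => by
        simp only [(h2 n _ (hsl n z hz).1 (hsl n z hz).2).2]
        rw [(Ψ n).right_inv hz]
      open_source := hD n
      open_target := (Ψ n).open_target.preimage (hc n)
      continuousOn_toFun := continuous_snd.comp_continuousOn
        ((Ψ n).continuousOn.comp hj.continuousOn fun y hy => (h1 n y hy).1)
      continuousOn_invFun := (hι n).comp (hsymm n).continuousOn fun z hz => hsl n z hz }
  refine ⟨{
    chart := c
    mem_source := hnD
    ext := fun n m => (Ψ n m).2
    dom := fun n => (Ψ n).source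
    isOpen_dom := fun n => (Ψ n).open_source
    mapsTo_dom := fun n y hy => (h1 n y hy).1
    smooth_symm := fun n => ?_
    smooth_ext := fun n => ?_
    ext_eq := fun n y hy => rfl }⟩
  · exact (hsymm n).congr fun z hz => (h2 n _ (hsl n z hz).1 (hsl n z hz).2).2
  · exact contDiff_snd.contMDiff.comp_contMDiffOn (hΨ n).1

/-- A subspace of a manifold which is locally the first level set of a chart with values in a
product is a submanifold. -/
theorem exists_submanifoldAtlas_of_isInducing {j : N → M} (hj : IsInducing j)
    (hinj : Function.Injective j) {k : ℕ}
    {V : Type*} [NormedAddCommGroup V] [NormedSpace ℝ V]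
    (h : ∀ n : N, ∃ (Ψ : OpenPartialHomeomorph M (V × EuclideanSpace ℝ (Fin k))) (a : V),
      IsPDiffeo 𝓘(ℝ, E) 𝓘(ℝ, V × EuclideanSpace ℝ (Fin k)) Ψ ∧ j n ∈ Ψ.source ∧
      ∀ m ∈ Ψ.source, m ∈ range j ↔ (Ψ m).1 = a) :
    Nonempty (SubmanifoldAtlas E j k) := by
  refine exists_submanifoldAtlas (V := V) hj.continuous fun n => ?_
  obtain ⟨Ψ, a, hΨ, hn, hr⟩ := h n
  have : Nonempty N := ⟨n⟩
  refine ⟨Ψ, a, j ⁻¹' Ψ.source, Function.invFun j, hΨ, hn, Ψ.open_source.preimage hj.continuous,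
    fun y hy => ⟨hy, (hr _ hy).1 ⟨y, rfl⟩, Function.leftInverse_invFun hinj y⟩, fun m hm hma => ?_,
        ?_⟩
  · have : j (Function.invFun j m) = m := Function.invFun_eq ((hr m hm).2 hma)
    exact ⟨by rwa [mem_preimage, this], this⟩
  · rw [hj.continuousOn_iff]
    exact continuousOn_id.congr fun m hm => Function.invFun_eq ((hr m hm.1).2 hm.2)

end Submanifold

section Initial

open Manifold

variable {E : Type*} [NormedAddCommGroup E] [NormedSpace ℝ E]
  {E' : Type*} [NormedAddCommGroup E'] [NormedSpace ℝ E']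
  {E'' : Type*} [NormedAddCommGroup E''] [NormedSpace ℝ E'']
  {H : Type*} [TopologicalSpace H] {H' : Type*} [TopologicalSpace H']
  {H'' : Type*} [TopologicalSpace H'']
  {I : ModelWithCorners ℝ E H} {J : ModelWithCorners ℝ E' H'} {L : ModelWithCorners ℝ E'' H''}
  {M : Type*} [TopologicalSpace M] [ChartedSpace H M]
  {N : Type*} [TopologicalSpace N] [ChartedSpace H' N]
  {Q : Type*} [TopologicalSpace Q] [ChartedSpace H'' Q]

/-- A map into an embedded manifold is smooth if it is smooth as a map into the ambient
manifold. -/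
theorem contMDiffOn_of_isImmersion_of_isInducing {j : N → Q} (hj : IsImmersion J L ∞ j)
    (hj' : IsInducing j) {f : M → N} {U : Set M} (hU : IsOpen U)
    (hf : ContMDiffOn I L ∞ (fun x => j (f x)) U) : ContMDiffOn I J ∞ f U := by
  have hc : ContinuousOn f U := hj'.continuousOn_iff.2 hf.continuousOn
  intro x hx
  refine ContMDiffAt.contMDiffWithinAt ?_
  exact (ContMDiffAt.iff_comp_isImmersionAt (hj.isImmersionAt (f x))).2
    ⟨hc.continuousAt (hU.mem_nhds hx), hf.contMDiffAt (hU.mem_nhds hx)⟩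

theorem contMDiff_of_isImmersion_of_isInducing {j : N → Q} (hj : IsImmersion J L ∞ j)
    (hj' : IsInducing j) {f : M → N}
    (hf : ContMDiff I L ∞ (fun x => j (f x))) : ContMDiff I J ∞ f :=
  contMDiffOn_univ.1 (contMDiffOn_of_isImmersion_of_isInducing hj hj' isOpen_univ
    (contMDiffOn_univ.2 hf))

end Initial

section LieSubgroup

open Manifold

variable {E : Type*} [NormedAddCommGroup E] [NormedSpace ℝ E]
  {E' : Type*} [NormedAddCommGroup E'] [NormedSpace ℝ E']
  {K : Type*} [Group K] [TopologicalSpace K] [ChartedSpace E K]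
  [IsManifold 𝓘(ℝ, E) ∞ K]
  {G : Type*} [Group G] [TopologicalSpace G] [ChartedSpace E' G] [LieGroup 𝓘(ℝ, E') ∞ G]

/-- An embedded manifold which is a subgroup is a Lie group. -/
theorem lieGroup_of_isSmoothEmbedding (j : K →* G) (hj : IsSmoothEmbedding 𝓘(ℝ, E) 𝓘(ℝ, E') ∞ j) :
    LieGroup 𝓘(ℝ, E) ∞ K where
  contMDiff_mul := by
    refine contMDiff_of_isImmersion_of_isInducing hj.isImmersion hj.isEmbedding.isInducing ?_
    simp only [map_mul]
    exact (hj.contMDiff.comp contMDiff_fst).mul (hj.contMDiff.comp contMDiff_snd)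
  contMDiff_inv := by
    refine contMDiff_of_isImmersion_of_isInducing hj.isImmersion hj.isEmbedding.isInducing ?_
    simp only [map_inv]
    exact hj.contMDiff.inv

end LieSubgroup

/-! ### Orbits of Lie group actions -/

section Auxiliary

variable {E : Type*} [NormedAddCommGroup E] [NormedSpace ℝ E]
  {E' : Type*} [NormedAddCommGroup E'] [NormedSpace ℝ E']
  {H : Type*} [TopologicalSpace H] {H' : Type*} [TopologicalSpace H']
  {I : ModelWithCorners ℝ E H} {J : ModelWithCorners ℝ E' H'}
  {M : Type*} [TopologicalSpace M] [ChartedSpace H M]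
  {N : Type*} [TopologicalSpace N] [ChartedSpace H' N]

theorem md_bijective_of_inverse {f : M → N} {g : N → M} (hf : ContMDiff I J ∞ f)
    (hg : ContMDiff J I ∞ g) (hgf : ∀ x, g (f x) = x) (hfg : ∀ y, f (g y) = y) (x : M) :
    Function.Bijective (md I J f x) := by
  have hf' : ∀ x, MDifferentiableAt I J f x := fun x => hf.mdifferentiableAt (by simp)
  have hg' : ∀ x, MDifferentiableAt J I g x := fun x => hg.mdifferentiableAt (by simp)
  refine Function.bijective_iff_has_inverse.2 ⟨md J I g (f x), fun v => ?_, fun v => ?_⟩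
  · rw [← md_comp_apply x (hg' _) (hf' _)]
    simp only [hgf, md_id]; rfl
  · have := md_comp_apply (f x) (hf' (g (f x))) (hg' (f x)) v
    rw [hgf x] at this
    rw [← this]
    simp only [hfg, md_id]; rfl

/-- The derivative of an immersion is injective. -/
theorem injective_md_of_isImmersion [J.Boundaryless] [IsManifold J ∞ N]
    {M : Type*} [TopologicalSpace M] [ChartedSpace E M] [IsManifold 𝓘(ℝ, E) ∞ M] {f : M → N}
    (hf : Manifold.IsImmersion 𝓘(ℝ, E) J ∞ f) (x : M) :
    Function.Injective (md 𝓘(ℝ, E) J f x) := by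
  have h := hf.isImmersionAt x
  let dom := h.domChart
  let cod := h.codChart
  have hdom := (IsManifold.mem_maximalAtlas_iff_contMDiffOn dom).1 h.domChart_mem_maximalAtlas
  have hdom' : IsPDiffeo 𝓘(ℝ, E) 𝓘(ℝ, E) dom := hdom
  have hcod : ContMDiffOn J 𝓘(ℝ, E') ∞ (cod.extend J) cod.source :=
    OpenPartialHomeomorph.contMDiffOn_extend h.codChart_mem_maximalAtlas
  have hx : x ∈ dom.source := h.mem_domChart_source
  have hfx : f x ∈ cod.source := h.mem_codChart_source
  have key : ∀ y ∈ dom.source, cod.extend J (f y) = h.equiv (dom y, 0) := by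
    intro y hy
    have hmem : dom y ∈ (h.domChart.extend 𝓘(ℝ, E)).target := by
      rw [OpenPartialHomeomorph.extend_target]
      exact ⟨by simpa using dom.map_source hy, by simp⟩
    have := h.writtenInCharts hmem
    simp only [Function.comp] at this
    rw [← this]
    congr 2
    simpa [dom] using (dom.left_inv hy).symm
  let e : E →L[ℝ] E' := (h.equiv : (E × h.complement) →L[ℝ] E').comp
    (ContinuousLinearMap.inl ℝ E h.complement)
  have he : Function.Injective e := by
    intro v w hvw
    have : h.equiv (v, 0) = h.equiv (w, 0) := by simpa [e] using hvw
    exact congrArg Prod.fst (h.equiv.injective this)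
  have h1 : md 𝓘(ℝ, E) 𝓘(ℝ, E') (fun y => cod.extend J (f y)) x = e.comp (md 𝓘(ℝ, E)
      𝓘(ℝ, E) dom x) := by
    rw [md_congr_of_isOpen dom.open_source (g := fun y => e (dom y))
      (fun y hy => by rw [key y hy]; simp [e]) hx,
      md_comp x (e.contMDiff.mdifferentiableAt (n := ∞) (by simp)) (hdom'.mdiffAt hx), md_eq_fderiv,
      e.fderiv]
  have h2 : Function.Injective (md 𝓘(ℝ, E) 𝓘(ℝ, E') (fun y => cod.extend J (f y)) x) := by
    rw [h1]; exact he.comp (hdom'.md_bijective hx).injective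
  rw [md_comp x (ContMDiffOn.mdiffAt hcod cod.open_source hfx)
    (hf.contMDiff.mdifferentiableAt (by simp))] at h2
  exact Function.Injective.of_comp h2

/-- A smooth function with vanishing derivative is locally constant. -/
theorem eventually_eq_of_md_eq_zero [I.Boundaryless] [IsManifold I ∞ M] {g : M → E'} {U : Set M}
    (hU : IsOpen U) (hg : ContMDiffOn I 𝓘(ℝ, E') ∞ g U) (h0 : ∀ x ∈ U, md I 𝓘(ℝ, E') g x = 0)
    {x : M} (hx : x ∈ U) : ∀ᶠ y in 𝓝 x, g y = g x := by
  let φ := echart I x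
  have hφ : IsPDiffeo I 𝓘(ℝ, E) φ := isPDiffeo_echart x
  have hxφ : x ∈ φ.source := mem_echart_source x
  let W : Set E := φ.target ∩ φ.symm ⁻¹' U
  have hW : IsOpen W := φ.symm.isOpen_inter_preimage hU
  have hxW : φ x ∈ W := ⟨φ.map_source hxφ, by show φ.symm (φ x) ∈ U; rwa [φ.left_inv hxφ]⟩
  let k : E → E' := fun z => g (φ.symm z)
  have hk : ContMDiffOn 𝓘(ℝ, E) 𝓘(ℝ, E') ∞ k W :=
    hg.comp (hφ.2.mono inter_subset_left) fun z hz => hz.2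
  obtain ⟨ε, hε, hball⟩ := Metric.isOpen_iff.1 hW _ hxW
  have hconst : ∀ z ∈ Metric.ball (φ x) ε, k z = k (φ x) := by
    intro z hz
    refine IsOpen.is_const_of_fderiv_eq_zero Metric.isOpen_ball
      (convex_ball (φ x) ε).isPreconnected
      (((contMDiffOn_iff_contDiffOn.1 hk).mono hball).differentiableOn (by simp)) ?_ hz
      (Metric.mem_ball_self hε)
    intro z hz
    have hzW := hball hz
    rw [← md_eq_fderiv, md_comp z (ContMDiffOn.mdiffAt hg hU hzW.2) (hφ.symm.mdiffAt hzW.1),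
      h0 _ hzW.2]
    simp
  have : φ ⁻¹' Metric.ball (φ x) ε ∈ 𝓝 x :=
    (φ.continuousAt hxφ).preimage_mem_nhds (Metric.ball_mem_nhds _ hε)
  filter_upwards [this, φ.open_source.mem_nhds hxφ] with y hy hy'
  have := hconst _ hy
  simpa [k, φ.left_inv hy', φ.left_inv hxφ] using this

/-- Locally constant maps on second countable spaces have countably many values. -/
theorem countable_image_of_eventually_eq {X Y : Type*} [TopologicalSpace X]
    [SecondCountableTopology X] {g : X → Y} {U : Set X}
    (h : ∀ x ∈ U, ∀ᶠ y in 𝓝 x, g y = g x) : (g '' U).Countable := by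
  obtain ⟨t, htU, htc, ht⟩ := TopologicalSpace.countable_cover_nhdsWithin
    (f := fun x => {y | g y = g x}) (s := U) fun x hx => mem_nhdsWithin_of_mem_nhds (h x hx)
  refine (htc.image g).mono ?_
  rintro _ ⟨x, hx, rfl⟩
  obtain ⟨y, hy, hxy⟩ := mem_iUnion₂.1 (ht hx)
  exact ⟨y, hy, hxy.symm⟩

/-- Continuous maps with countably many values are constant on connected sets, as countable subsets
of a metric space are totally disconnected. -/
theorem eqOn_of_countable {X Y : Type*} [TopologicalSpace X] [MetricSpace Y] {g : X → Y}
    {U : Set X} (hU : IsPreconnected U) (hg : ContinuousOn g U) {A : Set Y} (hA : A.Countable)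
    (h : MapsTo g U A) {x y : X} (hx : x ∈ U) (hy : y ∈ U) : g x = g y :=
  hA.isTotallyDisconnected (g '' U) (image_subset_iff.2 h) (hU.image g hg)
    (mem_image_of_mem g hx) (mem_image_of_mem g hy)

/-- A linear map of rank `r` is injective on some `r`-dimensional subspace. -/
theorem exists_injective_comp {L : E →L[ℝ] E'} [FiniteDimensional ℝ E] [FiniteDimensional ℝ E']
    {r : ℕ} (hr : Module.finrank ℝ (LinearMap.range L.toLinearMap) = r) :
    ∃ i : EuclideanSpace ℝ (Fin r) →L[ℝ] E, Function.Injective (L.comp i) := by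
  obtain ⟨s, hs⟩ := L.toLinearMap.rangeRestrict.exists_rightInverse_of_surjective
    L.toLinearMap.range_rangeRestrict
  let e : EuclideanSpace ℝ (Fin r) ≃ₗ[ℝ] LinearMap.range L.toLinearMap :=
    LinearEquiv.ofFinrankEq _ _ (by simp [hr])
  refine ⟨(s.comp e.toLinearMap).toContinuousLinearMap, fun v w hvw => ?_⟩
  have h : ∀ v, L (s (e v)) = (e v : E') := fun v =>
    congrArg Subtype.val (LinearMap.congr_fun hs (e v))
  have : L (s (e v)) = L (s (e w)) := hvw
  rw [h, h] at this
  exact e.injective (Subtype.ext this)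

end Auxiliary

section Orbits

variable {EH : Type*} [NormedAddCommGroup EH] [NormedSpace ℝ EH] [FiniteDimensional ℝ EH]
  {EO : Type*} [NormedAddCommGroup EO] [NormedSpace ℝ EO] [FiniteDimensional ℝ EO]
  {H : Type*} [Group H] [TopologicalSpace H] [ChartedSpace EH H] [LieGroup 𝓘(ℝ, EH) ∞ H]
  {O : Type*} [TopologicalSpace O] [ChartedSpace EO O] [IsManifold 𝓘(ℝ, EO) ∞ O]
  [MulAction H O] [ContMDiffSMul 𝓘(ℝ, EH) 𝓘(ℝ, EO) ∞ H O]

variable (EH EO H) in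
theorem contMDiff_orbitMap (α : O) : ContMDiff 𝓘(ℝ, EH) 𝓘(ℝ, EO) ∞ (fun h : H => h • α) :=
  contMDiff_id.smul contMDiff_const

theorem contMDiff_const_smul' (EH : Type*) [NormedAddCommGroup EH] [NormedSpace ℝ EH]
    [ChartedSpace EH H] [ContMDiffSMul 𝓘(ℝ, EH) 𝓘(ℝ, EO) ∞ H O] (h : H) :
    ContMDiff 𝓘(ℝ, EO) 𝓘(ℝ, EO) ∞ (fun β : O => h • β) :=
  ContMDiffSMul.contMDiff_const_smul (I := 𝓘(ℝ, EH)) h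

theorem md_const_smul_bijective (EH : Type*) [NormedAddCommGroup EH] [NormedSpace ℝ EH]
    [ChartedSpace EH H] [ContMDiffSMul 𝓘(ℝ, EH) 𝓘(ℝ, EO) ∞ H O] (h : H) (β : O) :
    Function.Bijective (md 𝓘(ℝ, EO) 𝓘(ℝ, EO) (fun β : O => h • β) β) :=
  md_bijective_of_inverse (contMDiff_const_smul' (O := O) EH h) (contMDiff_const_smul' EH h⁻¹)
    (fun x => by simp) (fun x => by simp) β

variable (EH) in
theorem md_mul_left_bijective (h x : H) :
    Function.Bijective (md 𝓘(ℝ, EH) 𝓘(ℝ, EH) (fun y : H => h * y) x) :=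
  md_bijective_of_inverse contMDiff_mul_left (contMDiff_mul_left (a := h⁻¹))
    (fun x => by simp) (fun x => by simp) x

/-- The derivative of the orbit map at `h * x` in terms of the one at `x`. -/
theorem md_orbitMap_mul (α : O) (h x : H) (v : EH) :
    md 𝓘(ℝ, EH) 𝓘(ℝ, EO) (fun h : H => h • α) (h * x)
      (md 𝓘(ℝ, EH) 𝓘(ℝ, EH) (fun y : H => h * y) x v) =
    md 𝓘(ℝ, EO) 𝓘(ℝ, EO) (fun β : O => h • β) (x • α)
      (md 𝓘(ℝ, EH) 𝓘(ℝ, EO) (fun h : H => h • α) x v) := by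
  have h1 := contMDiff_orbitMap EH EO H α
  have h3 : ContMDiff 𝓘(ℝ, EO) 𝓘(ℝ, EO) ∞ (fun β : O => h • β) := contMDiff_const_smul' EH h
  have h2 := contMDiff_mul_left (I := 𝓘(ℝ, EH)) (n := ∞) (a := h)
  rw [← md_comp_apply (g := fun h : H => h • α) (f := fun y : H => h * y) x
      (h1.mdifferentiableAt (by simp)) (h2.mdifferentiableAt (by simp)),
    ← md_comp_apply (g := fun β : O => h • β) (f := fun h : H => h • α) x
      (h3.mdifferentiableAt (by simp)) (h1.mdifferentiableAt (by simp))]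
  simp only [mul_smul]

/-- Orbit maps have constant rank, as they are equivariant for left translations. -/
theorem finrank_range_md_orbitMap (α : O) (h : H) :
    Module.finrank ℝ (LinearMap.range (md 𝓘(ℝ, EH) 𝓘(ℝ, EO) (fun h : H => h • α) h).toLinearMap) =
    Module.finrank ℝ
      (LinearMap.range (md 𝓘(ℝ, EH) 𝓘(ℝ, EO) (fun h : H => h • α) 1).toLinearMap) := by
  set D1 := md 𝓘(ℝ, EH) 𝓘(ℝ, EO) (fun h : H => h • α) 1
  set D2 := md 𝓘(ℝ, EH) 𝓘(ℝ, EO) (fun h : H => h • α) h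
  set A := md 𝓘(ℝ, EH) 𝓘(ℝ, EH) (fun y : H => h * y) 1
  set B := md 𝓘(ℝ, EO) 𝓘(ℝ, EO) (fun β : O => h • β) α
  have hA : Function.Bijective A := md_mul_left_bijective EH h 1
  have hB : Function.Bijective B := md_const_smul_bijective EH h α
  have hk : ∀ v, D2 (A v) = B (D1 v) := by
    intro v
    have := md_orbitMap_mul (EO := EO) α h (1 : H) v
    rw [mul_one, one_smul] at this
    exact this
  have hr : LinearMap.range D2.toLinearMap =
      (LinearMap.range D1.toLinearMap).map B.toLinearMap := by
    ext w
    constructor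
    · rintro ⟨v, rfl⟩
      obtain ⟨v', rfl⟩ := hA.2 v
      exact ⟨D1 v', ⟨v', rfl⟩, (hk v').symm⟩
    · rintro ⟨_, ⟨v, rfl⟩, rfl⟩
      exact ⟨A v, hk v⟩
  rw [hr]
  exact (LinearEquiv.finrank_eq (Submodule.equivMapOfInjective B.toLinearMap hB.1 _)).symm

/-- A chart of `O` around `α` adapted to the orbits of `H`: its first component parametrizes a
piece of the orbit of `α`, the second one is a transversal to it. The map `κ` translates points
along the orbits into the transversal `{β | (θ β).1 = 0}`. The last two fields say that, at all
points of the domain which lie on the orbit of `α`, the tangent space of this orbit is the first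
factor. -/
structure OrbitChart (EH EO : Type*) [NormedAddCommGroup EH] [NormedSpace ℝ EH]
    [NormedAddCommGroup EO] [NormedSpace ℝ EO]
    (H : Type*) [Group H] [TopologicalSpace H] [ChartedSpace EH H]
    {O : Type*} [TopologicalSpace O] [ChartedSpace EO O] [MulAction H O] (α : O) (r m : ℕ) where
  θ : OpenPartialHomeomorph O (EuclideanSpace ℝ (Fin r) × EuclideanSpace ℝ (Fin m))
  isPDiffeo : IsPDiffeo 𝓘(ℝ, EO) 𝓘(ℝ, EuclideanSpace ℝ (Fin r) × EuclideanSpace ℝ (Fin m)) θ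
  mem_source : α ∈ θ.source
  map_base : θ α = 0
  ε : ℝ
  ε_pos : 0 < ε
  target_eq : θ.target = Metric.ball 0 ε
  κ : O → H
  smooth_κ : ContMDiffOn 𝓘(ℝ, EO) 𝓘(ℝ, EH) ∞ κ θ.source
  κ_base : κ α = 1
  κ_mem : ∀ β ∈ θ.source, (κ β)⁻¹ • β ∈ θ.source
  κ_eq : ∀ β ∈ θ.source, θ ((κ β)⁻¹ • β) = (0, (θ β).2)
  exists_md_eq : ∀ p : H, p • α ∈ θ.source → ∀ v, ∃ X : EH,
    md 𝓘(ℝ, EH) 𝓘(ℝ, EuclideanSpace ℝ (Fin r) × EuclideanSpace ℝ (Fin m))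
      (fun h : H => θ (h • α)) p X = (v, 0)
  md_snd_eq : ∀ p : H, p • α ∈ θ.source → ∀ X : EH,
    (md 𝓘(ℝ, EH) 𝓘(ℝ, EuclideanSpace ℝ (Fin r) × EuclideanSpace ℝ (Fin m))
      (fun h : H => θ (h • α)) p X).2 = 0

/-- Orbit charts exist around every point. They are inverse to maps `(a, b) ↦ c a • w b`, where `c`
parametrizes a submanifold of `H` through `1` which the orbit map of `α` immerses into `O`, and `w`
a submanifold of `O` through `α` which is complementary to the orbit. The derivative of the orbit
map has its range in the directions of `a` since its rank is constant. -/
theorem exists_orbitChart (α : O) {r m : ℕ}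
    (hr : Module.finrank ℝ
      (LinearMap.range (md 𝓘(ℝ, EH) 𝓘(ℝ, EO) (fun h : H => h • α) 1).toLinearMap) = r)
    (hm : r + m = Module.finrank ℝ EO) : Nonempty (OrbitChart EH EO H α r m) := by
  set D := md 𝓘(ℝ, EH) 𝓘(ℝ, EO) (fun h : H => h • α) 1 with hD
  let φ := echart 𝓘(ℝ, EH) (1 : H)
  have hφ : IsPDiffeo 𝓘(ℝ, EH) 𝓘(ℝ, EH) φ := isPDiffeo_echart 1
  have h1φ : (1 : H) ∈ φ.source := mem_echart_source 1
  let ψ := echart 𝓘(ℝ, EO) α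
  have hψ : IsPDiffeo 𝓘(ℝ, EO) 𝓘(ℝ, EO) ψ := isPDiffeo_echart α
  have hαψ : α ∈ ψ.source := mem_echart_source α
  set dφ := md 𝓘(ℝ, EH) 𝓘(ℝ, EH) φ.symm (φ 1) with hdφ
  have hdφb : Function.Bijective dφ := hφ.symm.md_bijective (φ.map_source h1φ)
  set dψ := md 𝓘(ℝ, EO) 𝓘(ℝ, EO) ψ.symm (ψ α) with hdψ
  have hdψb : Function.Bijective dψ := hψ.symm.md_bijective (ψ.map_source hαψ)
  obtain ⟨i, hi⟩ := exists_injective_comp (L := D.comp dφ) (r := r) (by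
    rw [← hr]
    suffices h : LinearMap.range (D.comp dφ).toLinearMap = LinearMap.range D.toLinearMap by rw [h]
    ext w
    constructor
    · rintro ⟨v, rfl⟩; exact ⟨dφ v, rfl⟩
    · rintro ⟨v, rfl⟩
      obtain ⟨v', rfl⟩ := hdφb.2 v
      exact ⟨v', rfl⟩)
  obtain ⟨q₀, hq₀⟩ := exists_coprod_bijective hi (k := m) (by simpa using hm)
  let dψe : EO ≃L[ℝ] EO := (LinearEquiv.ofBijective dψ.toLinearMap hdψb).toContinuousLinearEquiv
  let q : EuclideanSpace ℝ (Fin m) →L[ℝ] EO := (dψe.symm : EO →L[ℝ] EO).comp q₀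
  have hq : ∀ b, dψ (q b) = q₀ b := fun b => dψe.apply_symm_apply (q₀ b)
  -- `c` parametrizes a submanifold of `H`, and `w` one of `O` transversal to the orbit
  let c : (EuclideanSpace ℝ (Fin r)) → H := fun a => φ.symm (φ 1 + i a)
  let w : (EuclideanSpace ℝ (Fin m)) → O := fun b => ψ.symm (ψ α + q b)
  let UR : Set (EuclideanSpace ℝ (Fin r)) := (fun a => φ 1 + i a) ⁻¹' φ.target
  let US : Set (EuclideanSpace ℝ (Fin m)) := (fun b => ψ α + q b) ⁻¹' ψ.target
  have hUR : IsOpen UR := φ.open_target.preimage (by fun_prop)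
  have hUS : IsOpen US := ψ.open_target.preimage (by fun_prop)
  have h0R : (0 : (EuclideanSpace ℝ (Fin r))) ∈ UR := by
    show φ 1 + i 0 ∈ φ.target
    simpa using φ.map_source h1φ
  have h0S : (0 : (EuclideanSpace ℝ (Fin m))) ∈ US := by
    show ψ α + q 0 ∈ ψ.target
    simpa using ψ.map_source hαψ
  have hc : ContMDiffOn (𝓡 r) 𝓘(ℝ, EH) ∞ c UR :=
    hφ.2.comp ((contDiff_const.add i.contDiff).contMDiff.contMDiffOn) fun a ha => ha
  have hw : ContMDiffOn (𝓡 m) 𝓘(ℝ, EO) ∞ w US :=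
    hψ.2.comp ((contDiff_const.add q.contDiff).contMDiff.contMDiffOn) fun a ha => ha
  have hc0 : c 0 = 1 := by simp [c, φ.left_inv h1φ]
  have hw0 : w 0 = α := by simp [w, ψ.left_inv hαψ]
  have hcd : md (𝓡 r) 𝓘(ℝ, EH) c 0 = dφ.comp i := by
    have h := md_comp (g := φ.symm) (f := fun a : EuclideanSpace ℝ (Fin r) => φ 1 + i a) (I :=
        (𝓡 r)) (J := 𝓘(ℝ, EH))
      (L := 𝓘(ℝ, EH)) 0 (by simpa using hφ.symm.mdiffAt (φ.map_source h1φ))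
      ((contDiff_const.add i.contDiff).contMDiff.mdifferentiableAt (n := ∞) (by simp))
    rw [md_eq_fderiv, fderiv_const_add, i.fderiv] at h
    simpa using h
  have hwd : md (𝓡 m) 𝓘(ℝ, EO) w 0 = dψ.comp q := by
    have h := md_comp (g := ψ.symm) (f := fun a : EuclideanSpace ℝ (Fin m) => ψ α + q a) (I :=
        (𝓡 m)) (J := 𝓘(ℝ, EO))
      (L := 𝓘(ℝ, EO)) 0 (by simpa using hψ.symm.mdiffAt (ψ.map_source hαψ))
      ((contDiff_const.add q.contDiff).contMDiff.mdifferentiableAt (n := ∞) (by simp))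
    rw [md_eq_fderiv, fderiv_const_add, q.fderiv] at h
    simpa using h
  let Θ : EuclideanSpace ℝ (Fin r) × EuclideanSpace ℝ (Fin m) → O := fun z => c z.1 • w z.2
  have hΘ : ContMDiffOn 𝓘(ℝ, EuclideanSpace ℝ (Fin r) × EuclideanSpace ℝ (Fin m)) 𝓘(ℝ, EO)
      ∞ Θ (UR ×ˢ US) :=
    (hc.comp contDiff_fst.contMDiff.contMDiffOn fun z hz => hz.1).smul
      (hw.comp contDiff_snd.contMDiff.contMDiffOn fun z hz => hz.2)
  have hΘd : md 𝓘(ℝ, EuclideanSpace ℝ (Fin r) × EuclideanSpace ℝ (Fin m)) 𝓘(ℝ, EO) Θ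
      0 = ((D.comp dφ).comp i).coprod q₀ := by
    have hd : MDifferentiableAt 𝓘(ℝ, EuclideanSpace ℝ (Fin r) × EuclideanSpace ℝ (Fin m))
        𝓘(ℝ, EO) Θ 0 :=
      ContMDiffOn.mdiffAt hΘ (hUR.prod hUS) ⟨h0R, h0S⟩
    have hinl : ∀ a, md 𝓘(ℝ, EuclideanSpace ℝ (Fin r) × EuclideanSpace ℝ (Fin m))
        𝓘(ℝ, EO) Θ 0 (a, 0) = D (dφ (i a)) := by
      intro a
      have h := md_comp_apply (g := Θ) (f := fun a : EuclideanSpace ℝ (Fin r) => (a, (0 :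
          (EuclideanSpace ℝ (Fin m))))) (I := (𝓡 r))
        (J := 𝓘(ℝ, EuclideanSpace ℝ (Fin r) × EuclideanSpace ℝ (Fin m))) (L := 𝓘(ℝ, EO)) 0 hd
        ((contDiff_id.prodMk contDiff_const).contMDiff.mdifferentiableAt (n := ∞) (by simp)) a
      have h' := md_comp_apply (g := fun h : H => h • α) (f := c) (I := (𝓡 r))
        (J := 𝓘(ℝ, EH)) (L := 𝓘(ℝ, EO)) 0
        ((contMDiff_orbitMap EH EO H α).mdifferentiableAt (by simp))
        (ContMDiffOn.mdiffAt hc hUR h0R) a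
      rw [hc0, hcd] at h'
      rw [show (fun a : EuclideanSpace ℝ (Fin r) => Θ (a, (0 : (EuclideanSpace ℝ (Fin m))))) = fun
          a => c a • α by
        funext a; simp [Θ, hw0], h'] at h
      rw [md_eq_fderiv, (hasFDerivAt_prodMk_left (0 : (EuclideanSpace ℝ (Fin r))) (0 :
          (EuclideanSpace ℝ (Fin m)))).fderiv] at h
      exact h.symm
    have hinr : ∀ b, md 𝓘(ℝ, EuclideanSpace ℝ (Fin r) × EuclideanSpace ℝ (Fin m))
        𝓘(ℝ, EO) Θ 0 (0, b) = q₀ b := by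
      intro b
      have h := md_comp_apply (g := Θ) (f := fun b : EuclideanSpace ℝ (Fin m) => ((0 :
          (EuclideanSpace ℝ (Fin r))), b)) (I := (𝓡 m))
        (J := 𝓘(ℝ, EuclideanSpace ℝ (Fin r) × EuclideanSpace ℝ (Fin m))) (L := 𝓘(ℝ, EO)) 0 hd
        ((contDiff_const.prodMk contDiff_id).contMDiff.mdifferentiableAt (n := ∞) (by simp)) b
      rw [show (fun b : EuclideanSpace ℝ (Fin m) => Θ ((0 : (EuclideanSpace ℝ (Fin r))), b)) = w by
          funext b; simp [Θ, hc0], hwd,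
        md_eq_fderiv, (hasFDerivAt_prodMk_right (0 : (EuclideanSpace ℝ (Fin r))) (0 :
            (EuclideanSpace ℝ (Fin m)))).fderiv] at h
      rw [← hq]
      exact h.symm
    refine ContinuousLinearMap.ext fun ⟨a, b⟩ => ?_
    rw [show ((a, b) : EuclideanSpace ℝ (Fin r) × EuclideanSpace ℝ (Fin m)) = (a, 0) + (0, b) by
        simp, map_add, hinl, hinr, map_add]
    simp
  obtain ⟨Φ, hΦ0, hΦs, hΦe, hΦ⟩ := exists_isPDiffeo_of_bijective_md (hUR.prod hUS) hΘ
    (x := 0) ⟨h0R, h0S⟩ (by rw [hΘd]; exact hq₀)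
  obtain ⟨ε, hε, hball⟩ := Metric.isOpen_iff.1 Φ.open_source _ hΦ0
  let Φ' := Φ.restrOpen (Metric.ball 0 ε) Metric.isOpen_ball
  have hΦ' : IsPDiffeo 𝓘(ℝ, EuclideanSpace ℝ (Fin r) × EuclideanSpace ℝ (Fin m)) 𝓘(ℝ, EO) Φ' :=
      hΦ.restrOpen _
  have hs : Φ'.source = Metric.ball 0 ε := inter_eq_right.2 hball
  have h0s : (0 : EuclideanSpace ℝ (Fin r) × EuclideanSpace ℝ (Fin m)) ∈ Φ'.source :=
      by rw [hs]; exact Metric.mem_ball_self hε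
  have hΦ'e : ∀ z ∈ Φ'.source, Φ' z = c z.1 • w z.2 := fun z hz => hΦe hz.1
  let θ := Φ'.symm
  have hθ : IsPDiffeo 𝓘(ℝ, EO) 𝓘(ℝ, EuclideanSpace ℝ (Fin r) × EuclideanSpace ℝ (Fin m)) θ :=
      hΦ'.symm
  have hθ' : ∀ z ∈ Φ'.source, θ (c z.1 • w z.2) = z := fun z hz => by
    rw [← hΦ'e z hz]; exact Φ'.left_inv hz
  have hθs : ∀ β ∈ θ.source, θ β ∈ Φ'.source ∧ c (θ β).1 • w (θ β).2 = β := fun β hβ => by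
    have := θ.map_source hβ
    refine ⟨this, ?_⟩
    rw [← hΦ'e _ this]
    exact Φ'.right_inv hβ
  have hbox : ∀ z ∈ Φ'.source, ((0 : (EuclideanSpace ℝ (Fin r))), z.2) ∈ Φ'.source := fun z hz => by
    rw [hs, mem_ball_zero_iff] at hz ⊢
    simp only [Prod.norm_def] at hz ⊢
    simp only [norm_zero]
    exact max_lt hε ((le_max_right _ _).trans_lt hz)
  have hα0 : Φ' 0 = α := by rw [hΦ'e 0 h0s]; simp [hc0, hw0]
  have hαs : α ∈ θ.source := by
    have := Φ'.map_source h0s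
    rwa [hα0] at this
  have hθα : θ α = 0 := by
    have := Φ'.left_inv h0s
    rwa [hα0] at this
  have hF : ∀ p : H, p • α ∈ θ.source →
      MDifferentiableAt 𝓘(ℝ, EH) 𝓘(ℝ, EuclideanSpace ℝ (Fin r) × EuclideanSpace ℝ (Fin m)) (fun h :
          H => θ (h • α)) p := fun p hp =>
    (hθ.mdiffAt hp).comp p ((contMDiff_orbitMap EH EO H α).mdifferentiableAt (by simp))
  have hex : ∀ p : H, p • α ∈ θ.source → ∀ v, ∃ X : EH,
      md 𝓘(ℝ, EH) 𝓘(ℝ, EuclideanSpace ℝ (Fin r) × EuclideanSpace ℝ (Fin m)) (fun h : H => θ (h •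
          α)) p X = (v, 0) := by
    -- differentiate `θ (c a' • p₀ • α) = (a', b)` with respect to `a'`
    intro p hp v
    obtain ⟨hz, hzp⟩ := hθs _ hp
    set z := θ (p • α)
    let Γ : (EuclideanSpace ℝ (Fin r)) → H := fun a' => c a' * ((c z.1)⁻¹ * p)
    have hΓz : Γ z.1 = p := by simp [Γ]
    have hΓα : ∀ a', Γ a' • α = c a' • w z.2 := fun a' => by
      simp only [Γ, mul_smul]
      rw [← hzp, inv_smul_smul]
    have hzR : z.1 ∈ UR := (hΦs hz.1).1
    have hΓ : MDifferentiableAt (𝓡 r) 𝓘(ℝ, EH) Γ z.1 :=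
      ContMDiffOn.mdiffAt (hc.mul contMDiffOn_const) hUR hzR
    have h := md_comp_apply (g := fun h : H => θ (h • α)) (f := Γ) (I := (𝓡 r))
        (J := 𝓘(ℝ, EH)) (L := 𝓘(ℝ, EuclideanSpace ℝ (Fin r) × EuclideanSpace ℝ (Fin m))) z.1
            (by rw [hΓz]; exact hF p hp) hΓ v
    rw [hΓz] at h
    refine ⟨md (𝓡 r) 𝓘(ℝ, EH) Γ z.1 v, ?_⟩
    rw [← h]
    have hop : IsOpen {a' : (EuclideanSpace ℝ (Fin r)) | (a', z.2) ∈ Φ'.source} :=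
      Φ'.open_source.preimage (by fun_prop)
    rw [md_congr_of_isOpen (I := 𝓘(ℝ, EuclideanSpace ℝ (Fin r)))
      (J := 𝓘(ℝ, EuclideanSpace ℝ (Fin r) × EuclideanSpace ℝ (Fin m))) hop (f :=
          fun y => θ (Γ y • α)) (g := fun a' => (a', z.2))
      (fun a' ha' => by simp only [hΓα]; exact hθ' (a', z.2) ha') (x := z.1) hz, md_eq_fderiv,
      (hasFDerivAt_prodMk_left z.1 z.2).fderiv]
    rfl
  refine ⟨{
    θ := θ
    isPDiffeo := hθ
    mem_source := hαs
    map_base := hθα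
    ε := ε
    ε_pos := hε
    target_eq := hs
    κ := fun β => c (θ β).1
    smooth_κ := hc.comp (contDiff_fst.contMDiff.comp_contMDiffOn hθ.1) fun β hβ =>
      (hΦs (hθs β hβ).1.1).1
    κ_base := by rw [hθα]; exact hc0
    κ_mem := fun β hβ => ?_
    κ_eq := fun β hβ => ?_
    exists_md_eq := hex
    md_snd_eq := fun p hp X => ?_ }⟩
  · obtain ⟨h1, h2⟩ := hθs β hβ
    have h3 := Φ'.map_source (hbox _ h1)
    rw [hΦ'e _ (hbox _ h1)] at h3
    simp only [hc0, one_smul] at h3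
    rw [inv_smul_eq_iff.2 h2.symm]
    exact h3
  · obtain ⟨h1, h2⟩ := hθs β hβ
    rw [inv_smul_eq_iff.2 h2.symm]
    have h3 := hθ' _ (hbox _ h1)
    simpa [hc0] using h3
  · set F := md 𝓘(ℝ, EH) 𝓘(ℝ, EuclideanSpace ℝ (Fin r) × EuclideanSpace ℝ (Fin m)) (fun h : H => θ
      (h • α)) p with hFdef
    have hFr : Module.finrank ℝ (LinearMap.range F.toLinearMap) = r := by
      refine Eq.trans ?_ ((finrank_range_md_orbitMap α p).trans hr)
      rw [hFdef,
        md_comp (g := θ) (f := fun h : H => h • α) p (hθ.mdiffAt hp)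
          ((contMDiff_orbitMap EH EO H α).mdifferentiableAt (by simp))]
      rw [ContinuousLinearMap.toLinearMap_comp, LinearMap.range_comp]
      exact (LinearEquiv.finrank_eq (Submodule.equivMapOfInjective _
        (hθ.md_bijective hp).1 _)).symm
    have hle : LinearMap.range (LinearMap.inl ℝ (EuclideanSpace ℝ (Fin r)) (EuclideanSpace ℝ (Fin
        m))) ≤ LinearMap.range F.toLinearMap := by
      rintro _ ⟨v, rfl⟩
      obtain ⟨X, hX⟩ := hex p hp v
      exact ⟨X, hX⟩
    have heq := Submodule.eq_of_le_of_finrank_eq hle (by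
      rw [hFr, LinearMap.finrank_range_of_inj LinearMap.inl_injective]; simp)
    have : F X ∈ LinearMap.range (LinearMap.inl ℝ (EuclideanSpace ℝ (Fin r)) (EuclideanSpace ℝ (Fin
        m))) := by
      rw [heq]; exact ⟨X, rfl⟩
    obtain ⟨v, hv⟩ := this
    rw [← hv]; rfl

namespace OrbitChart

variable {α : O} {r m : ℕ} (Z : OrbitChart EH EO H α r m)

theorem isOpen_preimage : IsOpen {p : H | p • α ∈ Z.θ.source} :=
  Z.θ.open_source.preimage (contMDiff_orbitMap EH EO H α).continuous

theorem contMDiffOn_orbit :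
    ContMDiffOn 𝓘(ℝ, EH) 𝓘(ℝ, EuclideanSpace ℝ (Fin r) × EuclideanSpace ℝ (Fin m)) ∞
      (fun h : H => Z.θ (h • α)) {p : H | p • α ∈ Z.θ.source} :=
  Z.isPDiffeo.1.comp (contMDiff_orbitMap EH EO H α).contMDiffOn fun _ hp => hp

/-- The transversal component is locally constant on the orbit of `α`. -/
theorem eventually_snd_eq {p : H} (hp : p • α ∈ Z.θ.source) :
    ∀ᶠ p' in 𝓝 p, (Z.θ (p' • α)).2 = (Z.θ (p • α)).2 := by
  refine eventually_eq_of_md_eq_zero (I := 𝓘(ℝ, EH)) Z.isOpen_preimage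
    (contDiff_snd.contMDiff.comp_contMDiffOn Z.contMDiffOn_orbit) (fun x hx => ?_) hp
  ext1 X
  have h := md_comp_apply (g := Prod.snd) (f := fun h : H => Z.θ (h • α)) (I := 𝓘(ℝ, EH))
    (J := 𝓘(ℝ, EuclideanSpace ℝ (Fin r) × EuclideanSpace ℝ (Fin m)))
    (L := 𝓘(ℝ, EuclideanSpace ℝ (Fin m))) x
    (contDiff_snd.contMDiff.mdifferentiableAt (n := ∞) (by simp))
    (ContMDiffOn.mdiffAt Z.contMDiffOn_orbit Z.isOpen_preimage hx) X
  rw [md_eq_fderiv, fderiv_snd] at h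
  refine h.trans ?_
  exact Z.md_snd_eq x hx X

/-- The orbit of `α` meets the transversal in a countable set. -/
theorem countable_snd [SecondCountableTopology H] :
    ((fun β => (Z.θ β).2) '' (Z.θ.source ∩ MulAction.orbit H α)).Countable := by
  refine (countable_image_of_eventually_eq (g := fun p : H => (Z.θ (p • α)).2)
    (U := {p : H | p • α ∈ Z.θ.source}) fun p hp => Z.eventually_snd_eq hp).mono ?_
  rintro _ ⟨_, ⟨hβ, p, rfl⟩, rfl⟩
  exact ⟨p, hβ, rfl⟩

/-- For a transitive action, the transversal is a point. -/
theorem subsingleton_of_isPretransitive (Z : OrbitChart EH EO H α r m)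
    [SecondCountableTopology H] [MulAction.IsPretransitive H O] :
    Subsingleton (EuclideanSpace ℝ (Fin m)) := by
  have hsub : ∀ b ∈ Metric.ball (0 : EuclideanSpace ℝ (Fin m)) Z.ε, b = 0 := by
    intro b hb
    refine eqOn_of_countable (g := fun b => b) (convex_ball _ Z.ε).isPreconnected continuousOn_id
      Z.countable_snd ?_ hb (Metric.mem_ball_self Z.ε_pos)
    intro b hb
    have ht : ((0 : EuclideanSpace ℝ (Fin r)), b) ∈ Z.θ.target := by
      rw [Z.target_eq, mem_ball_zero_iff, Prod.norm_def]
      simp only [norm_zero]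
      exact max_lt Z.ε_pos (mem_ball_zero_iff.1 hb)
    refine ⟨Z.θ.symm (0, b), ⟨Z.θ.map_target ht, ?_⟩, ?_⟩
    · exact MulAction.exists_smul_eq H α _
    · simp only [Z.θ.right_inv ht]
  refine subsingleton_of_forall_eq 0 fun b => ?_
  by_contra hb
  have hn : 0 < ‖b‖ := norm_pos_iff.2 hb
  have := hsub ((Z.ε / 2 / ‖b‖) • b) (by
    rw [mem_ball_zero_iff, norm_smul, Real.norm_of_nonneg (by have := Z.ε_pos; positivity),
      div_mul_cancel₀ _ hn.ne']
    linarith [Z.ε_pos])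
  rw [smul_eq_zero] at this
  rcases this with h | h
  · have := Z.ε_pos
    have : 0 < Z.ε / 2 / ‖b‖ := by positivity
    exact this.ne' h
  · exact hb h

end OrbitChart

end Orbits

/-! ### Basic properties of Cartan geometries -/

section LieGroupDerivatives

variable {EG : Type*} [NormedAddCommGroup EG] [NormedSpace ℝ EG] [FiniteDimensional ℝ EG]
  {EO : Type*} [NormedAddCommGroup EO] [NormedSpace ℝ EO] [FiniteDimensional ℝ EO]
  {EP : Type*} [NormedAddCommGroup EP] [NormedSpace ℝ EP] [FiniteDimensional ℝ EP]
  {G : Type*} [Group G] [TopologicalSpace G] [ChartedSpace EG G] [LieGroup 𝓘(ℝ, EG) ∞ G]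
  {O : Type*} [TopologicalSpace O] [ChartedSpace EO O] [IsManifold 𝓘(ℝ, EO) ∞ O]
  [MulAction G O] [ContMDiffSMul 𝓘(ℝ, EG) 𝓘(ℝ, EO) ∞ G O]
  {P : Subgroup G} [ChartedSpace EP P]

theorem ad_one_inv (X : EG) : Ad EG ((1 : G)⁻¹) X = X := by
  have : (fun x : G => (1 : G)⁻¹ * x * (1 : G)⁻¹⁻¹) = fun x => x := by funext x; simp
  show md 𝓘(ℝ, EG) 𝓘(ℝ, EG) (fun x : G => (1 : G)⁻¹ * x * (1 : G)⁻¹⁻¹) 1 X = X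
  rw [this, md_id]; rfl

theorem maurerCartan_one (Z : EG) : maurerCartan EG (1 : G) Z = Z := by
  have : (fun x : G => (1 : G)⁻¹ * x) = fun x => x := by funext x; simp
  show md 𝓘(ℝ, EG) 𝓘(ℝ, EG) (fun x : G => (1 : G)⁻¹ * x) 1 Z = Z
  rw [this, md_id]; rfl

/-- Acting by inverses changes the sign of the infinitesimal action. -/
theorem md_inv_smul (β : O) (Z : EG) :
    md 𝓘(ℝ, EG) 𝓘(ℝ, EO) (fun g : G => g⁻¹ • β) 1 Z =
      - md 𝓘(ℝ, EG) 𝓘(ℝ, EO) (fun g : G => g • β) 1 Z := by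
  -- differentiate `g • g⁻¹ • β = β`
  have hF : ContMDiff (𝓘(ℝ, EG).prod 𝓘(ℝ, EG)) 𝓘(ℝ, EO) ∞
      (fun z : G × G => z.1 • (z.2⁻¹ • β)) :=
    contMDiff_fst.smul (contMDiff_snd.inv.smul contMDiff_const)
  have h1 := md_prod_apply (hF.mdifferentiableAt (x := ((1 : G), (1 : G))) (by simp)) Z Z
  have h2 := md_comp_apply (g := fun z : G × G => z.1 • (z.2⁻¹ • β)) (f := fun g : G => (g, g))
    (I := 𝓘(ℝ, EG)) (1 : G) (hF.mdifferentiableAt (by simp))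
    (mdifferentiableAt_id.prodMk mdifferentiableAt_id) Z
  rw [md_prodMk (f := fun g : G => g) (g := fun g : G => g) mdifferentiableAt_id
    mdifferentiableAt_id, md_id] at h2
  simp only [smul_inv_smul, md_const] at h2
  have h3 : md 𝓘(ℝ, EG) 𝓘(ℝ, EO) (fun g : G => g • β) 1 Z +
      md 𝓘(ℝ, EG) 𝓘(ℝ, EO) (fun g : G => g⁻¹ • β) 1 Z = 0 := by
    simp only [inv_one, one_smul] at h1
    rw [← h1]
    exact h2.symm
  exact (neg_eq_of_add_eq_zero_right h3).symm

theorem contMDiffSMul_subgroup (hv : ContMDiff 𝓘(ℝ, EP) 𝓘(ℝ, EG) ∞ (Subtype.val : P → G)) :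
    ContMDiffSMul 𝓘(ℝ, EP) 𝓘(ℝ, EO) ∞ P O where
  contMDiff_smul := (hv.comp contMDiff_fst).smul contMDiff_snd

theorem md_orbitMap_subgroup (hv : ContMDiff 𝓘(ℝ, EP) 𝓘(ℝ, EG) ∞ (Subtype.val : P → G)) (α : O)
    (Y : EP) : md 𝓘(ℝ, EP) 𝓘(ℝ, EO) (fun p : P => p • α) 1 Y =
      md 𝓘(ℝ, EG) 𝓘(ℝ, EO) (fun g : G => g • α) 1
        (md 𝓘(ℝ, EP) 𝓘(ℝ, EG) (Subtype.val : P → G) 1 Y) :=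
  md_comp_apply (g := fun g : G => g • α) (f := (Subtype.val : P → G)) 1
    ((contMDiff_orbitMap EG EO G α).mdifferentiableAt (by simp)) (hv.mdifferentiableAt (by simp)) Y

end LieGroupDerivatives

namespace CartanGeometry

variable {EG : Type*} [NormedAddCommGroup EG] [NormedSpace ℝ EG] [FiniteDimensional ℝ EG]
  {EP : Type*} [NormedAddCommGroup EP] [NormedSpace ℝ EP] [FiniteDimensional ℝ EP]
  {EB : Type*} [NormedAddCommGroup EB] [NormedSpace ℝ EB] [FiniteDimensional ℝ EB]
  {EM : Type*} [NormedAddCommGroup EM] [NormedSpace ℝ EM] [FiniteDimensional ℝ EM]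
  {G : Type*} [Group G] [TopologicalSpace G] [ChartedSpace EG G]
  {P : Subgroup G} [ChartedSpace EP P] [LieGroup 𝓘(ℝ, EP) ∞ P]
  {B : Type*} [TopologicalSpace B] [ChartedSpace EB B] [IsManifold 𝓘(ℝ, EB) ∞ B]
  {M : Type*} [TopologicalSpace M] [ChartedSpace EM M] [IsManifold 𝓘(ℝ, EM) ∞ M]
  (C : CartanGeometry EG EP EB EM P B M)

/-- Local triviality of the Cartan bundle, with the equivariance of the trivialisation stated in
terms of points of the base. -/
theorem exists_trivialization (x : M) : ∃ (U : Set M) (Φ : OpenPartialHomeomorph B (M × P)),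
    IsOpen U ∧ x ∈ U ∧ Φ.source = C.proj ⁻¹' U ∧ Φ.target = U ×ˢ univ ∧
    IsPDiffeo 𝓘(ℝ, EB) (𝓘(ℝ, EM).prod 𝓘(ℝ, EP)) Φ ∧
    (∀ u, C.proj u ∈ U → (Φ u).1 = C.proj u) ∧
    (∀ u, C.proj u ∈ U → ∀ p : P, C.proj (C.act u p) ∈ U ∧
      Φ (C.act u p) = (C.proj u, (Φ u).2 * p)) ∧
    (∀ y ∈ U, ∀ p : P, C.proj (Φ.symm (y, p)) = y) := by
  obtain ⟨U, Φ, hU, hx, hs, ht, h1, h2, h3⟩ := C.locallyTrivial x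
  have hs' : ∀ u, C.proj u ∈ U → u ∈ Φ.source := fun u hu => by rw [hs]; exact hu
  refine ⟨U, Φ, hU, hx, hs, ht, ⟨h1, h2⟩, fun u hu => (h3 u (hs' u hu)).1, fun u hu p => ?_,
    fun y hy p => ?_⟩
  · obtain ⟨h4, h5⟩ := (h3 u (hs' u hu)).2 p
    rw [(h3 u (hs' u hu)).1] at h5
    rw [hs] at h4
    exact ⟨h4, h5⟩
  · have ht' : (y, p) ∈ Φ.target := by rw [ht]; exact ⟨hy, trivial⟩
    rw [← (h3 _ (Φ.map_target ht')).1, Φ.right_inv ht']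

theorem proj_act (u : B) (p : P) : C.proj (C.act u p) = C.proj u := by
  obtain ⟨U, Φ, hU, hx, hs, ht, hΦ, h1, h2, h3⟩ := C.exists_trivialization (C.proj u)
  rw [← h1 _ (h2 u hx p).1, (h2 u hx p).2]

theorem contMDiff_proj : ContMDiff 𝓘(ℝ, EB) 𝓘(ℝ, EM) ∞ C.proj := by
  intro u
  obtain ⟨U, Φ, hU, hx, hs, ht, hΦ, h1, h2, h3⟩ := C.exists_trivialization (C.proj u)
  have hu : u ∈ Φ.source := by rw [hs]; exact hx
  have h : ContMDiffOn 𝓘(ℝ, EB) 𝓘(ℝ, EM) ∞ C.proj Φ.source :=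
    (contMDiff_fst.comp_contMDiffOn hΦ.1).congr fun v hv => (h1 v (by rwa [hs] at hv)).symm
  exact h.contMDiffAt (Φ.open_source.mem_nhds hu)

theorem contMDiff_act : ContMDiff (𝓘(ℝ, EB).prod 𝓘(ℝ, EP)) 𝓘(ℝ, EB) ∞
    (fun z : B × P => C.act z.1 z.2) := by
  rintro ⟨u, p⟩
  obtain ⟨U, Φ, hU, hx, hs, ht, hΦ, h1, h2, h3⟩ := C.exists_trivialization (C.proj u)
  have hu : u ∈ Φ.source := by rw [hs]; exact hx
  have hg : ContMDiffOn (𝓘(ℝ, EB).prod 𝓘(ℝ, EP)) (𝓘(ℝ, EM).prod 𝓘(ℝ, EP)) ∞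
      (fun z : B × P => (C.proj z.1, (Φ z.1).2 * z.2)) (Φ.source ×ˢ univ) :=
    (C.contMDiff_proj.comp contMDiff_fst).contMDiffOn.prodMk
      ((contMDiff_snd.comp_contMDiffOn (hΦ.1.comp contMDiff_fst.contMDiffOn fun z hz => hz.1)).mul
        contMDiff_snd.contMDiffOn)
  have h : ContMDiffOn (𝓘(ℝ, EB).prod 𝓘(ℝ, EP)) 𝓘(ℝ, EB) ∞ (fun z : B × P => C.act z.1 z.2)
      (Φ.source ×ˢ univ) := by
    refine (hΦ.2.comp hg fun z hz => ?_).congr fun z hz => ?_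
    · rw [ht]; refine ⟨?_, trivial⟩
      have := hz.1
      rwa [hs] at this
    · have hz1 : C.proj z.1 ∈ U := by have := hz.1; rwa [hs] at this
      simp only [Function.comp]
      rw [← (h2 _ hz1 z.2).2, Φ.left_inv (by rw [hs]; exact (h2 _ hz1 z.2).1)]
  exact h.contMDiffAt ((Φ.open_source.prod isOpen_univ).mem_nhds ⟨hu, trivial⟩)

theorem contMDiff_act_left (p : P) : ContMDiff 𝓘(ℝ, EB) 𝓘(ℝ, EB) ∞ (fun u => C.act u p) :=
  C.contMDiff_act.comp (contMDiff_id.prodMk contMDiff_const)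

theorem contMDiff_act_right (u : B) : ContMDiff 𝓘(ℝ, EP) 𝓘(ℝ, EB) ∞ (fun p => C.act u p) :=
  C.contMDiff_act.comp (contMDiff_const.prodMk contMDiff_id)

/-- The structure group acts transitively on the fibres. -/
theorem exists_act_eq {u v : B} (h : C.proj u = C.proj v) : ∃ p : P, C.act u p = v := by
  obtain ⟨U, Φ, hU, hx, hs, ht, hΦ, h1, h2, h3⟩ := C.exists_trivialization (C.proj u)
  have hv : C.proj v ∈ U := h ▸ hx
  refine ⟨(Φ u).2⁻¹ * (Φ v).2, Φ.injOn (by rw [hs]; exact (h2 u hx _).1) (by rw [hs]; exact hv) ?_⟩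
  rw [(h2 u hx _).2, mul_inv_cancel_left, h, ← h1 v hv]

theorem act_injective (u : B) : Function.Injective (C.act u) := by
  intro p q hpq
  obtain ⟨U, Φ, hU, hx, hs, ht, hΦ, h1, h2, h3⟩ := C.exists_trivialization (C.proj u)
  have := congrArg (fun v => (Φ v).2) hpq
  simpa [(h2 u hx _).2] using this

/-- The element of the structure group which maps `u` to `v`, for points `u` and `v` in the same
fibre; it is set to `1` if they are in different fibres. -/
def div (u v : B) : P := by
  classical exact if h : C.proj u = C.proj v then (C.exists_act_eq h).choose else 1

theorem act_div {u v : B} (h : C.proj u = C.proj v) : C.act u (C.div u v) = v := by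
  rw [div, dif_pos h]
  exact (C.exists_act_eq h).choose_spec

theorem contMDiffOn_div {E : Type*} [NormedAddCommGroup E] [NormedSpace ℝ E] {H : Type*}
    [TopologicalSpace H] {I : ModelWithCorners ℝ E H} {X : Type*} [TopologicalSpace X]
    [ChartedSpace H X] {f g : X → B} {W : Set X} (hW : IsOpen W)
    (hf : ContMDiffOn I 𝓘(ℝ, EB) ∞ f W) (hg : ContMDiffOn I 𝓘(ℝ, EB) ∞ g W)
    (hfg : ∀ x ∈ W, C.proj (f x) = C.proj (g x)) :
    ContMDiffOn I 𝓘(ℝ, EP) ∞ (fun x => C.div (f x) (g x)) W := by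
  intro x hxW
  obtain ⟨U, Φ, hU, hx, hs, ht, hΦ, h1, h2, h3⟩ := C.exists_trivialization (C.proj (f x))
  have hW' : IsOpen (W ∩ f ⁻¹' Φ.source) := hf.continuousOn.isOpen_inter_preimage hW Φ.open_source
  have hmem : ∀ y ∈ W ∩ f ⁻¹' Φ.source, g y ∈ Φ.source := fun y hy => by
    have := hy.2
    rw [mem_preimage, hs, mem_preimage, hfg y hy.1] at this
    rwa [hs]
  have h : ContMDiffOn I 𝓘(ℝ, EP) ∞ (fun x => (Φ (f x)).2⁻¹ * (Φ (g x)).2) (W ∩ f ⁻¹' Φ.source) :=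
    (contMDiff_snd.comp_contMDiffOn
      (hΦ.1.comp (hf.mono inter_subset_left) fun y hy => hy.2)).inv.mul
    (contMDiff_snd.comp_contMDiffOn (hΦ.1.comp (hg.mono inter_subset_left) hmem))
  have h' : ContMDiffOn I 𝓘(ℝ, EP) ∞ (fun x => C.div (f x) (g x)) (W ∩ f ⁻¹' Φ.source) := by
    refine h.congr fun y hy => ?_
    have hfU : C.proj (f y) ∈ U := by have := hy.2; rwa [mem_preimage, hs] at this
    have := congrArg (fun v => (Φ v).2) (C.act_div (hfg y hy.1))
    simp only [(h2 _ hfU _).2] at this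
    rw [← this]; simp
  refine (h'.contMDiffAt (hW'.mem_nhds ⟨hxW, ?_⟩)).contMDiffWithinAt
  rw [mem_preimage, hs]; exact hx

/-- There are local sections of the Cartan bundle through each of its points. -/
theorem exists_section (u : B) : ∃ (U : Set M) (σ : M → B), IsOpen U ∧ C.proj u ∈ U ∧
    ContMDiffOn 𝓘(ℝ, EM) 𝓘(ℝ, EB) ∞ σ U ∧ (∀ y ∈ U, C.proj (σ y) = y) ∧ σ (C.proj u) = u := by
  obtain ⟨U, Φ, hU, hx, hs, ht, hΦ, h1, h2, h3⟩ := C.exists_trivialization (C.proj u)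
  refine ⟨U, fun y => Φ.symm (y, (Φ u).2), hU, hx, ?_, fun y hy => h3 y hy _, ?_⟩
  · exact hΦ.2.comp (contMDiff_id.prodMk contMDiff_const).contMDiffOn fun y hy => by
      rw [ht]; exact ⟨hy, trivial⟩
  · rw [← h1 u hx]
    exact Φ.left_inv (by rw [hs]; exact hx)

/-- The vertical vectors are the values of the fundamental vector fields. -/
theorem exists_md_act_eq {u : B} {ξ : EB} (hξ : md 𝓘(ℝ, EB) 𝓘(ℝ, EM) C.proj u ξ = 0) :
    ∃ Y : EP, md 𝓘(ℝ, EP) 𝓘(ℝ, EB) (fun p => C.act u p) 1 Y = ξ := by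
  obtain ⟨U, Φ, hU, hx, hs, ht, hΦ, h1, h2, h3⟩ := C.exists_trivialization (C.proj u)
  have hu : u ∈ Φ.source := by rw [hs]; exact hx
  set η : EM × EP := md 𝓘(ℝ, EB) (𝓘(ℝ, EM).prod 𝓘(ℝ, EP)) Φ u ξ with hη
  have hη1 : η.1 = 0 := by
    have h := md_comp_apply (g := (Prod.fst : M × P → M)) (f := Φ) (I := 𝓘(ℝ, EB))
      (J := 𝓘(ℝ, EM).prod 𝓘(ℝ, EP)) (L := 𝓘(ℝ, EM)) u mdifferentiableAt_fst (hΦ.mdiffAt hu) ξ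
    rw [md_congr_of_isOpen Φ.open_source (f := fun y => (Φ y).1) (g := C.proj)
      (fun y hy => h1 y (by rwa [hs] at hy)) hu, hξ] at h
    have h' : md (𝓘(ℝ, EM).prod 𝓘(ℝ, EP)) 𝓘(ℝ, EM) (Prod.fst : M × P → M) (Φ u) =
      ContinuousLinearMap.fst ℝ EM EP := mfderiv_fst
    rw [h'] at h
    exact h.symm
  obtain ⟨Y, hY⟩ := (md_mul_left_bijective EP (Φ u).2 (1 : P)).2 η.2
  refine ⟨Y, ?_⟩
  -- in the trivialisation, the fundamental fields are left invariant fields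
  have h4 : md 𝓘(ℝ, EB) (𝓘(ℝ, EM).prod 𝓘(ℝ, EP)) Φ u
      (md 𝓘(ℝ, EP) 𝓘(ℝ, EB) (fun p => C.act u p) 1 Y) = η := by
    have h := md_comp_apply (g := Φ) (f := fun p => C.act u p) (I := 𝓘(ℝ, EP))
      (J := 𝓘(ℝ, EB)) (L := 𝓘(ℝ, EM).prod 𝓘(ℝ, EP)) 1
      (by rw [C.act_one]; exact hΦ.mdiffAt hu)
      ((C.contMDiff_act_right u).mdifferentiableAt (by simp)) Y
    rw [C.act_one] at h
    rw [← h, show (fun p => Φ (C.act u p)) = fun p => (C.proj u, (Φ u).2 * p) from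
      funext fun p => (h2 u hx p).2, md_prodMk (f := fun _ : P => C.proj u)
        (g := fun p : P => (Φ u).2 * p) mdifferentiableAt_const
        ((contMDiff_mul_left (I := 𝓘(ℝ, EP)) (n := ∞)).mdifferentiableAt (by simp)), md_const]
    ext
    · exact hη1.symm
    · exact hY
  exact (hΦ.md_bijective hu).1 (h4.trans hη)

/-- The Cartan connection, as a linear map between the model vector spaces. -/
def om (u : B) : EB →L[ℝ] EG := C.form u

theorem om_bijective (u : B) : Function.Bijective (C.om u) := C.form_bijective u

theorem om_act (u : B) (p : P) (ξ : EB) :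
    C.om (C.act u p) (md 𝓘(ℝ, EB) 𝓘(ℝ, EB) (fun u' => C.act u' p) u ξ) =
      Ad EG ((p : G)⁻¹) (C.om u ξ) :=
  C.form_act u p ξ

theorem om_fundamental (u : B) (Y : EP) :
    C.om u (md 𝓘(ℝ, EP) 𝓘(ℝ, EB) (fun p => C.act u p) 1 Y) = lieInclusion EG EP P Y := by
  have h := C.form_fundamental u Y
  have h' : C.om (C.act u 1) (md 𝓘(ℝ, EP) 𝓘(ℝ, EB) (fun p => C.act u p) 1 Y) =
    lieInclusion EG EP P Y := h
  rwa [C.act_one] at h'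

variable {EO : Type*} [NormedAddCommGroup EO] [NormedSpace ℝ EO] [FiniteDimensional ℝ EO]
  {O : Type*} [TopologicalSpace O] [ChartedSpace EO O] [IsManifold 𝓘(ℝ, EO) ∞ O]
  [MulAction G O] [LieGroup 𝓘(ℝ, EG) ∞ G] [ContMDiffSMul 𝓘(ℝ, EG) 𝓘(ℝ, EO) ∞ G O]

/-- The derivative of a holonomy reduction is determined by the Cartan connection and the
infinitesimal action of the Lie algebra. -/
theorem HolonomyReduction.md_eq {C : CartanGeometry EG EP EB EM P B M} {s : B → O}
    (hs : C.HolonomyReduction (EO := EO) s) (u : B) (ξ : EB) :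
    md 𝓘(ℝ, EB) 𝓘(ℝ, EO) s u ξ =
      - md 𝓘(ℝ, EG) 𝓘(ℝ, EO) (fun g : G => g • s u) 1 (C.om u ξ) := by
  have h0 : C.extendedForm u 1 ξ (-(C.om u ξ) : EG) = 0 := by
    show (Ad EG (1 : G)⁻¹ (C.om u ξ) + maurerCartan EG (1 : G) (-(C.om u ξ) : EG) : EG) = 0
    erw [ad_one_inv, maurerCartan_one]
    exact add_neg_cancel (C.om u ξ : EG)
  have h1 : md (𝓘(ℝ, EB).prod 𝓘(ℝ, EG)) 𝓘(ℝ, EO) (fun w : B × G => w.2⁻¹ • s w.1) (u, 1)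
      (ξ, -(C.om u ξ)) = 0 := hs.parallel u 1 ξ _ h0
  have hd : ContMDiff (𝓘(ℝ, EB).prod 𝓘(ℝ, EG)) 𝓘(ℝ, EO) ∞ (fun w : B × G => w.2⁻¹ • s w.1) :=
    contMDiff_snd.inv.smul (hs.smooth.comp contMDiff_fst)
  rw [md_prod_apply (hd.mdifferentiableAt (by simp))] at h1
  simp only [inv_one, one_smul] at h1
  rw [md_inv_smul, map_neg, neg_neg] at h1
  exact eq_neg_of_add_eq_zero_left h1

end CartanGeometry

/-! ### Level sets and stabilisers -/

/-- If `D ∘ A = 0` and the dimensions match, then the range of `A` is the kernel of `D`. This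
identifies tangent spaces of level sets. -/
theorem exists_eq_of_finrank {E₁ E₂ E₃ : Type*} [NormedAddCommGroup E₁] [NormedSpace ℝ E₁]
    [FiniteDimensional ℝ E₁]
    [NormedAddCommGroup E₂] [NormedSpace ℝ E₂] [FiniteDimensional ℝ E₂] [NormedAddCommGroup E₃]
    [NormedSpace ℝ E₃] {A : E₁ →L[ℝ] E₂} {D : E₂ →L[ℝ] E₃} (hA : Function.Injective A)
    (hDA : ∀ v, D (A v) = 0)
    (hdim : Module.finrank ℝ E₁ + Module.finrank ℝ (LinearMap.range D.toLinearMap)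
      = Module.finrank ℝ E₂) {v : E₂} (hv : D v = 0) : ∃ w, A w = v := by
  have hle : LinearMap.range A.toLinearMap ≤ LinearMap.ker D.toLinearMap := by
    rintro _ ⟨w, rfl⟩; exact hDA w
  have h1 := D.toLinearMap.finrank_range_add_finrank_ker
  have h2 : Module.finrank ℝ (LinearMap.range A.toLinearMap) = Module.finrank ℝ E₁ :=
    LinearMap.finrank_range_of_inj hA
  have heq := Submodule.eq_of_le_of_finrank_eq hle (by omega)
  have : v ∈ LinearMap.range A.toLinearMap := by rw [heq]; exact hv
  obtain ⟨w, hw⟩ := this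
  exact ⟨w, hw⟩

section LevelSets

variable {E : Type*} [NormedAddCommGroup E] [NormedSpace ℝ E] [FiniteDimensional ℝ E]
  {EO : Type*} [NormedAddCommGroup EO] [NormedSpace ℝ EO] [FiniteDimensional ℝ EO]
  {M : Type*} [TopologicalSpace M] [ChartedSpace E M] [IsManifold 𝓘(ℝ, E) ∞ M]
  {N : Type*} [TopologicalSpace N]
  {O : Type*} [TopologicalSpace O] [ChartedSpace EO O] [IsManifold 𝓘(ℝ, EO) ∞ O]

/-- A regular level set is a submanifold. -/
theorem exists_submanifoldAtlas_of_levelSet {j : N → M} (hj : IsInducing j)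
    (hinj : Function.Injective j) {f : M → O} (hf : ContMDiff 𝓘(ℝ, E) 𝓘(ℝ, EO) ∞ f) {α : O}
    (hrange : ∀ m, m ∈ range j ↔ f m = α)
    (hsurj : ∀ m, f m = α → Function.Surjective (md 𝓘(ℝ, E) 𝓘(ℝ, EO) f m)) {k : ℕ}
    (hk : k + Module.finrank ℝ EO = Module.finrank ℝ E) : Nonempty (SubmanifoldAtlas E j k) := by
  let ψ := echart 𝓘(ℝ, EO) α
  have hψ : IsPDiffeo 𝓘(ℝ, EO) 𝓘(ℝ, EO) ψ := isPDiffeo_echart α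
  have hαψ : α ∈ ψ.source := mem_echart_source α
  have hU : IsOpen (f ⁻¹' ψ.source) := ψ.open_source.preimage hf.continuous
  have hF : ContMDiffOn 𝓘(ℝ, E) 𝓘(ℝ, EO) ∞ (fun m => ψ (f m)) (f ⁻¹' ψ.source) :=
    hψ.1.comp hf.contMDiffOn fun m hm => hm
  refine exists_submanifoldAtlas_of_isInducing (V := EO) hj hinj fun n => ?_
  have hn : f (j n) = α := (hrange _).1 ⟨n, rfl⟩
  have hs : Function.Surjective (md 𝓘(ℝ, E) 𝓘(ℝ, EO) (fun m => ψ (f m)) (j n)) := by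
    rw [md_comp (j n) (hψ.mdiffAt (by rwa [hn])) (hf.mdifferentiableAt (by simp))]
    exact (hψ.md_bijective (by rwa [hn])).surjective.comp (hsurj _ hn)
  obtain ⟨Ψ, h1, h2, h3, h4⟩ := exists_slice hU hF (x := j n) (by rwa [mem_preimage, hn]) hs hk
  refine ⟨Ψ, ψ α, h3, h1, fun m hm => ?_⟩
  rw [hrange, h4 m hm]
  exact ⟨fun h => by rw [h], fun h => ψ.injOn (h2 hm) hαψ h⟩

variable {j : N → M} {k : ℕ}

/-- The parametrization of a submanifold by a chart around `n`. -/
def SubmanifoldAtlas.param (A : SubmanifoldAtlas E j k) (n : N) :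
    EuclideanSpace ℝ (Fin k) → N := (A.chart n).symm

namespace SubmanifoldAtlas

variable (A : SubmanifoldAtlas E j k)

theorem param_chart (n : N) : A.param n (A.chart n n) = n := (A.chart n).left_inv (A.mem_source n)

theorem contMDiffOn_param (n : N) :
    ContMDiffOn (𝓡 k) 𝓘(ℝ, E) ∞ (fun z => j (A.param n z)) (A.chart n).target := A.smooth_symm n

theorem mem_target (n : N) : A.chart n n ∈ (A.chart n).target :=
  (A.chart n).map_source (A.mem_source n)

theorem injective_md_param (n : N) :
    Function.Injective (md (𝓡 k) 𝓘(ℝ, E) (fun z => j (A.param n z)) (A.chart n n)) := by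
  have hext : MDifferentiableAt 𝓘(ℝ, E) (𝓡 k) (A.ext n) (j (A.param n (A.chart n n))) := by
    rw [A.param_chart]
    exact ContMDiffOn.mdiffAt (A.smooth_ext n) (A.isOpen_dom n) (A.mapsTo_dom n n (A.mem_source n))
  have h := md_comp (g := A.ext n) (f := fun z => j (A.param n z)) (L := 𝓡 k) (A.chart n n) hext
    (ContMDiffOn.mdiffAt (A.contMDiffOn_param n) (A.chart n).open_target (A.mem_target n))
  rw [md_congr_of_isOpen (A.chart n).open_target (g := fun z => z) (fun z hz => by
    simp only [param]
    rw [A.ext_eq n _ ((A.chart n).map_target hz), (A.chart n).right_inv hz]) (A.mem_target n),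
    md_id] at h
  intro v w hvw
  have hv := congrArg (fun L => L v) h
  have hw := congrArg (fun L => L w) h
  simp only [ContinuousLinearMap.id_apply, ContinuousLinearMap.comp_apply] at hv hw
  rw [hv, hw, hvw]

/-- If `f` is constant along a submanifold whose codimension is the rank of `f`, then the tangent
space of the submanifold is the kernel of the derivative of `f`; here in terms of a parametrization.
-/
theorem exists_md_param_eq {f : M → O} (hf : ContMDiff 𝓘(ℝ, E) 𝓘(ℝ, EO) ∞ f) {α : O}
    (hα : ∀ n, f (j n) = α) (n : N)
    (hdim : k + Module.finrank ℝ
      (LinearMap.range (md 𝓘(ℝ, E) 𝓘(ℝ, EO) f (j n)).toLinearMap) = Module.finrank ℝ E)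
    {v : E} (hv : md 𝓘(ℝ, E) 𝓘(ℝ, EO) f (j n) v = 0) :
    ∃ w, md (𝓡 k) 𝓘(ℝ, E) (fun z => j (A.param n z)) (A.chart n n) w = v := by
  refine exists_eq_of_finrank (A.injective_md_param n) (fun w => ?_) (by simpa using hdim) hv
  have h := md_comp_apply (g := f) (f := fun z => j (A.param n z)) (L := 𝓘(ℝ, EO)) (A.chart n n)
    (hf.mdifferentiableAt (by simp))
    (ContMDiffOn.mdiffAt (A.contMDiffOn_param n) (A.chart n).open_target (A.mem_target n)) w
  simp only [hα, md_const] at h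
  rw [A.param_chart] at h
  exact h.symm

/-- If `f` is constant along a submanifold whose codimension is the rank of `f`, then the tangent
space of the submanifold is the kernel of the derivative of `f`. -/
theorem exists_md_eq {f : M → O} (hf : ContMDiff 𝓘(ℝ, E) 𝓘(ℝ, EO) ∞ f) {α : O}
    (hα : ∀ n, f (j n) = α) (n : N)
    (hdim : k + Module.finrank ℝ
      (LinearMap.range (md 𝓘(ℝ, E) 𝓘(ℝ, EO) f (j n)).toLinearMap) = Module.finrank ℝ E)
    {v : E} (hv : md 𝓘(ℝ, E) 𝓘(ℝ, EO) f (j n) v = 0) :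
    letI := A.chartedSpace; ∃ w, md (𝓡 k) 𝓘(ℝ, E) j n w = v := by
  let := A.chartedSpace
  have := A.isManifold
  refine exists_eq_of_finrank (A.injective_md n) (fun w => ?_) (by simpa using hdim) hv
  have h := md_comp_apply (g := f) (f := j) (I := 𝓡 k) (L := 𝓘(ℝ, EO)) n
    (hf.mdifferentiableAt (by simp)) (A.contMDiff.mdifferentiableAt (by simp)) w
  simp only [hα, md_const] at h
  exact h.symm

end SubmanifoldAtlas

end LevelSets

section Stabilizers

variable {EG : Type*} [NormedAddCommGroup EG] [NormedSpace ℝ EG] [FiniteDimensional ℝ EG]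
  {EO : Type*} [NormedAddCommGroup EO] [NormedSpace ℝ EO] [FiniteDimensional ℝ EO]
  {EP : Type*} [NormedAddCommGroup EP] [NormedSpace ℝ EP] [FiniteDimensional ℝ EP]
  {G : Type*} [Group G] [TopologicalSpace G] [ChartedSpace EG G] [LieGroup 𝓘(ℝ, EG) ∞ G]
  {O : Type*} [TopologicalSpace O] [ChartedSpace EO O] [IsManifold 𝓘(ℝ, EO) ∞ O]
  [MulAction G O] [ContMDiffSMul 𝓘(ℝ, EG) 𝓘(ℝ, EO) ∞ G O]

/-- The rank of the orbit map of `α`. -/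
def orbitRank (EG EO : Type*) [NormedAddCommGroup EG] [NormedSpace ℝ EG]
    [NormedAddCommGroup EO] [NormedSpace ℝ EO] (G : Type*) [Group G] [TopologicalSpace G]
    [ChartedSpace EG G]
    {O : Type*} [TopologicalSpace O] [ChartedSpace EO O] [MulAction G O] (α : O) : ℕ :=
  Module.finrank ℝ (LinearMap.range (md 𝓘(ℝ, EG) 𝓘(ℝ, EO) (fun g : G => g • α) 1).toLinearMap)

variable (EG EO G) in
theorem exists_orbitChart' (α : O) : Nonempty (OrbitChart EG EO G α (orbitRank EG EO G α)
    (Module.finrank ℝ EO - orbitRank EG EO G α)) := by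
  refine exists_orbitChart α rfl ?_
  have := Submodule.finrank_le
    (LinearMap.range (md 𝓘(ℝ, EG) 𝓘(ℝ, EO) (fun g : G => g • α) 1).toLinearMap)
  exact Nat.add_sub_cancel' this

variable (EG EO G) in
/-- The orbit map of a transitive action has local sections. -/
theorem exists_orbitMap_section [SecondCountableTopology G] [MulAction.IsPretransitive G O]
    (α : O) : ∃ (V : Set O) (κ : O → G), IsOpen V ∧ α ∈ V ∧
      ContMDiffOn 𝓘(ℝ, EO) 𝓘(ℝ, EG) ∞ κ V ∧ κ α = 1 ∧ ∀ β ∈ V, κ β • α = β := by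
  obtain ⟨Z⟩ := exists_orbitChart' EG EO G α
  have := Z.subsingleton_of_isPretransitive
  refine ⟨Z.θ.source, Z.κ, Z.θ.open_source, Z.mem_source, Z.smooth_κ, Z.κ_base, fun β hβ => ?_⟩
  have h1 : (Z.κ β)⁻¹ • β = α := by
    refine Z.θ.injOn (Z.κ_mem β hβ) Z.mem_source ?_
    rw [Z.κ_eq β hβ, Z.map_base]
    exact Prod.ext rfl (Subsingleton.elim _ _)
  exact (inv_smul_eq_iff.1 h1).symm

variable (EG EO) in
/-- The orbit map of a transitive action is a submersion. -/
theorem md_orbitMap_surjective [SecondCountableTopology G] [MulAction.IsPretransitive G O]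
    (α : O) (g : G) : Function.Surjective (md 𝓘(ℝ, EG) 𝓘(ℝ, EO) (fun g : G => g • α) g) := by
  have h1 : Function.Surjective (md 𝓘(ℝ, EG) 𝓘(ℝ, EO) (fun g : G => g • α) 1) := by
    obtain ⟨V, κ, hV, hα, hκ, hκ1, hκα⟩ := exists_orbitMap_section EG EO G α
    intro v
    have h := md_comp_apply (g := fun g : G => g • α) (f := κ) (I := 𝓘(ℝ, EO)) (J := 𝓘(ℝ, EG))
      (L := 𝓘(ℝ, EO)) α
      ((contMDiff_orbitMap EG EO G α).mdifferentiableAt (by simp)) (ContMDiffOn.mdiffAt hκ hV hα) v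
    rw [md_congr_of_isOpen hV (f := fun β => κ β • α) (g := fun β => β) hκα hα, md_id, hκ1] at h
    exact ⟨_, h.symm⟩
  intro v
  obtain ⟨v', hv'⟩ := (md_const_smul_bijective EG g α).2 v
  obtain ⟨X, hX⟩ := h1 v'
  refine ⟨md 𝓘(ℝ, EG) 𝓘(ℝ, EG) (fun y : G => g * y) 1 X, ?_⟩
  have := md_orbitMap_mul (EO := EO) α g (1 : G) X
  rw [mul_one, one_smul, hX, hv'] at this
  exact this

variable (EG EO G) in
theorem finrank_range_md_orbitMap_of_isPretransitive [SecondCountableTopology G]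
    [MulAction.IsPretransitive G O] (α : O) (g : G) :
    Module.finrank ℝ (LinearMap.range
      (md 𝓘(ℝ, EG) 𝓘(ℝ, EO) (fun g : G => g • α) g).toLinearMap) = Module.finrank ℝ EO := by
  rw [LinearMap.range_eq_top.2 (md_orbitMap_surjective EG EO α g), finrank_top]

variable (EG EO) in
theorem finrank_le_of_isPretransitive [SecondCountableTopology G]
    [MulAction.IsPretransitive G O] (α : O) : Module.finrank ℝ EO ≤ Module.finrank ℝ EG :=
  LinearMap.finrank_le_finrank_of_surjective
    (f := (md 𝓘(ℝ, EG) 𝓘(ℝ, EO) (fun g : G => g • α) 1).toLinearMap)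
    (md_orbitMap_surjective EG EO α 1)

variable (EG EO G) in
/-- The stabiliser of a point under a transitive action is a submanifold. -/
theorem exists_submanifoldAtlas_stabilizer [SecondCountableTopology G]
    [MulAction.IsPretransitive G O] (α : O) :
    Nonempty (SubmanifoldAtlas EG (Subtype.val : MulAction.stabilizer G α → G)
      (Module.finrank ℝ EG - Module.finrank ℝ EO)) := by
  refine exists_submanifoldAtlas_of_levelSet IsInducing.subtypeVal Subtype.val_injective
    (contMDiff_orbitMap EG EO G α) (α := α) (fun g => ?_)
    (fun g _ => md_orbitMap_surjective EG EO α g) ?_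
  · rw [Subtype.range_val]; exact MulAction.mem_stabilizer_iff
  · have := finrank_le_of_isPretransitive (O := O) (G := G) EG EO α
    omega

theorem isInducing_stabPIncl (P : Subgroup G) (α : O) : IsInducing (stabPIncl P α) := by
  have h1 : IsInducing (fun q : stabP P α => ((q : MulAction.stabilizer G α) : G)) :=
    (IsInducing.subtypeVal (t := (MulAction.stabilizer G α : Set G))).comp
      (IsInducing.subtypeVal (t := (stabP P α : Set (MulAction.stabilizer G α))))
  have h2 : Continuous (stabPIncl P α) :=
    Continuous.subtype_mk (continuous_subtype_val.comp continuous_subtype_val) _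
  exact IsInducing.of_comp h2 continuous_subtype_val h1

theorem stabPIncl_injective (P : Subgroup G) (α : O) : Function.Injective (stabPIncl P α) := by
  intro q q' h
  have h' : ((q : MulAction.stabilizer G α) : G) = ((q' : MulAction.stabilizer G α) : G) :=
    congrArg (fun p : P => (p : G)) h
  exact Subtype.ext (Subtype.ext h')

theorem stabPIncl_smul (P : Subgroup G) (α : O) (q : stabP P α) : stabPIncl P α q • α = α :=
  q.1.2

theorem mem_range_stabPIncl (P : Subgroup G) (α : O) (p : P) :
    p ∈ range (stabPIncl P α) ↔ p • α = α := by
  constructor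
  · rintro ⟨q, rfl⟩; exact stabPIncl_smul P α q
  · intro h
    exact ⟨⟨⟨p, h⟩, p.2⟩, rfl⟩

variable (EP EO) in
/-- The stabiliser of a point in a closed subgroup is a submanifold of this subgroup. As the orbit
map has constant rank, the stabiliser is locally a level set of the first component of an orbit
chart. -/
theorem exists_submanifoldAtlas_stabP (P : Subgroup G) [ChartedSpace EP P]
    [LieGroup 𝓘(ℝ, EP) ∞ P] [ContMDiffSMul 𝓘(ℝ, EP) 𝓘(ℝ, EO) ∞ P O] (α : O) :
    Nonempty (SubmanifoldAtlas EP (stabPIncl P α)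
      (Module.finrank ℝ EP - orbitRank EP EO P α)) := by
  obtain ⟨Z⟩ := exists_orbitChart' EP EO P α
  set r := orbitRank EP EO P α with hr
  set m := Module.finrank ℝ EO - r with hm
  refine exists_submanifoldAtlas_of_isInducing (V := EuclideanSpace ℝ (Fin r))
    (isInducing_stabPIncl P α) (stabPIncl_injective P α) fun q => ?_
  set p := stabPIncl P α q
  have hpα : p • α = α := stabPIncl_smul P α q
  have hp : p • α ∈ Z.θ.source := by rw [hpα]; exact Z.mem_source
  obtain ⟨W, hW, hWo, hpW⟩ := eventually_nhds_iff.1 (Z.eventually_snd_eq hp)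
  let U : Set P := {p | p • α ∈ Z.θ.source} ∩ W
  have hU : IsOpen U := Z.isOpen_preimage.inter hWo
  have hF : ContMDiffOn 𝓘(ℝ, EP) (𝓡 r) ∞ (fun p : P => (Z.θ (p • α)).1) U :=
    contDiff_fst.contMDiff.comp_contMDiffOn (Z.contMDiffOn_orbit.mono inter_subset_left)
  have hsurj : Function.Surjective
      (md 𝓘(ℝ, EP) (𝓡 r) (fun p : P => (Z.θ (p • α)).1) p) := by
    intro v
    obtain ⟨X, hX⟩ := Z.exists_md_eq p hp v
    refine ⟨X, ?_⟩
    have h := md_comp_apply (g := Prod.fst) (f := fun h : P => Z.θ (h • α)) (I := 𝓘(ℝ, EP))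
      (J := 𝓘(ℝ, EuclideanSpace ℝ (Fin r) × EuclideanSpace ℝ (Fin m)))
      (L := 𝓡 r) p
      (contDiff_fst.contMDiff.mdifferentiableAt (n := ∞) (by simp))
      (ContMDiffOn.mdiffAt Z.contMDiffOn_orbit Z.isOpen_preimage hp) X
    rw [md_eq_fderiv, fderiv_fst, hX] at h
    exact h
  have hle : r ≤ Module.finrank ℝ EP := by
    have := (md 𝓘(ℝ, EP) 𝓘(ℝ, EO) (fun g : P => g • α) 1).toLinearMap.finrank_range_le
    exact this
  obtain ⟨Ψ, h1, h2, h3, h4⟩ := exists_slice hU hF (x := p) ⟨hp, hpW⟩ hsurj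
    (k := Module.finrank ℝ EP - r) (by simp; omega)
  refine ⟨Ψ, 0, h3, h1, fun p' hp' => ?_⟩
  have hp'U := h2 hp'
  have h5 : (Z.θ (p' • α)).2 = 0 := by
    rw [hW p' hp'U.2, hpα, Z.map_base]; rfl
  rw [mem_range_stabPIncl, h4 p' hp']
  constructor
  · intro h; rw [h, Z.map_base]; rfl
  · intro h
    refine Z.θ.injOn hp'U.1 Z.mem_source ?_
    rw [Z.map_base]
    exact Prod.ext h h5

variable (EP EO) in
/-- The Lie algebra of the stabiliser in a closed subgroup is the kernel of the infinitesimal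
action. -/
theorem exists_md_param_stabP_eq (P : Subgroup G) [ChartedSpace EP P]
    [LieGroup 𝓘(ℝ, EP) ∞ P] [ContMDiffSMul 𝓘(ℝ, EP) 𝓘(ℝ, EO) ∞ P O] (α : O)
    (A : SubmanifoldAtlas EP (stabPIncl P α) (Module.finrank ℝ EP - orbitRank EP EO P α))
    {Y : EP} (hY : md 𝓘(ℝ, EP) 𝓘(ℝ, EO) (fun p : P => p • α) 1 Y = 0) :
    ∃ w, md (𝓡 (Module.finrank ℝ EP - orbitRank EP EO P α)) 𝓘(ℝ, EP)
      (fun z => stabPIncl P α (A.param 1 z)) (A.chart 1 1) w = Y := by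
  have hle : orbitRank EP EO P α ≤ Module.finrank ℝ EP :=
    (md 𝓘(ℝ, EP) 𝓘(ℝ, EO) (fun g : P => g • α) 1).toLinearMap.finrank_range_le
  exact A.exists_md_param_eq (f := fun p : P => p • α) (contMDiff_orbitMap EP EO P α)
    (stabPIncl_smul P α) 1 (Nat.sub_add_cancel hle) hY

end Stabilizers

/-! ### Sections of the Cartan bundle adapted to a holonomy reduction -/

/-- Continuous maps with countably many values are locally constant on locally connected spaces. -/
theorem isOpen_fiber_of_countable {X Y : Type*} [TopologicalSpace X] [LocallyConnectedSpace X]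
    [MetricSpace Y] {g : X → Y} {U : Set X} (hU : IsOpen U) (hg : ContinuousOn g U) {A : Set Y}
    (hA : A.Countable) (h : MapsTo g U A) (a : Y) : IsOpen {x | x ∈ U ∧ g x = a} := by
  rw [isOpen_iff_mem_nhds]
  rintro x ⟨hx, rfl⟩
  obtain ⟨V, hVU, hVo, hxV, hV⟩ :=
    locallyConnectedSpace_iff_subsets_isOpen_isConnected.1 ‹_› x U (hU.mem_nhds hx)
  refine Filter.mem_of_superset (hVo.mem_nhds hxV) fun y hy => ⟨hVU hy, ?_⟩
  exact eqOn_of_countable hV.isPreconnected (hg.mono hVU) hA (h.mono_left hVU) hy hxV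

namespace CartanGeometry

variable {EG : Type*} [NormedAddCommGroup EG] [NormedSpace ℝ EG] [FiniteDimensional ℝ EG]
  {EP : Type*} [NormedAddCommGroup EP] [NormedSpace ℝ EP] [FiniteDimensional ℝ EP]
  {EB : Type*} [NormedAddCommGroup EB] [NormedSpace ℝ EB] [FiniteDimensional ℝ EB]
  {EM : Type*} [NormedAddCommGroup EM] [NormedSpace ℝ EM] [FiniteDimensional ℝ EM]
  {EO : Type*} [NormedAddCommGroup EO] [NormedSpace ℝ EO] [FiniteDimensional ℝ EO]
  {G : Type*} [Group G] [TopologicalSpace G] [ChartedSpace EG G] [LieGroup 𝓘(ℝ, EG) ∞ G]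
  [SecondCountableTopology G]
  {P : Subgroup G} [ChartedSpace EP P] [LieGroup 𝓘(ℝ, EP) ∞ P]
  {B : Type*} [TopologicalSpace B] [ChartedSpace EB B] [IsManifold 𝓘(ℝ, EB) ∞ B]
  {M : Type*} [TopologicalSpace M] [ChartedSpace EM M] [IsManifold 𝓘(ℝ, EM) ∞ M]
  {O : Type*} [TopologicalSpace O] [ChartedSpace EO O] [IsManifold 𝓘(ℝ, EO) ∞ O]
  [MulAction G O] [ContMDiffSMul 𝓘(ℝ, EG) 𝓘(ℝ, EO) ∞ G O] [MulAction.IsPretransitive G O]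
  [ContMDiffSMul 𝓘(ℝ, EP) 𝓘(ℝ, EO) ∞ P O]
  {C : CartanGeometry EG EP EB EM P B M} {s : B → O}

/-- The points of type `P • α` are those over which `s` takes the value `α`. -/
theorem mem_curvedOrbit_iff (heq : ∀ (u : B) (p : P), s (C.act u p) = (p : G)⁻¹ • s u)
    {i : Set O} {α : O} (hi : i = MulAction.orbit P α) {x : M} :
    x ∈ C.curvedOrbit s i ↔ ∃ u, C.proj u = x ∧ s u = α := by
  constructor
  · intro h
    have hα : α ∈ C.pType s x := by
      rw [show C.pType s x = i from h, hi]; exact MulAction.mem_orbit_self α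
    obtain ⟨u, hu, h'⟩ := hα
    exact ⟨u, hu, h'⟩
  · rintro ⟨u, rfl, rfl⟩
    show C.pType s (C.proj u) = i
    rw [hi]
    ext β
    constructor
    · rintro ⟨v, hv, rfl⟩
      obtain ⟨p, rfl⟩ := C.exists_act_eq (u := u) (v := v) hv.symm
      exact ⟨p⁻¹, by rw [heq]; rfl⟩
    · rintro ⟨p, rfl⟩
      exact ⟨C.act u p⁻¹, C.proj_act u _, by rw [heq]; simp [Subgroup.smul_def]⟩

theorem HolonomyReduction.equivariant' (hs : C.HolonomyReduction (EO := EO) s)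
    (u : B) (p : P) : s (C.act u p) = p⁻¹ • s u := by
  rw [hs.equivariant]; rfl

/-- Holonomy reductions are submersions, since `G` acts transitively on `O` and the Cartan
connection is surjective. -/
theorem HolonomyReduction.md_surjective (hs : C.HolonomyReduction (EO := EO) s)
    (u : B) :
    Function.Surjective (md 𝓘(ℝ, EB) 𝓘(ℝ, EO) s u) := by
  intro v
  obtain ⟨X, hX⟩ := md_orbitMap_surjective EG EO (s u) (1 : G) (-v)
  obtain ⟨ξ, rfl⟩ := (C.om_bijective u).2 X
  exact ⟨ξ, by rw [hs.md_eq, hX, neg_neg]⟩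

/-- Around each point `u` with `s u = α`, there is a section `lam` of the Cartan bundle along which
`s` takes values in a transversal to the orbit of `α` under `P`. The corresponding map `τ` to the
transversal is a submersion, it takes countably many values on the curved orbit, and `lam` maps its
zeros to points of `{s = α}`. -/
theorem HolonomyReduction.exists_adapted_section (hs : C.HolonomyReduction (EO := EO) s)
    [SecondCountableTopology P] {α : O} {u : B}
    (hu : s u = α) :
    ∃ (W : Set M) (lam : M → B)
      (τ : M → EuclideanSpace ℝ (Fin (Module.finrank ℝ EO - orbitRank EP EO P α)))
      (A : Set (EuclideanSpace ℝ (Fin (Module.finrank ℝ EO - orbitRank EP EO P α)))),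
      IsOpen W ∧ C.proj u ∈ W ∧ ContMDiffOn 𝓘(ℝ, EM) 𝓘(ℝ, EB) ∞ lam W ∧
      (∀ y ∈ W, C.proj (lam y) = y) ∧ lam (C.proj u) = u ∧
      ContMDiffOn 𝓘(ℝ, EM) (𝓡 (Module.finrank ℝ EO - orbitRank EP EO P α)) ∞ τ W ∧
      Function.Surjective (md 𝓘(ℝ, EM) (𝓡 (Module.finrank ℝ EO - orbitRank EP EO P α)) τ
        (C.proj u)) ∧
      A.Countable ∧ (∀ v, C.proj v ∈ W → s v = α → τ (C.proj v) ∈ A) ∧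
      ∀ y ∈ W, τ y = 0 ↔ s (lam y) = α := by
  obtain ⟨Z⟩ := exists_orbitChart' EP EO P α
  set r := orbitRank EP EO P α with hr
  set m := Module.finrank ℝ EO - r with hm
  obtain ⟨U, σ, hU, huU, hσ, hσ1, hσ2⟩ := C.exists_section u
  have hsσ : ContMDiffOn 𝓘(ℝ, EM) 𝓘(ℝ, EO) ∞ (fun y => s (σ y)) U := hs.smooth.comp_contMDiffOn hσ
  let W : Set M := U ∩ (fun y => s (σ y)) ⁻¹' Z.θ.source
  have hW : IsOpen W := hsσ.continuousOn.isOpen_inter_preimage hU Z.θ.open_source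
  have huW : C.proj u ∈ W := ⟨huU, by
    rw [mem_preimage, hσ2, hu]; exact Z.mem_source⟩
  let τ : M → EuclideanSpace ℝ (Fin m) := fun y => (Z.θ (s (σ y))).2
  let lam : M → B := fun y => C.act (σ y) (Z.κ (s (σ y)))
  have hslam : ∀ y, s (lam y) = (Z.κ (s (σ y)))⁻¹ • s (σ y) := fun y => hs.equivariant' _ _
  have hθs : ContMDiffOn 𝓘(ℝ, EM) 𝓘(ℝ, EuclideanSpace ℝ (Fin r) × EuclideanSpace ℝ (Fin m)) ∞
      (fun y => Z.θ (s (σ y))) W :=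
    Z.isPDiffeo.1.comp (hsσ.mono inter_subset_left) fun y hy => hy.2
  refine ⟨W, lam, τ, _, hW, huW, ?_, fun y hy => ?_, ?_, ?_, ?_, Z.countable_snd, fun v hv hvα =>
      ?_,
    fun y hy => ?_⟩
  · exact C.contMDiff_act.comp_contMDiffOn ((hσ.mono inter_subset_left).prodMk
      (Z.smooth_κ.comp (hsσ.mono inter_subset_left) fun y hy => hy.2))
  · exact (C.proj_act _ _).trans (hσ1 y hy.1)
  · simp only [lam, hσ2, hu, Z.κ_base, C.act_one]
  · exact contDiff_snd.contMDiff.comp_contMDiffOn hθs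
  · -- the derivatives of `τ ∘ proj` and `θ₂ ∘ s` agree, since they agree on vertical vectors
    let t : B → EuclideanSpace ℝ (Fin m) := fun v => (Z.θ (s v)).2
    have hV : IsOpen (s ⁻¹' Z.θ.source) := Z.θ.open_source.preimage hs.smooth.continuous
    have huV : u ∈ s ⁻¹' Z.θ.source := by rw [mem_preimage, hu]; exact Z.mem_source
    have hθ2 : ContMDiffOn 𝓘(ℝ, EO) (𝓡 m) ∞ (fun β => (Z.θ β).2) Z.θ.source :=
      contDiff_snd.contMDiff.comp_contMDiffOn Z.isPDiffeo.1
    have ht : ContMDiffOn 𝓘(ℝ, EB) (𝓡 m) ∞ t (s ⁻¹' Z.θ.source) :=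
      hθ2.comp hs.smooth.contMDiffOn fun v hv => hv
    have htu : MDifferentiableAt 𝓘(ℝ, EB) (𝓡 m) t u := ContMDiffOn.mdiffAt ht hV huV
    have hsurj : Function.Surjective (md 𝓘(ℝ, EB) (𝓡 m) t u) := by
      intro w
      obtain ⟨w', hw'⟩ := (Z.isPDiffeo.md_bijective Z.mem_source).2 (0, w)
      obtain ⟨ξ, hξ⟩ := hs.md_surjective u w'
      refine ⟨ξ, ?_⟩
      have h1 := md_comp_apply (g := fun β => (Z.θ β).2) (f := s) (L := 𝓡 m) u
        (ContMDiffOn.mdiffAt hθ2 Z.θ.open_source huV) (hs.smooth.mdifferentiableAt (by simp)) ξ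
      have h2 := md_comp_apply (g := Prod.snd) (f := Z.θ) (I := 𝓘(ℝ, EO))
        (J := 𝓘(ℝ, EuclideanSpace ℝ (Fin r) × EuclideanSpace ℝ (Fin m))) (L := 𝓡 m) α
        (contDiff_snd.contMDiff.mdifferentiableAt (n := ∞) (by simp))
        (Z.isPDiffeo.mdiffAt Z.mem_source) w'
      rw [md_eq_fderiv, fderiv_snd, hw'] at h2
      rw [hξ, hu] at h1
      exact h1.trans h2
    have hvert : ∀ Y : EP, md 𝓘(ℝ, EB) (𝓡 m) t u
        (md 𝓘(ℝ, EP) 𝓘(ℝ, EB) (fun p => C.act u p) 1 Y) = 0 := by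
      intro Y
      have h1 := md_comp_apply (g := t) (f := fun p => C.act u p) (L := 𝓡 m) 1
        (by rw [C.act_one]; exact htu) ((C.contMDiff_act_right u).mdifferentiableAt (by simp)) Y
      have hα1 : ((1 : P)⁻¹) • α ∈ Z.θ.source := by rw [inv_one, one_smul]; exact Z.mem_source
      have hg : MDifferentiableAt 𝓘(ℝ, EP) (𝓡 m) (fun h : P => (Z.θ (h • α)).2) (1 : P)⁻¹ :=
        ContMDiffOn.mdiffAt (contDiff_snd.contMDiff.comp_contMDiffOn Z.contMDiffOn_orbit)
          Z.isOpen_preimage hα1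
      have h2 := md_comp_apply (g := fun h : P => (Z.θ (h • α)).2) (f := fun p : P => p⁻¹)
        (L := 𝓡 m) 1 hg ((contMDiff_inv 𝓘(ℝ, EP) ∞).mdifferentiableAt (by simp)) Y
      have h3 := md_comp_apply (g := Prod.snd) (f := fun h : P => Z.θ (h • α)) (I := 𝓘(ℝ, EP))
        (J := 𝓘(ℝ, EuclideanSpace ℝ (Fin r) × EuclideanSpace ℝ (Fin m))) (L := 𝓡 m) (1 : P)⁻¹
        (contDiff_snd.contMDiff.mdifferentiableAt (n := ∞) (by simp))
        (ContMDiffOn.mdiffAt Z.contMDiffOn_orbit Z.isOpen_preimage hα1)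
        (md 𝓘(ℝ, EP) 𝓘(ℝ, EP) (fun p : P => p⁻¹) 1 Y)
      rw [md_eq_fderiv, fderiv_snd] at h3
      have h4 : (fun p : P => t (C.act u p)) = fun p : P => (Z.θ (p⁻¹ • α)).2 := by
        funext p; simp only [t, hs.equivariant', hu]
      rw [C.act_one, h4] at h1
      rw [← h1, h2, h3]
      exact Z.md_snd_eq _ hα1 _
    intro w
    obtain ⟨ξ, hξ⟩ := hsurj w
    refine ⟨md 𝓘(ℝ, EB) 𝓘(ℝ, EM) C.proj u ξ, ?_⟩
    have h1 := md_comp_apply (g := t) (f := σ) (L := 𝓡 m) (C.proj u) (by rw [hσ2]; exact htu)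
      (ContMDiffOn.mdiffAt hσ hU huU) (md 𝓘(ℝ, EB) 𝓘(ℝ, EM) C.proj u ξ)
    rw [hσ2] at h1
    set ξ' := md 𝓘(ℝ, EM) 𝓘(ℝ, EB) σ (C.proj u) (md 𝓘(ℝ, EB) 𝓘(ℝ, EM) C.proj u ξ) with hξ'
    have h2 := md_comp_apply (g := C.proj) (f := σ) (L := 𝓘(ℝ, EM)) (C.proj u)
      (C.contMDiff_proj.mdifferentiableAt (by simp)) (ContMDiffOn.mdiffAt hσ hU huU)
      (md 𝓘(ℝ, EB) 𝓘(ℝ, EM) C.proj u ξ)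
    rw [hσ2, md_congr_of_isOpen hU (f := fun y => C.proj (σ y)) (g := fun y => y) hσ1 huU,
      md_id] at h2
    obtain ⟨Y, hY⟩ := C.exists_md_act_eq (u := u) (ξ := ξ - ξ') (by
      rw [map_sub]; exact sub_eq_zero.2 h2)
    have h3 := hvert Y
    rw [hY, map_sub, sub_eq_zero] at h3
    exact h1.trans (h3.symm.trans hξ)
  · have hp : C.proj (lam (C.proj v)) = C.proj v := (C.proj_act _ _).trans (hσ1 _ hv.1)
    obtain ⟨p, hp⟩ := C.exists_act_eq hp.symm
    refine ⟨s (lam (C.proj v)), ⟨?_, ?_⟩, ?_⟩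
    · rw [hslam]; exact Z.κ_mem _ hv.2
    · rw [← hp, hs.equivariant', hvα]; exact ⟨p⁻¹, rfl⟩
    · simp only [hslam, Z.κ_eq _ hv.2, τ]
  · rw [hslam]
    constructor
    · intro h
      refine Z.θ.injOn (Z.κ_mem _ hy.2) Z.mem_source ?_
      rw [Z.κ_eq _ hy.2, Z.map_base]
      exact Prod.ext rfl h
    · intro h
      have := Z.κ_eq _ hy.2
      rw [h, Z.map_base] at this
      exact (congrArg Prod.snd this).symm

/-- For maps into the curved orbit from a locally connected space, the condition `τ = 0` on the
transversal map is open. -/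
theorem isOpen_preimage_zero {X : Type*} [TopologicalSpace X]
    [LocallyConnectedSpace X] {α : O} {j : X → M} (hj : Continuous j)
    (hα : ∀ x, ∃ u, C.proj u = j x ∧ s u = α) {m : ℕ} {W : Set M} {τ : M → EuclideanSpace ℝ (Fin m)}
    {A : Set (EuclideanSpace ℝ (Fin m))} (hW : IsOpen W) (hτ : ContinuousOn τ W)
    (hA : A.Countable) (hτA : ∀ v, C.proj v ∈ W → s v = α → τ (C.proj v) ∈ A) :
    IsOpen {x | j x ∈ W ∧ τ (j x) = 0} := by
  refine isOpen_fiber_of_countable (hW.preimage hj) (hτ.comp hj.continuousOn fun x hx => hx) hA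
    (fun x hx => ?_) 0
  obtain ⟨u, hu, hsu⟩ := hα x
  show τ (j x) ∈ A
  rw [← hu]
  exact hτA u (by rw [hu]; exact hx) hsu

end CartanGeometry

/-! ### Curved orbits are initial submanifolds -/

theorem secondCountableTopology_subtype {X : Type*} [TopologicalSpace X]
    [SecondCountableTopology X] (p : X → Prop) : SecondCountableTopology {x // p x} :=
  IsInducing.subtypeVal.secondCountableTopology

namespace CartanGeometry

variable {EG : Type*} [NormedAddCommGroup EG] [NormedSpace ℝ EG] [FiniteDimensional ℝ EG]
  {EP : Type*} [NormedAddCommGroup EP] [NormedSpace ℝ EP] [FiniteDimensional ℝ EP]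
  {EB : Type*} [NormedAddCommGroup EB] [NormedSpace ℝ EB] [FiniteDimensional ℝ EB]
  {EM : Type*} [NormedAddCommGroup EM] [NormedSpace ℝ EM] [FiniteDimensional ℝ EM]
  {EO : Type*} [NormedAddCommGroup EO] [NormedSpace ℝ EO] [FiniteDimensional ℝ EO]
  {G : Type*} [Group G] [TopologicalSpace G] [ChartedSpace EG G] [LieGroup 𝓘(ℝ, EG) ∞ G]
  [SecondCountableTopology G]
  {P : Subgroup G} [ChartedSpace EP P] [LieGroup 𝓘(ℝ, EP) ∞ P]
  {B : Type*} [TopologicalSpace B] [ChartedSpace EB B] [IsManifold 𝓘(ℝ, EB) ∞ B]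
  {M : Type*} [TopologicalSpace M] [ChartedSpace EM M] [IsManifold 𝓘(ℝ, EM) ∞ M]
  {O : Type*} [TopologicalSpace O] [ChartedSpace EO O] [IsManifold 𝓘(ℝ, EO) ∞ O]
  [MulAction G O] [ContMDiffSMul 𝓘(ℝ, EG) 𝓘(ℝ, EO) ∞ G O] [MulAction.IsPretransitive G O]
  [ContMDiffSMul 𝓘(ℝ, EP) 𝓘(ℝ, EO) ∞ P O]
  {C : CartanGeometry EG EP EB EM P B M} {s : B → O}

/-- The reduction `{u | s u = α}` of the Cartan bundle. -/
abbrev Reduction (s : B → O) (α : O) := {u : B // s u = α}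

/-- The reduction is a regular level set. -/
theorem HolonomyReduction.exists_submanifoldAtlas_reduction
    (hs : C.HolonomyReduction (EO := EO) s) (α : O) :
    Nonempty (SubmanifoldAtlas EB (Subtype.val : Reduction s α → B)
      (Module.finrank ℝ EB - Module.finrank ℝ EO)) := by
  by_cases h : IsEmpty B
  · -- over an empty bundle, the dimensions need not match, but there is nothing to show
    exact exists_submanifoldAtlas_of_isInducing (V := EO) IsInducing.subtypeVal
      Subtype.val_injective fun n => (h.false n.1).elim
  have hB : Nonempty B := not_isEmpty_iff.1 h
  refine exists_submanifoldAtlas_of_levelSet IsInducing.subtypeVal Subtype.val_injective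
    hs.smooth (α := α) (fun u => ?_) (fun u _ => hs.md_surjective u) ?_
  · exact ⟨by rintro ⟨v, rfl⟩; exact v.2, fun hu => ⟨⟨u, hu⟩, rfl⟩⟩
  · have := LinearMap.finrank_le_finrank_of_surjective
      (f := (md 𝓘(ℝ, EB) 𝓘(ℝ, EO) s hB.some).toLinearMap) (hs.md_surjective hB.some)
    omega

theorem HolonomyReduction.locallyConnectedSpace_reduction
    (hs : C.HolonomyReduction (EO := EO) s) (α : O) : LocallyConnectedSpace (Reduction s α) := by
  obtain ⟨A⟩ := hs.exists_submanifoldAtlas_reduction α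
  let := A.chartedSpace
  exact ChartedSpace.locallyConnectedSpace
    (EuclideanSpace ℝ (Fin (Module.finrank ℝ EB - Module.finrank ℝ EO))) _

/-- The set of points over which `s` takes the value `α`, with the quotient topology from
`{u | s u = α}`. In general this topology is finer than the subspace topology. -/
def Leaf (C : CartanGeometry EG EP EB EM P B M) (s : B → O) (α : O) :=
  {x : M // ∃ u, C.proj u = x ∧ s u = α}

namespace Leaf

variable {α : O}

/-- The projection of the reduction `{u | s u = α}` onto its base. -/
def mk (C : CartanGeometry EG EP EB EM P B M) (u : Reduction s α) : Leaf C s α :=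
  ⟨C.proj u, u, rfl, u.2⟩

instance : TopologicalSpace (Leaf C s α) := TopologicalSpace.coinduced (mk C) inferInstance

/-- The inclusion into the base of the ambient bundle. -/
def incl (n : Leaf C s α) : M := n.1

theorem incl_injective : Function.Injective (incl : Leaf C s α → M) := Subtype.val_injective

theorem incl_mk (u : Reduction s α) : incl (mk C u) = C.proj u := rfl

theorem mk_surjective : Function.Surjective (mk C : Reduction s α → Leaf C s α) := by
  rintro ⟨_, u, rfl, hu⟩
  exact ⟨⟨u, hu⟩, rfl⟩

theorem isQuotientMap_mk : IsQuotientMap (mk C : Reduction s α → Leaf C s α) :=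
  ⟨⟨rfl⟩, mk_surjective⟩

theorem continuous_incl : Continuous (incl : Leaf C s α → M) :=
  isQuotientMap_mk.continuous_iff.2 (C.contMDiff_proj.continuous.comp continuous_subtype_val)

/-- The projection is open, since the fibres of the reduction are orbits of the stabiliser of `α`.
-/
theorem isOpenMap_mk (hs : C.HolonomyReduction (EO := EO) s) :
    IsOpenMap (mk C : Reduction s α → Leaf C s α) := by
  intro V hV
  rw [← isQuotientMap_mk.isOpen_preimage]
  -- the saturation of `V` is the union of its translates under the stabiliser of `α`
  let a : {p : P // p • α = α} → Reduction s α → Reduction s α := fun p u =>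
    ⟨C.act u.1 p.1⁻¹, by rw [hs.equivariant', u.2, inv_inv, p.2]⟩
  have ha : ∀ p, Continuous (a p) := fun p =>
    ((C.contMDiff_act_left _).continuous.comp continuous_subtype_val).subtype_mk _
  have : mk C ⁻¹' (mk C '' V) = ⋃ p, a p ⁻¹' V := by
    ext u
    simp only [mem_preimage, mem_image, mem_iUnion]
    constructor
    · rintro ⟨v, hv, hvu⟩
      obtain ⟨p, hp⟩ := C.exists_act_eq (u := u.1) (v := v.1) (congrArg incl hvu).symm
      have hpα : p⁻¹ • α = α := by
        have := hs.equivariant' u.1 p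
        rwa [hp, u.2, v.2, eq_comm] at this
      refine ⟨⟨p⁻¹, hpα⟩, ?_⟩
      have : a ⟨p⁻¹, hpα⟩ u = v := Subtype.ext (by simp only [a, inv_inv, hp])
      rwa [this]
    · rintro ⟨p, hp⟩
      exact ⟨_, hp, incl_injective (C.proj_act _ _)⟩
  rw [this]
  exact isOpen_iUnion fun p => hV.preimage (ha p)

end Leaf

variable {α : O}

/-- The leaf is a manifold immersed into the base: around each of its points, the zeros of a
transversal map in the curved orbit form an open subset of the leaf. -/
theorem HolonomyReduction.exists_submanifoldAtlas_leaf (hs : C.HolonomyReduction (EO := EO) s)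
    (α : O) : Nonempty (SubmanifoldAtlas EM (Leaf.incl : Leaf C s α → M)
      (Module.finrank ℝ EM - (Module.finrank ℝ EO - orbitRank EP EO P α))) := by
  refine exists_submanifoldAtlas
    (V := EuclideanSpace ℝ (Fin (Module.finrank ℝ EO - orbitRank EP EO P α)))
    Leaf.continuous_incl fun n => ?_
  obtain ⟨⟨u, hu⟩, rfl⟩ := Leaf.mk_surjective n
  have : SecondCountableTopology P := secondCountableTopology_subtype _
  obtain ⟨W, lam, τ, A, hW, huW, hlam, hlam1, hlam2, hτ, hτs, hA, hτA, h0⟩ :=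
    hs.exists_adapted_section hu
  have hτu : τ (C.proj u) = 0 := (h0 _ huW).2 (by rw [hlam2, hu])
  have hle := LinearMap.finrank_le_finrank_of_surjective (f := (md 𝓘(ℝ, EM)
    (𝓡 (Module.finrank ℝ EO - orbitRank EP EO P α)) τ (C.proj u)).toLinearMap) hτs
  obtain ⟨Ψ, h1, h2, h3, h4⟩ := exists_slice hW hτ huW hτs
    (k := Module.finrank ℝ EM - (Module.finrank ℝ EO - orbitRank EP EO P α)) (by
      rw [finrank_euclideanSpace_fin] at hle ⊢; omega)
  classical
  -- the inverse of the inclusion on the slice; the value elsewhere does not matter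
  let ι : M → Leaf C s α := fun m => if h : s (lam m) = α then Leaf.mk C ⟨lam m, h⟩ else
    Leaf.mk C ⟨u, hu⟩
  have hι : ∀ m, ∀ h : s (lam m) = α, ι m = Leaf.mk C ⟨lam m, h⟩ := fun m h => dif_pos h
  have hS : ∀ m ∈ Ψ.source, (Ψ m).1 = 0 → s (lam m) = α := fun m hm hm0 =>
    (h0 m (h2 hm)).1 (by rw [← h4 m hm, hm0])
  have hincl : ∀ m ∈ Ψ.source, (Ψ m).1 = 0 → (ι m).incl = m := fun m hm hm0 => by
    rw [hι m (hS m hm hm0), Leaf.incl_mk, hlam1 m (h2 hm)]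
  refine ⟨Ψ, 0, {n | n.incl ∈ Ψ.source ∧ τ n.incl = 0}, ι, h3, ⟨h1, hτu⟩, ?_, fun y hy => ?_,
    fun m hm hm0 => ⟨⟨?_, ?_⟩, hincl m hm hm0⟩, ?_⟩
  · rw [← Leaf.isQuotientMap_mk.isOpen_preimage]
    have := hs.locallyConnectedSpace_reduction α
    exact isOpen_preimage_zero (X := Reduction s α) (j := fun v => C.proj v.1)
      (C.contMDiff_proj.continuous.comp continuous_subtype_val) (fun v => ⟨v.1, rfl, v.2⟩)
      Ψ.open_source (hτ.continuousOn.mono h2) hA fun v hv => hτA v (h2 hv)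
  · have hy0 : (Ψ y.incl).1 = 0 := by rw [h4 _ hy.1, hy.2]
    exact ⟨hy.1, hy0, Leaf.incl_injective (hincl _ hy.1 hy0)⟩
  · show (ι m).incl ∈ Ψ.source
    rwa [hincl m hm hm0]
  · show τ (ι m).incl = 0
    rw [hincl m hm hm0, ← h4 m hm, hm0]
  · rw [continuousOn_iff_continuous_domRestrict]
    have hc : Continuous (fun m : {m | m ∈ Ψ.source ∧ (Ψ m).1 = 0} =>
        (⟨lam m, hS m m.2.1 m.2.2⟩ : Reduction s α)) :=
      (continuousOn_iff_continuous_domRestrict.1 (hlam.continuousOn.mono fun m hm => h2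
          hm.1)).subtype_mk
        _
    exact (Leaf.isQuotientMap_mk.continuous.comp hc).congr fun m =>
      (hι m (hS m m.2.1 m.2.2)).symm

/-- A map into the leaf is continuous if it is continuous as a map into the ambient manifold. -/
theorem HolonomyReduction.continuousOn_leaf (hs : C.HolonomyReduction (EO := EO) s) {X : Type*}
    [TopologicalSpace X] [LocallyConnectedSpace X] {f : X → Leaf C s α} {U : Set X} (hU : IsOpen U)
    (hf : ContinuousOn (fun x => (f x).incl) U) : ContinuousOn f U := by
  intro x hx
  refine ContinuousAt.continuousWithinAt ?_
  obtain ⟨⟨u, hu⟩, hux⟩ := Leaf.mk_surjective (f x)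
  have : SecondCountableTopology P := secondCountableTopology_subtype _
  obtain ⟨W, lam, τ, A, hW, huW, hlam, hlam1, hlam2, hτ, hτs, hA, hτA, h0⟩ :=
    hs.exists_adapted_section hu
  have hxu : (f x).incl = C.proj u := by rw [← hux]; rfl
  have hτu : τ (C.proj u) = 0 := (h0 _ huW).2 (by rw [hlam2, hu])
  have hUW : IsOpen (U ∩ (fun x => (f x).incl) ⁻¹' W) := hf.isOpen_inter_preimage hU hW
  have hopen : IsOpen {y | y ∈ U ∩ (fun x => (f x).incl) ⁻¹' W ∧ τ (f y).incl = 0} := by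
    refine isOpen_fiber_of_countable hUW (hτ.continuousOn.comp
      (hf.mono inter_subset_left) fun y hy => hy.2) hA
      (fun y hy => ?_) 0
    obtain ⟨⟨v, hv⟩, hvy⟩ := Leaf.mk_surjective (f y)
    have hyv : (f y).incl = C.proj v := by rw [← hvy]; rfl
    show τ (f y).incl ∈ A
    rw [hyv]
    exact hτA v (by rw [← hyv]; exact hy.2) hv
  -- on the open set `V`, the map `f` lifts to the reduction by `lam`
  set V := {y | y ∈ U ∩ (fun x => (f x).incl) ⁻¹' W ∧ τ (f y).incl = 0}
  have hxV : x ∈ V := ⟨⟨hx, by rw [mem_preimage, hxu]; exact huW⟩, by rw [hxu]; exact hτu⟩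
  refine ContinuousOn.continuousAt (s := V) ?_ (hopen.mem_nhds hxV)
  rw [continuousOn_iff_continuous_domRestrict]
  have hS : ∀ y ∈ V, s (lam (f y).incl) = α := fun y hy => (h0 _ hy.1.2).1 hy.2
  have hc : Continuous (fun y : V => (⟨lam (f y).incl, hS y y.2⟩ : Reduction s α)) :=
    (continuousOn_iff_continuous_domRestrict.1 (hlam.continuousOn.comp
      (hf.mono fun y (hy : y ∈ V) => hy.1.1) fun y hy => hy.1.2)).subtype_mk _
  exact (Leaf.isQuotientMap_mk.continuous.comp hc).congr fun y =>
    Leaf.incl_injective (hlam1 _ y.2.1.2)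

/-- A curved orbit is an initial submanifold. -/
theorem HolonomyReduction.nonempty_initialSubmanifold [T2Space M] [SecondCountableTopology B]
    (hs : C.HolonomyReduction (EO := EO) s) {S : Set M}
    (hS : ∀ x, x ∈ S ↔ ∃ u, C.proj u = x ∧ s u = α) :
    Nonempty (InitialSubmanifold (EM := EM) S) := by
  obtain ⟨A⟩ := hs.exists_submanifoldAtlas_leaf α
  have : SecondCountableTopology (Reduction s α) := secondCountableTopology_subtype _
  let := A.chartedSpace
  have := A.isManifold
  refine ⟨{
    dim := _
    Carrier := Leaf C s α
    t2 := T2Space.of_injective_continuous Leaf.incl_injective Leaf.continuous_incl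
    secondCountable :=
      Leaf.isQuotientMap_mk.secondCountableTopology (Leaf.isOpenMap_mk hs)
    incl := Leaf.incl
    injective := Leaf.incl_injective
    range_eq := by
      ext x
      rw [hS]
      exact ⟨by rintro ⟨n, rfl⟩; exact n.2, fun h => ⟨⟨x, h⟩, rfl⟩⟩
    isImmersion := A.isImmersion
    initial := fun n U f hU hf x hx => ?_ }⟩
  exact ((ContMDiffAt.iff_comp_isImmersionAt (A.isImmersion.isImmersionAt (f x))).2
    ⟨(hs.continuousOn_leaf hU hf.continuousOn).continuousAt (hU.mem_nhds hx),
      hf.contMDiffAt (hU.mem_nhds hx)⟩).contMDiffWithinAt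

end CartanGeometry

/-! ### The homogeneous space `G ⧸ P` -/

section Homogeneous

/-- There are smooth maps between manifolds with a prescribed derivative at a point. -/
theorem exists_contMDiffOn_md_eq {E : Type*} [NormedAddCommGroup E] [NormedSpace ℝ E]
    {E' : Type*} [NormedAddCommGroup E'] [NormedSpace ℝ E']
    {M : Type*} [TopologicalSpace M] [ChartedSpace E M] [IsManifold 𝓘(ℝ, E) ∞ M]
    {N : Type*} [TopologicalSpace N] [ChartedSpace E' N] [IsManifold 𝓘(ℝ, E') ∞ N]
    (x : M) (y : N) (L : E →L[ℝ] E') :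
    ∃ (U : Set M) (f : M → N), IsOpen U ∧ x ∈ U ∧ ContMDiffOn 𝓘(ℝ, E) 𝓘(ℝ, E') ∞ f U ∧
      f x = y ∧ md 𝓘(ℝ, E) 𝓘(ℝ, E') f x = L := by
  let φ := echart 𝓘(ℝ, E) x
  have hφ : IsPDiffeo 𝓘(ℝ, E) 𝓘(ℝ, E) φ := isPDiffeo_echart x
  have hx : x ∈ φ.source := mem_echart_source x
  let ψ := echart 𝓘(ℝ, E') y
  have hψ : IsPDiffeo 𝓘(ℝ, E') 𝓘(ℝ, E') ψ := isPDiffeo_echart y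
  have hy : y ∈ ψ.source := mem_echart_source y
  let i : E →L[ℝ] E' := (md 𝓘(ℝ, E') 𝓘(ℝ, E') ψ y).comp (L.comp (md 𝓘(ℝ, E) 𝓘(ℝ, E) φ.symm (φ x)))
  let a : E → E' := fun z => ψ y + i (z - φ x)
  have ha : ContDiff ℝ ∞ a := contDiff_const.add (i.contDiff.comp (contDiff_id.sub contDiff_const))
  have had : ∀ z, fderiv ℝ a z = i := fun z => by
    have h1 : HasFDerivAt (fun z : E => z - φ x) (ContinuousLinearMap.id ℝ E) z :=
      (hasFDerivAt_id z).sub_const _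
    have h2 : HasFDerivAt a (i.comp (ContinuousLinearMap.id ℝ E)) z :=
      (i.hasFDerivAt.comp z h1).const_add (ψ y)
    simpa using h2.fderiv
  have hax : a (φ x) = ψ y := by simp [a]
  let U : Set M := φ.source ∩ φ ⁻¹' (a ⁻¹' ψ.target)
  have hU : IsOpen U := φ.isOpen_inter_preimage (ψ.open_target.preimage ha.continuous)
  have hxU : x ∈ U := ⟨hx, by
    show a (φ x) ∈ ψ.target
    rw [hax]; exact ψ.map_source hy⟩
  have haφ : ContMDiffOn 𝓘(ℝ, E) 𝓘(ℝ, E') ∞ (fun m => a (φ m)) φ.source :=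
    ha.contMDiff.comp_contMDiffOn hφ.1
  refine ⟨U, fun m => ψ.symm (a (φ m)), hU, hxU,
    hψ.2.comp (haφ.mono inter_subset_left) fun m hm => hm.2, by
      simp only [hax, ψ.left_inv hy], ?_⟩
  ext v
  have h1 := md_comp_apply (g := ψ.symm) (f := fun m => a (φ m)) (L := 𝓘(ℝ, E')) x
    (by rw [hax]; exact hψ.symm.mdiffAt (ψ.map_source hy))
    (ContMDiffOn.mdiffAt haφ φ.open_source hx) v
  have h2 := md_comp_apply (g := a) (f := φ) (L := 𝓘(ℝ, E')) x
    (ha.contMDiff.mdifferentiableAt (by simp)) (hφ.mdiffAt hx) v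
  rw [md_eq_fderiv, had] at h2
  rw [h1, h2, hax]
  simp only [i, ContinuousLinearMap.comp_apply, hφ.md_symm_comp hx, hψ.md_symm_comp hy]

variable {EG : Type*} [NormedAddCommGroup EG] [NormedSpace ℝ EG] [FiniteDimensional ℝ EG]
  {EP : Type*} [NormedAddCommGroup EP] [NormedSpace ℝ EP] [FiniteDimensional ℝ EP]
  {G : Type*} [Group G] [TopologicalSpace G] [ChartedSpace EG G] [LieGroup 𝓘(ℝ, EG) ∞ G]

/-- A slice for the right multiplication by a subgroup `P`: a map `c` such that `(v, p) ↦ c v * p`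
is a diffeomorphism from `V × P` onto an open set `Ω` which is a union of cosets; the map `τ` is the
first component of its inverse. -/
structure CosetSlice (EG : Type*) [NormedAddCommGroup EG] [NormedSpace ℝ EG] {G : Type*} [Group G]
    [TopologicalSpace G] [ChartedSpace EG G] (P : Subgroup G) (d : ℕ) where
  V : Set (EuclideanSpace ℝ (Fin d))
  isOpen_V : IsOpen V
  zero_mem : 0 ∈ V
  c : EuclideanSpace ℝ (Fin d) → G
  smooth_c : ContMDiffOn (𝓡 d) 𝓘(ℝ, EG) ∞ c V
  c_zero : c 0 = 1
  Ω : Set G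
  isOpen_Ω : IsOpen Ω
  τ : G → EuclideanSpace ℝ (Fin d)
  smooth_τ : ContMDiffOn 𝓘(ℝ, EG) (𝓡 d) ∞ τ Ω
  mul_mem : ∀ v ∈ V, ∀ p ∈ P, c v * p ∈ Ω
  τ_mem : ∀ g ∈ Ω, τ g ∈ V
  τ_spec : ∀ g ∈ Ω, (c (τ g))⁻¹ * g ∈ P
  τ_mul : ∀ v ∈ V, ∀ p ∈ P, τ (c v * p) = v

/-- Slices for a closed Lie subgroup exist: the inverse function theorem applies to
`(v, p) ↦ c v * p` if `c` is transversal to `P` at `1`. As `P` carries the subspace topology,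
different points of a small slice are in different cosets. -/
theorem exists_cosetSlice {P : Subgroup G} [ChartedSpace EP P] (hP : IsClosedLieSubgroup EG EP P) :
    Nonempty (CosetSlice EG P (Module.finrank ℝ EG - Module.finrank ℝ EP)) := by
  set d := Module.finrank ℝ EG - Module.finrank ℝ EP
  have := hP.lieGroup
  have hv : ContMDiff 𝓘(ℝ, EP) 𝓘(ℝ, EG) ∞ (Subtype.val : P → G) := hP.isSmoothEmbedding.contMDiff
  have hL : Function.Injective (md 𝓘(ℝ, EP) 𝓘(ℝ, EG) (Subtype.val : P → G) 1) :=
    injective_md_of_isImmersion hP.isSmoothEmbedding.isImmersion 1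
  have hd : Module.finrank ℝ EP + d = Module.finrank ℝ EG :=
    Nat.add_sub_cancel' (LinearMap.finrank_le_finrank_of_injective (f :=
      (md 𝓘(ℝ, EP) 𝓘(ℝ, EG) (Subtype.val : P → G) 1).toLinearMap) hL)
  obtain ⟨q, hq⟩ := exists_coprod_bijective hL hd
  obtain ⟨U, c, hU, h0U, hc, hc0, hcd⟩ :=
    exists_contMDiffOn_md_eq (0 : EuclideanSpace ℝ (Fin d)) (1 : G) q
  let F : EuclideanSpace ℝ (Fin d) × P → G := fun z => c z.1 * z.2
  have hF : ContMDiffOn ((𝓡 d).prod 𝓘(ℝ, EP)) 𝓘(ℝ, EG) ∞ F (U ×ˢ univ) :=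
    (hc.comp contMDiff_fst.contMDiffOn fun z hz => hz.1).mul
      (hv.comp contMDiff_snd).contMDiffOn
  have hUo : IsOpen (U ×ˢ (univ : Set P)) := hU.prod isOpen_univ
  have hFd : Function.Bijective (md ((𝓡 d).prod 𝓘(ℝ, EP)) 𝓘(ℝ, EG) F (0, 1)) := by
    have h1 : ∀ z, md ((𝓡 d).prod 𝓘(ℝ, EP)) 𝓘(ℝ, EG) F (0, 1) z =
        ((md 𝓘(ℝ, EP) 𝓘(ℝ, EG) (Subtype.val : P → G) 1).coprod q) (z.2, z.1) := by
      rintro ⟨v, w⟩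
      rw [md_prod_apply (ContMDiffOn.mdiffAt hF hUo ⟨h0U, trivial⟩)]
      simp only [F, hc0, one_mul, Subgroup.coe_one, mul_one]
      rw [ContinuousLinearMap.coprod_apply, ← hcd, add_comm]
    have h2 : (md ((𝓡 d).prod 𝓘(ℝ, EP)) 𝓘(ℝ, EG) F (0, 1) :
        EuclideanSpace ℝ (Fin d) × EP → EG) = ((md 𝓘(ℝ, EP) 𝓘(ℝ, EG)
          (Subtype.val : P → G) 1).coprod q) ∘ Prod.swap := funext h1
    rw [h2]
    exact hq.comp Prod.swap_bijective
  obtain ⟨Φ, h0Φ, hΦU, hΦF, hΦ⟩ := exists_isPDiffeo_of_bijective_md hUo hF (x := (0, 1))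
    ⟨h0U, trivial⟩ hFd
  -- shrink the slice such that `c v` and `c v'` are in different cosets
  obtain ⟨V₁, W₁, hV₁, hW₁, h0V₁, h1W₁, hVW⟩ := isOpen_prod_iff.1 Φ.open_source 0 1 h0Φ
  obtain ⟨U₁, hU₁, hU₁W⟩ := isOpen_induced_iff.1 hW₁
  have hcc : ContinuousOn (fun z : EuclideanSpace ℝ (Fin d) × EuclideanSpace ℝ (Fin d) =>
      (c z.1)⁻¹ * c z.2) (U ×ˢ U) := by
    have := topologicalGroup_of_lieGroup 𝓘(ℝ, EG) ∞ (G := G)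
    exact (hc.continuousOn.comp continuousOn_fst fun z hz => hz.1).inv.mul
      (hc.continuousOn.comp continuousOn_snd fun z hz => hz.2)
  have hcco := hcc.isOpen_inter_preimage (hU.prod hU) hU₁
  obtain ⟨V₂, V₃, hV₂, hV₃, h0V₂, h0V₃, hVV⟩ := isOpen_prod_iff.1 hcco 0 0 ⟨⟨h0U, h0U⟩, by
    have : (1 : G) ∈ U₁ := by
      have : (1 : P) ∈ W₁ := h1W₁
      rw [← hU₁W] at this
      exact this
    simpa [hc0] using this⟩
  let V := U ∩ V₁ ∩ V₂ ∩ V₃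
  have hV : IsOpen V := ((hU.inter hV₁).inter hV₂).inter hV₃
  have hV1 : ∀ v ∈ V, (v, (1 : P)) ∈ Φ.source := fun v hv => hVW ⟨hv.1.1.2, h1W₁⟩
  have key : ∀ v ∈ V, ∀ v' ∈ V, ∀ p ∈ P, ∀ p' ∈ P, c v * p = c v' * p' → v = v' := by
    intro v hv v' hv' p hp p' hp' h
    have h1 : (c v)⁻¹ * c v' = p * p'⁻¹ := by
      rw [inv_mul_eq_iff_eq_mul, ← mul_assoc, h, mul_inv_cancel_right]
    let q : P := ⟨(c v)⁻¹ * c v', by rw [h1]; exact P.mul_mem hp (P.inv_mem hp')⟩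
    have hq : q ∈ W₁ := by
      rw [← hU₁W]
      exact (hVV (show (v, v') ∈ V₂ ×ˢ V₃ from ⟨hv.1.2, hv'.2⟩)).2
    have h2 : (v, q) ∈ Φ.source := hVW ⟨hv.1.1.2, hq⟩
    have h3 := Φ.injOn h2 (hV1 v' hv') (by
      rw [hΦF h2, hΦF (hV1 v' hv')]
      simp [F, q])
    exact congrArg Prod.fst h3
  let Ω : Set G := {g | ∃ v ∈ V, ∃ p ∈ P, g = c v * p}
  classical
  let τ : G → EuclideanSpace ℝ (Fin d) := fun g => if h : g ∈ Ω then h.choose else 0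
  have hτmul : ∀ v ∈ V, ∀ p ∈ P, τ (c v * p) = v := by
    intro v hv p hp
    have h : c v * p ∈ Ω := ⟨v, hv, p, hp, rfl⟩
    have h1 : τ (c v * p) = h.choose := dif_pos h
    obtain ⟨h2, p', hp', h3⟩ := h.choose_spec
    rw [h1]
    exact (key v hv _ h2 p hp p' hp' h3).symm
  -- near `c v * p`, the set `Ω` and the map `τ` are given by a translate of `Φ`
  have hloc : ∀ v ∈ V, ∀ p ∈ P, ∃ W : Set G, IsOpen W ∧ c v * p ∈ W ∧ W ⊆ Ω ∧
      ContMDiffOn 𝓘(ℝ, EG) (𝓡 d) ∞ τ W := by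
    intro v hv p hp
    let Z : Set G := {g | g ∈ Φ.target ∧ (Φ.symm g).1 ∈ V}
    have hZ : IsOpen Z := (continuous_fst.comp_continuousOn
        Φ.symm.continuousOn).isOpen_inter_preimage
      Φ.open_target hV
    have hZs : ContMDiffOn 𝓘(ℝ, EG) (𝓡 d) ∞ (fun g => (Φ.symm g).1) Z :=
      contMDiff_fst.comp_contMDiffOn (hΦ.2.mono fun g hg => hg.1)
    have hr : ContMDiff 𝓘(ℝ, EG) 𝓘(ℝ, EG) ∞ (fun g : G => g * p⁻¹) := contMDiff_mul_right
    have hdec : ∀ g, g * p⁻¹ ∈ Z → g = c (Φ.symm (g * p⁻¹)).1 * ((Φ.symm (g * p⁻¹)).2 * p) := by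
      intro g hg
      have h1 := hΦF (Φ.map_target hg.1)
      rw [Φ.right_inv hg.1] at h1
      rw [← mul_assoc, ← mul_inv_eq_iff_eq_mul]
      exact h1
    refine ⟨(fun g => g * p⁻¹) ⁻¹' Z, hZ.preimage hr.continuous, ?_, fun g hg => ?_, ?_⟩
    · show c v * p * p⁻¹ ∈ Z
      have h1 : c v = Φ (v, 1) := by rw [hΦF (hV1 v hv)]; simp [F]
      rw [mul_inv_cancel_right, h1]
      exact ⟨Φ.map_source (hV1 v hv), by rw [Φ.left_inv (hV1 v hv)]; exact hv⟩
    · exact ⟨_, hg.2, _, P.mul_mem (Φ.symm (g * p⁻¹)).2.2 hp, hdec g hg⟩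
    · refine (hZs.comp hr.contMDiffOn fun g hg => hg).congr fun g hg => ?_
      conv_lhs => rw [hdec g hg]
      exact hτmul _ hg.2 _ (P.mul_mem (Φ.symm (g * p⁻¹)).2.2 hp)
  refine ⟨{ V := V, isOpen_V := hV, zero_mem := ⟨⟨⟨h0U, h0V₁⟩, h0V₂⟩, h0V₃⟩, c := c
            smooth_c := hc.mono fun v hv => hv.1.1.1, c_zero := hc0, Ω := Ω, τ := τ
            isOpen_Ω := ?_, smooth_τ := ?_, mul_mem := fun v hv p hp => ⟨v, hv, p, hp, rfl⟩
            τ_mem := ?_, τ_spec := ?_, τ_mul := hτmul }⟩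
  · rw [isOpen_iff_mem_nhds]
    rintro _ ⟨v, hv, p, hp, rfl⟩
    obtain ⟨W, hW, hgW, hWΩ, -⟩ := hloc v hv p hp
    exact Filter.mem_of_superset (hW.mem_nhds hgW) hWΩ
  · rintro _ ⟨v, hv, p, hp, rfl⟩
    obtain ⟨W, hW, hgW, -, hτW⟩ := hloc v hv p hp
    exact (hτW.contMDiffAt (hW.mem_nhds hgW)).contMDiffWithinAt
  · rintro _ ⟨v, hv, p, hp, rfl⟩
    rw [hτmul v hv p hp]; exact hv
  · rintro _ ⟨v, hv, p, hp, rfl⟩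
    rw [hτmul v hv p hp, inv_mul_cancel_left]; exact hp

namespace CosetSlice

variable {P : Subgroup G} {d : ℕ} (S : CosetSlice EG P d)

theorem c_mem {v : EuclideanSpace ℝ (Fin d)} (hv : v ∈ S.V) : S.c v ∈ S.Ω := by
  simpa using S.mul_mem v hv 1 P.one_mem

theorem one_mem : (1 : G) ∈ S.Ω := by
  have := S.c_mem S.zero_mem
  rwa [S.c_zero] at this

theorem τ_c {v : EuclideanSpace ℝ (Fin d)} (hv : v ∈ S.V) : S.τ (S.c v) = v := by
  simpa using S.τ_mul v hv 1 P.one_mem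

theorem mem_of_mem {g p : G} (hg : g ∈ S.Ω) (hp : p ∈ P) :
    g * p ∈ S.Ω ∧ S.τ (g * p) = S.τ g := by
  have h : g * p = S.c (S.τ g) * ((S.c (S.τ g))⁻¹ * g * p) := by group
  rw [h]
  exact ⟨S.mul_mem _ (S.τ_mem g hg) _ (P.mul_mem (S.τ_spec g hg) hp),
    S.τ_mul _ (S.τ_mem g hg) _ (P.mul_mem (S.τ_spec g hg) hp)⟩

theorem mk_c_τ {g : G} (hg : g ∈ S.Ω) : ((S.c (S.τ g) : G) : G ⧸ P) = g :=
  QuotientGroup.eq.2 (S.τ_spec g hg)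

/-- The chart of `G ⧸ P` around the coset of `g`. -/
def chart (g : G) : OpenPartialHomeomorph (G ⧸ P) (EuclideanSpace ℝ (Fin d)) :=
  have hG := topologicalGroup_of_lieGroup 𝓘(ℝ, EG) ∞ (G := G)
  have hcont : Continuous (fun x : G => g⁻¹ * x) := continuous_const.mul continuous_id
  have hpre : QuotientGroup.mk ⁻¹' {x : G ⧸ P | g⁻¹ * x.out ∈ S.Ω} = {x : G | g⁻¹ * x ∈ S.Ω} := by
    ext x
    obtain ⟨p, hp⟩ := QuotientGroup.mk_out_eq_mul P x
    simp only [mem_preimage, mem_ofPred_eq, hp, ← mul_assoc]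
    refine ⟨fun h => ?_, fun h => (S.mem_of_mem h p.2).1⟩
    have := (S.mem_of_mem h (P.inv_mem p.2)).1
    rwa [mul_inv_cancel_right] at this
  { toFun := fun x => S.τ (g⁻¹ * x.out)
    invFun := fun v => ((g * S.c v : G) : G ⧸ P)
    source := {x | g⁻¹ * x.out ∈ S.Ω}
    target := S.V
    map_source' := fun x hx => S.τ_mem _ hx
    map_target' := fun v hv => by
      have : g * S.c v ∈ QuotientGroup.mk ⁻¹' {x : G ⧸ P | g⁻¹ * x.out ∈ S.Ω} := by
        rw [hpre, mem_ofPred_eq, inv_mul_cancel_left]; exact S.c_mem hv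
      exact this
    left_inv' := fun x hx => by
      conv_rhs => rw [← QuotientGroup.out_eq' x]
      refine QuotientGroup.eq.2 ?_
      rw [mul_inv_rev, mul_assoc]
      exact S.τ_spec _ hx
    right_inv' := fun v hv => by
      obtain ⟨p, hp⟩ := QuotientGroup.mk_out_eq_mul P (g * S.c v)
      rw [hp, ← mul_assoc, inv_mul_cancel_left, S.τ_mul v hv _ p.2]
    open_source := by
      rw [← (QuotientGroup.isQuotientMap_mk P).isOpen_preimage, hpre]
      exact S.isOpen_Ω.preimage hcont
    open_target := S.isOpen_V
    continuousOn_toFun := by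
      have ho : IsOpen {x : G ⧸ P | g⁻¹ * x.out ∈ S.Ω} := by
        rw [← (QuotientGroup.isQuotientMap_mk P).isOpen_preimage, hpre]
        exact S.isOpen_Ω.preimage hcont
      rw [(QuotientGroup.isQuotientMap_mk P).continuousOn_isOpen_iff ho, hpre]
      refine ContinuousOn.congr (f := fun x : G => S.τ (g⁻¹ * x))
        (S.smooth_τ.continuousOn.comp hcont.continuousOn fun x hx => hx) fun x hx => ?_
      obtain ⟨p, hp⟩ := QuotientGroup.mk_out_eq_mul P x
      simp only [Function.comp, hp, ← mul_assoc]
      exact (S.mem_of_mem hx p.2).2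
    continuousOn_invFun := QuotientGroup.continuous_mk.comp_continuousOn
      (continuousOn_const.mul S.smooth_c.continuousOn) }

theorem chart_mk {g x : G} (hx : g⁻¹ * x ∈ S.Ω) :
    (x : G ⧸ P) ∈ (S.chart g).source ∧ S.chart g (x : G ⧸ P) = S.τ (g⁻¹ * x) := by
  obtain ⟨p, hp⟩ := QuotientGroup.mk_out_eq_mul P x
  show g⁻¹ * (x : G ⧸ P).out ∈ S.Ω ∧ S.τ (g⁻¹ * (x : G ⧸ P).out) = S.τ (g⁻¹ * x)
  rw [hp, ← mul_assoc]
  exact S.mem_of_mem hx p.2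

theorem mem_of_mk_mem {g x : G} (hx : (x : G ⧸ P) ∈ (S.chart g).source) : g⁻¹ * x ∈ S.Ω := by
  obtain ⟨p, hp⟩ := QuotientGroup.mk_out_eq_mul P x
  have hx' : g⁻¹ * (x : G ⧸ P).out ∈ S.Ω := hx
  rw [hp, ← mul_assoc] at hx'
  have := (S.mem_of_mem hx' (P.inv_mem p.2)).1
  rwa [mul_inv_cancel_right] at this

theorem chart_symm (g : G) (v : EuclideanSpace ℝ (Fin d)) :
    (S.chart g).symm v = ((g * S.c v : G) : G ⧸ P) := rfl

/-- The manifold structure of the homogeneous space `G ⧸ P`. -/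
@[reducible] def chartedSpace : ChartedSpace (EuclideanSpace ℝ (Fin d)) (G ⧸ P) where
  atlas := range S.chart
  chartAt x := S.chart x.out
  mem_chart_source x := by
    show x.out⁻¹ * x.out ∈ S.Ω
    rw [inv_mul_cancel]; exact S.one_mem
  chart_mem_atlas x := mem_range_self _

theorem isManifold : letI := S.chartedSpace; IsManifold (𝓡 d) ∞ (G ⧸ P) := by
  let := S.chartedSpace
  refine isManifold_of_contDiffOn _ _ _ ?_
  rintro _ _ ⟨g, rfl⟩ ⟨g', rfl⟩
  simp only [modelWithCornersSelf_coe, modelWithCornersSelf_coe_symm, Function.comp_id,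
    Function.id_comp, preimage_id, range_id, inter_univ]
  have hmem : ∀ v ∈ ((S.chart g).symm.trans (S.chart g')).source, v ∈ S.V ∧
      g'⁻¹ * (g * S.c v) ∈ S.Ω := fun v hv => by
    refine ⟨hv.1, S.mem_of_mk_mem ?_⟩
    exact hv.2
  have h : ContMDiffOn (𝓡 d) (𝓡 d) ∞ (fun v => S.τ (g'⁻¹ * (g * S.c v)))
      ((S.chart g).symm.trans (S.chart g')).source :=
    S.smooth_τ.comp (contMDiffOn_const.mul (contMDiffOn_const.mul
      (S.smooth_c.mono fun v hv => (hmem v hv).1))) fun v hv => (hmem v hv).2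
  exact (contMDiffOn_iff_contDiffOn.1 h).congr fun v hv => (S.chart_mk (hmem v hv).2).2

theorem isPDiffeo_chart (g : G) :
    letI := S.chartedSpace; IsPDiffeo (𝓡 d) (𝓡 d) (S.chart g) := by
  let := S.chartedSpace
  have := S.isManifold
  have h : S.chart g ∈ IsManifold.maximalAtlas (𝓡 d) ∞ (G ⧸ P) :=
    IsManifold.subset_maximalAtlas (mem_range_self g)
  exact ⟨contMDiffOn_of_mem_maximalAtlas h, contMDiffOn_symm_of_mem_maximalAtlas h⟩

theorem contMDiff_mk :
    letI := S.chartedSpace; ContMDiff 𝓘(ℝ, EG) (𝓡 d) ∞ (fun g : G => (g : G ⧸ P)) := by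
  let := S.chartedSpace
  intro g
  have hl : ContMDiff 𝓘(ℝ, EG) 𝓘(ℝ, EG) ∞ (fun x : G => g⁻¹ * x) := contMDiff_mul_left
  have hU : IsOpen {x : G | g⁻¹ * x ∈ S.Ω} := S.isOpen_Ω.preimage hl.continuous
  have h : ContMDiffOn 𝓘(ℝ, EG) (𝓡 d) ∞ (fun x : G => (x : G ⧸ P)) {x : G | g⁻¹ * x ∈ S.Ω} := by
    have h1 : ContMDiffOn 𝓘(ℝ, EG) (𝓡 d) ∞ (fun x : G => S.τ (g⁻¹ * x)) {x : G | g⁻¹ * x ∈ S.Ω} :=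
      S.smooth_τ.comp hl.contMDiffOn fun x hx => hx
    refine ((S.isPDiffeo_chart g).2.comp h1 fun x hx => S.τ_mem _ hx).congr fun x hx => ?_
    show (x : G ⧸ P) = (S.chart g).symm (S.τ (g⁻¹ * x))
    rw [← (S.chart_mk hx).2]
    exact ((S.chart g).left_inv (S.chart_mk hx).1).symm
  exact h.contMDiffAt (hU.mem_nhds (by rw [mem_ofPred_eq, inv_mul_cancel]; exact S.one_mem))

theorem isSubmersion_mk :
    letI := S.chartedSpace
    Manifold.IsSubmersion 𝓘(ℝ, EG) (𝓡 d) ∞ (fun g : G => (g : G ⧸ P)) := by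
  let := S.chartedSpace
  have := S.isManifold
  refine isSubmersion_of_surjective_md S.contMDiff_mk fun g v => ?_
  -- the inverse of the chart around the coset of `g` factors through `G`
  have h0 : (0 : EuclideanSpace ℝ (Fin d)) ∈ (S.chart g).target := S.zero_mem
  obtain ⟨w, hw⟩ := ((S.isPDiffeo_chart g).symm.md_bijective h0).2 (by
    have : (S.chart g).symm 0 = (g : G ⧸ P) := by rw [S.chart_symm, S.c_zero, mul_one]
    exact v)
  have hgc : ContMDiffOn (𝓡 d) 𝓘(ℝ, EG) ∞ (fun v => g * S.c v) S.V :=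
    contMDiffOn_const.mul S.smooth_c
  have h := md_comp_apply (g := fun g : G => (g : G ⧸ P)) (f := fun v => g * S.c v) (I := 𝓡 d)
    (J := 𝓘(ℝ, EG)) (L := 𝓡 d) 0 (S.contMDiff_mk.mdifferentiableAt (by simp))
    (ContMDiffOn.mdiffAt hgc S.isOpen_V S.zero_mem) w
  rw [S.c_zero, mul_one] at h
  exact ⟨_, h.symm.trans hw⟩

theorem md_τ_surjective : Function.Surjective (md 𝓘(ℝ, EG) (𝓡 d) S.τ 1) := by
  intro v
  have h := md_comp_apply (g := S.τ) (f := S.c) (I := 𝓡 d) (J := 𝓘(ℝ, EG)) (L := 𝓡 d) 0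
    (by rw [S.c_zero]; exact ContMDiffOn.mdiffAt S.smooth_τ S.isOpen_Ω S.one_mem)
    (ContMDiffOn.mdiffAt S.smooth_c S.isOpen_V S.zero_mem) v
  rw [md_congr_of_isOpen S.isOpen_V (f := fun v => S.τ (S.c v)) (g := fun v => v)
    (fun v hv => S.τ_c hv) S.zero_mem, md_id, S.c_zero] at h
  exact ⟨_, h.symm⟩

theorem md_τ_eq_zero [ChartedSpace EP P]
    (hv : ContMDiff 𝓘(ℝ, EP) 𝓘(ℝ, EG) ∞ (Subtype.val : P → G)) (Y : EP) :
    md 𝓘(ℝ, EG) (𝓡 d) S.τ 1 (md 𝓘(ℝ, EP) 𝓘(ℝ, EG) (Subtype.val : P → G) 1 Y) = 0 := by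
  have h := md_comp_apply (g := S.τ) (f := (Subtype.val : P → G)) (I := 𝓘(ℝ, EP))
    (J := 𝓘(ℝ, EG)) (L := 𝓡 d) 1
    (ContMDiffOn.mdiffAt S.smooth_τ S.isOpen_Ω S.one_mem) (hv.mdifferentiableAt (by simp)) Y
  have h1 : (fun p : P => S.τ p) = fun _ => S.τ 1 := by
    funext p
    simpa using (S.mem_of_mem S.one_mem p.2).2
  rw [h1, md_const] at h
  exact h.symm

/-- The kernel of the derivative of `τ` at `1` is the Lie algebra of `P`. -/
theorem exists_of_md_τ_eq_zero [ChartedSpace EP P] (hP : IsClosedLieSubgroup EG EP P)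
    (hd : d = Module.finrank ℝ EG - Module.finrank ℝ EP) {X : EG}
    (hX : md 𝓘(ℝ, EG) (𝓡 d) S.τ 1 X = 0) :
    ∃ Y : EP, md 𝓘(ℝ, EP) 𝓘(ℝ, EG) (Subtype.val : P → G) 1 Y = X := by
  have := hP.lieGroup
  have hL : Function.Injective (md 𝓘(ℝ, EP) 𝓘(ℝ, EG) (Subtype.val : P → G) 1) :=
    injective_md_of_isImmersion hP.isSmoothEmbedding.isImmersion 1
  have hle := LinearMap.finrank_le_finrank_of_injective (f :=
    (md 𝓘(ℝ, EP) 𝓘(ℝ, EG) (Subtype.val : P → G) 1).toLinearMap) hL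
  refine exists_eq_of_finrank hL (S.md_τ_eq_zero hP.isSmoothEmbedding.contMDiff) ?_ hX
  rw [LinearMap.range_eq_top.2 S.md_τ_surjective, finrank_top, finrank_euclideanSpace_fin]
  omega

end CosetSlice

end Homogeneous

/-! ### Local form of curved orbits -/

namespace CartanGeometry

variable {EG : Type*} [NormedAddCommGroup EG] [NormedSpace ℝ EG] [FiniteDimensional ℝ EG]
  {EP : Type*} [NormedAddCommGroup EP] [NormedSpace ℝ EP] [FiniteDimensional ℝ EP]
  {EB : Type*} [NormedAddCommGroup EB] [NormedSpace ℝ EB] [FiniteDimensional ℝ EB]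
  {EM : Type*} [NormedAddCommGroup EM] [NormedSpace ℝ EM] [FiniteDimensional ℝ EM]
  {EO : Type*} [NormedAddCommGroup EO] [NormedSpace ℝ EO] [FiniteDimensional ℝ EO]
  {G : Type*} [Group G] [TopologicalSpace G] [ChartedSpace EG G] [LieGroup 𝓘(ℝ, EG) ∞ G]
  [SecondCountableTopology G]
  {P : Subgroup G} [ChartedSpace EP P] [LieGroup 𝓘(ℝ, EP) ∞ P]
  {B : Type*} [TopologicalSpace B] [ChartedSpace EB B] [IsManifold 𝓘(ℝ, EB) ∞ B]
  {M : Type*} [TopologicalSpace M] [ChartedSpace EM M] [IsManifold 𝓘(ℝ, EM) ∞ M]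
  {O : Type*} [TopologicalSpace O] [ChartedSpace EO O] [IsManifold 𝓘(ℝ, EO) ∞ O]
  [MulAction G O] [ContMDiffSMul 𝓘(ℝ, EG) 𝓘(ℝ, EO) ∞ G O] [MulAction.IsPretransitive G O]
  [ContMDiffSMul 𝓘(ℝ, EP) 𝓘(ℝ, EO) ∞ P O]
  {C : CartanGeometry EG EP EB EM P B M} {s : B → O}

/-- The key local map: near a point `u` with `s u = α`, there is a smooth map `f` to `G` which moves
`s` to the constant `α` and whose derivative at `u` is the Cartan connection. Any map `g` with this
derivative moves `s` to `α` up to first order, as `s` is parallel. A correction with a local section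
`κ` of the orbit map then does not change the derivative. -/
theorem HolonomyReduction.exists_development (hs : C.HolonomyReduction (EO := EO) s) {α : O} {u : B}
    (hu : s u = α) : ∃ (U : Set B) (f : B → G), IsOpen U ∧ u ∈ U ∧
      ContMDiffOn 𝓘(ℝ, EB) 𝓘(ℝ, EG) ∞ f U ∧ f u = 1 ∧ md 𝓘(ℝ, EB) 𝓘(ℝ, EG) f u = C.om u ∧
      ∀ v ∈ U, f v • s v = α := by
  obtain ⟨V, κ, hV, hαV, hκ, hκ1, hκα⟩ := exists_orbitMap_section EG EO G α
  obtain ⟨U₀, g, hU₀, huU₀, hg, hg1, hgd⟩ := exists_contMDiffOn_md_eq u (1 : G) (C.om u)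
  have hgs : ContMDiffOn 𝓘(ℝ, EB) 𝓘(ℝ, EO) ∞ (fun v => g v • s v) U₀ :=
    hg.smul hs.smooth.contMDiffOn
  let U : Set B := U₀ ∩ (fun v => g v • s v) ⁻¹' V
  have hU : IsOpen U := hgs.continuousOn.isOpen_inter_preimage hU₀ hV
  have huU : u ∈ U := ⟨huU₀, by rw [mem_preimage, hg1, one_smul, hu]; exact hαV⟩
  let k : B → G := fun v => κ (g v • s v)
  have hk : ContMDiffOn 𝓘(ℝ, EB) 𝓘(ℝ, EG) ∞ k U :=
    hκ.comp (hgs.mono inter_subset_left) fun v hv => hv.2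
  have hku : k u = 1 := by simp only [k, hg1, one_smul, hu, hκ1]
  let f : B → G := fun v => (k v)⁻¹ * g v
  have hf : ContMDiffOn 𝓘(ℝ, EB) 𝓘(ℝ, EG) ∞ f U := hk.inv.mul (hg.mono inter_subset_left)
  have hfu : f u = 1 := by simp only [f, hku, hg1, inv_one, one_mul]
  refine ⟨U, f, hU, huU, hf, hfu, ?_, fun v hv => ?_⟩
  · ext ξ
    have hgu := ContMDiffOn.mdiffAt hg hU₀ huU₀
    have hsu := hs.smooth.mdifferentiableAt (x := u) (by simp)
    -- `v ↦ g v • s v` has derivative zero at `u`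
    have h1 : md 𝓘(ℝ, EB) 𝓘(ℝ, EO) (fun v => g v • s v) u ξ = 0 := by
      have hsm : ContMDiff (𝓘(ℝ, EG).prod 𝓘(ℝ, EO)) 𝓘(ℝ, EO) ∞ (fun z : G × O => z.1 • z.2) :=
        contMDiff_fst.smul contMDiff_snd
      have h := md_comp_apply (g := fun z : G × O => z.1 • z.2) (f := fun v => (g v, s v))
        (L := 𝓘(ℝ, EO)) u (hsm.mdifferentiableAt (by simp)) (hgu.prodMk hsu) ξ
      rw [md_prodMk hgu hsu, ContinuousLinearMap.prod_apply,
        md_prod_apply (hsm.mdifferentiableAt (by simp)), hg1] at h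
      simp only [one_smul] at h
      rw [h, hgd, md_id, ContinuousLinearMap.id_apply, hs.md_eq]
      exact add_neg_cancel _
    have h2 : md 𝓘(ℝ, EB) 𝓘(ℝ, EG) k u ξ = 0 := by
      have h := md_comp_apply (g := κ) (f := fun v => g v • s v) (L := 𝓘(ℝ, EG)) u
        (ContMDiffOn.mdiffAt hκ hV huU.2) (ContMDiffOn.mdiffAt hgs hU₀ huU₀) ξ
      rw [h1, map_zero] at h
      exact h
    have hku' := ContMDiffOn.mdiffAt hk hU huU
    have hfu' := ContMDiffOn.mdiffAt hf hU huU
    have hm : ContMDiff (𝓘(ℝ, EG).prod 𝓘(ℝ, EG)) 𝓘(ℝ, EG) ∞ (fun z : G × G => z.1 * z.2) :=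
      contMDiff_fst.mul contMDiff_snd
    have h := md_comp_apply (g := fun z : G × G => z.1 * z.2) (f := fun v => (k v, f v))
      (L := 𝓘(ℝ, EG)) u (hm.mdifferentiableAt (by simp)) (hku'.prodMk hfu') ξ
    rw [md_prodMk hku' hfu', ContinuousLinearMap.prod_apply,
      md_prod_apply (hm.mdifferentiableAt (by simp)), hku, hfu, h2, map_zero, zero_add] at h
    simp only [one_mul] at h
    rw [md_id, ContinuousLinearMap.id_apply] at h
    rw [← h, ← hgd]
    simp only [f, mul_inv_cancel_left]
  · rw [mul_smul, inv_smul_eq_iff]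
    exact (hκα _ hv.2).symm

/-- The local form of a curved orbit: the local diffeomorphism is `y ↦ f (σ y) P`, with a map `f`
as in `exists_development` and a local section `σ` of the Cartan bundle. -/
theorem HolonomyReduction.exists_local_form (hP : IsClosedLieSubgroup EG EP P)
    {d : ℕ} (S : CosetSlice EG P d) (hd : d = Module.finrank ℝ EG - Module.finrank ℝ EP)
    (hs : C.HolonomyReduction (EO := EO) s) {α : O} {u : B} (hu : s u = α) :
    letI := S.chartedSpace
    ∃ φ : OpenPartialHomeomorph M (G ⧸ P),
      C.proj u ∈ φ.source ∧ φ (C.proj u) = ((1 : G) : G ⧸ P) ∧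
      IsPDiffeo 𝓘(ℝ, EM) (𝓡 d) φ ∧
      φ '' ({x | ∃ u, C.proj u = x ∧ s u = α} ∩ φ.source) =
        MulAction.orbit (MulAction.stabilizer G α) ((1 : G) : G ⧸ P) ∩ φ.target := by
  let := S.chartedSpace
  have := S.isManifold
  obtain ⟨U, f, hU, huU, hf, hf1, hfd, hfα⟩ := hs.exists_development hu
  obtain ⟨W, σ, hW, huW, hσ, hσ1, hσ2⟩ := C.exists_section u
  have hτ1 : MDifferentiableAt 𝓘(ℝ, EG) (𝓡 d) S.τ 1 :=
    ContMDiffOn.mdiffAt S.smooth_τ S.isOpen_Ω S.one_mem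
  let W₁ : Set M := W ∩ σ ⁻¹' U
  have hW₁ : IsOpen W₁ := hσ.continuousOn.isOpen_inter_preimage hW hU
  have hfσ : ContMDiffOn 𝓘(ℝ, EM) 𝓘(ℝ, EG) ∞ (fun y => f (σ y)) W₁ :=
    hf.comp (hσ.mono inter_subset_left) fun y hy => hy.2
  let W₂ : Set M := W₁ ∩ (fun y => f (σ y)) ⁻¹' S.Ω
  have hW₂ : IsOpen W₂ := hfσ.continuousOn.isOpen_inter_preimage hW₁ S.isOpen_Ω
  have huW₂ : C.proj u ∈ W₂ := ⟨⟨huW, by rw [mem_preimage, hσ2]; exact huU⟩, by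
    rw [mem_preimage, hσ2, hf1]; exact S.one_mem⟩
  let ψ : M → EuclideanSpace ℝ (Fin d) := fun y => S.τ (f (σ y))
  have hψ : ContMDiffOn 𝓘(ℝ, EM) (𝓡 d) ∞ ψ W₂ :=
    S.smooth_τ.comp (hfσ.mono inter_subset_left) fun y hy => hy.2
  have hσu : MDifferentiableAt 𝓘(ℝ, EM) 𝓘(ℝ, EB) σ (C.proj u) := ContMDiffOn.mdiffAt hσ hW huW
  have hψd : ∀ w, md 𝓘(ℝ, EM) (𝓡 d) ψ (C.proj u) w =
      md 𝓘(ℝ, EG) (𝓡 d) S.τ 1 (C.om u (md 𝓘(ℝ, EM) 𝓘(ℝ, EB) σ (C.proj u) w)) := by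
    intro w
    have h1 := md_comp_apply (g := S.τ) (f := fun y => f (σ y)) (L := 𝓡 d) (C.proj u)
      (by rw [hσ2, hf1]; exact hτ1) (ContMDiffOn.mdiffAt hfσ hW₁ huW₂.1) w
    have h2 := md_comp_apply (g := f) (f := σ) (L := 𝓘(ℝ, EG)) (C.proj u)
      (by rw [hσ2]; exact ContMDiffOn.mdiffAt hf hU huU) hσu w
    rw [hσ2, hf1] at h1
    rw [hσ2, hfd] at h2
    rw [h2] at h1
    exact h1
  have hpσ : ∀ w, md 𝓘(ℝ, EB) 𝓘(ℝ, EM) C.proj u (md 𝓘(ℝ, EM) 𝓘(ℝ, EB) σ (C.proj u) w) = w := by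
    intro w
    have h := md_comp_apply (g := C.proj) (f := σ) (L := 𝓘(ℝ, EM)) (C.proj u)
      (C.contMDiff_proj.mdifferentiableAt (by simp)) hσu w
    rw [hσ2, md_congr_of_isOpen hW (f := fun y => C.proj (σ y)) (g := fun y => y) hσ1 huW,
      md_id] at h
    exact h.symm
  have hproj_fund : ∀ Y, md 𝓘(ℝ, EB) 𝓘(ℝ, EM) C.proj u
      (md 𝓘(ℝ, EP) 𝓘(ℝ, EB) (fun p => C.act u p) 1 Y) = 0 := by
    intro Y
    have h := md_comp_apply (g := C.proj) (f := fun p => C.act u p) (L := 𝓘(ℝ, EM)) 1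
      (C.contMDiff_proj.mdifferentiableAt (by simp))
      ((C.contMDiff_act_right u).mdifferentiableAt (by simp)) Y
    simp only [C.proj_act, C.act_one, md_const] at h
    exact h.symm
  -- the Cartan connection identifies the tangent space of `M` with `𝔤 / 𝔭`
  have hψb : Function.Bijective (md 𝓘(ℝ, EM) (𝓡 d) ψ (C.proj u)) := by
    constructor
    · rw [← LinearMap.coe_coe, ← LinearMap.ker_eq_bot, LinearMap.ker_eq_bot']
      intro w hw
      have hw' : md 𝓘(ℝ, EM) (𝓡 d) ψ (C.proj u) w = 0 := hw
      rw [hψd] at hw'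
      obtain ⟨Y, hY⟩ := S.exists_of_md_τ_eq_zero hP hd hw'
      have h1 : md 𝓘(ℝ, EP) 𝓘(ℝ, EB) (fun p => C.act u p) 1 Y =
          md 𝓘(ℝ, EM) 𝓘(ℝ, EB) σ (C.proj u) w :=
        (C.om_bijective u).1 ((C.om_fundamental u Y).trans hY)
      rw [← hpσ w, ← h1, hproj_fund]
    · intro v
      obtain ⟨X, hX⟩ := S.md_τ_surjective v
      obtain ⟨ξ, rfl⟩ := (C.om_bijective u).2 X
      refine ⟨md 𝓘(ℝ, EB) 𝓘(ℝ, EM) C.proj u ξ, ?_⟩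
      obtain ⟨Y, hY⟩ := C.exists_md_act_eq (u := u) (ξ := ξ -
        md 𝓘(ℝ, EM) 𝓘(ℝ, EB) σ (C.proj u) (md 𝓘(ℝ, EB) 𝓘(ℝ, EM) C.proj u ξ)) (by
          rw [map_sub, hpσ, sub_self])
      have h1 : C.om u (md 𝓘(ℝ, EP) 𝓘(ℝ, EB) (fun p => C.act u p) 1 Y) =
        md 𝓘(ℝ, EP) 𝓘(ℝ, EG) (Subtype.val : P → G) 1 Y := C.om_fundamental u Y
      rw [hY, map_sub, sub_eq_iff_eq_add] at h1
      rw [hψd, ← hX, h1, map_add, S.md_τ_eq_zero hP.isSmoothEmbedding.contMDiff, zero_add]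
  obtain ⟨Φ, huΦ, hΦW, hΦψ, hΦ⟩ := exists_isPDiffeo_of_bijective_md hW₂ hψ huW₂ hψb
  have hmem : ∀ y ∈ Φ.source, Φ y ∈ S.V := fun y hy => by
    rw [hΦψ hy]; exact S.τ_mem _ (hΦW hy).2
  let φ : OpenPartialHomeomorph M (G ⧸ P) := Φ.trans (S.chart 1).symm
  have hsource : φ.source = Φ.source := by
    rw [OpenPartialHomeomorph.trans_source]
    exact inter_eq_left.2 hmem
  have hφ : ∀ y ∈ φ.source, φ y = (f (σ y) : G ⧸ P) := by
    intro y hy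
    rw [hsource] at hy
    show ((1 * S.c (Φ y) : G) : G ⧸ P) = (f (σ y) : G ⧸ P)
    rw [one_mul, hΦψ hy]
    exact S.mk_c_τ (hΦW hy).2
  refine ⟨φ, by rw [hsource]; exact huΦ, ?_, hΦ.trans (S.isPDiffeo_chart 1).symm, ?_⟩
  · rw [hφ _ (by rw [hsource]; exact huΦ), hσ2, hf1]
  · ext z
    constructor
    · -- if `s (C.act (σ y) p) = α`, then `f (σ y) * p` stabilises `α`
      rintro ⟨y, ⟨⟨v, hvy, hv⟩, hy⟩, rfl⟩
      refine ⟨?_, φ.map_source hy⟩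
      have hyW := hΦW (hsource ▸ hy)
      obtain ⟨p, hp⟩ := C.exists_act_eq (u := σ y) (v := v) ((hσ1 y hyW.1.1).trans hvy.symm)
      have h1 : s (σ y) = (p : G) • α := by
        have := hs.equivariant (σ y) p
        rw [hp, hv] at this
        exact (inv_smul_eq_iff.1 this.symm)
      have h2 := hfα _ hyW.1.2
      rw [h1, ← mul_smul] at h2
      refine ⟨⟨f (σ y) * p, h2⟩, ?_⟩
      show ((f (σ y) * p * 1 : G) : G ⧸ P) = _
      rw [hφ y hy, mul_one]
      exact (QuotientGroup.mk_mul_of_mem _ p.2)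
    · -- if `f (σ y) * p` stabilises `α`, then `s (C.act (σ y) p) = α`
      rintro ⟨⟨g, hg⟩, hz⟩
      have hz1 : ((g.1 * 1 : G) : G ⧸ P) = z := hg
      have hy := φ.map_target hz
      refine ⟨φ.symm z, ⟨?_, hy⟩, φ.right_inv hz⟩
      have hyW := hΦW (hsource ▸ hy)
      set y := φ.symm z
      have h1 : (f (σ y))⁻¹ * g.1 ∈ P := by
        rw [← QuotientGroup.eq, ← hφ _ hy, φ.right_inv hz, ← hz1, mul_one]
      let p : P := ⟨(f (σ y))⁻¹ * g.1, h1⟩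
      refine ⟨C.act (σ y) p, (C.proj_act _ _).trans (hσ1 y hyW.1.1), ?_⟩
      rw [hs.equivariant]
      show ((f (σ y))⁻¹ * g.1)⁻¹ • s (σ y) = α
      rw [mul_inv_rev, inv_inv, mul_smul, hfα _ hyW.1.2]
      exact inv_smul_eq_iff.2 g.2.symm

end CartanGeometry

/-! ### Smooth structures on stabilisers and on the reduction -/

/-- Maps from manifolds to an initial submanifold are smooth if they are smooth as maps to the
ambient manifold. -/
theorem InitialSubmanifold.contMDiffOn {EM : Type*} [NormedAddCommGroup EM] [NormedSpace ℝ EM]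
    {M : Type*} [TopologicalSpace M] [ChartedSpace EM M] {S : Set M}
    (N : InitialSubmanifold (EM := EM) S) {n : ℕ} {X : Type*} [TopologicalSpace X]
    [ChartedSpace (EuclideanSpace ℝ (Fin n)) X] [IsManifold (𝓡 n) ∞ X] {f : X → N.Carrier}
    {U : Set X} (hU : IsOpen U) (hf : ContMDiffOn (𝓡 n) 𝓘(ℝ, EM) ∞ (fun x => N.incl (f x)) U) :
    ContMDiffOn (𝓡 n) (𝓡 N.dim) ∞ f U := by
  intro x hx
  let φ := echart (𝓡 n) x
  have hφ : IsPDiffeo (𝓡 n) (𝓡 n) φ := isPDiffeo_echart x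
  have hxφ : x ∈ φ.source := mem_echart_source x
  have hV : IsOpen (φ.target ∩ φ.symm ⁻¹' U) := φ.symm.isOpen_inter_preimage hU
  have h1 : ContMDiffOn (𝓡 n) (𝓡 N.dim) ∞ (fun z => f (φ.symm z)) (φ.target ∩ φ.symm ⁻¹' U) :=
    N.initial n _ (fun z => f (φ.symm z)) hV
      (hf.comp (hφ.2.mono inter_subset_left) fun z hz => hz.2)
  have h2 : ContMDiffOn (𝓡 n) (𝓡 N.dim) ∞ f (φ.source ∩ U) := by
    refine (h1.comp (hφ.1.mono inter_subset_left) fun y hy => ⟨φ.map_source hy.1, ?_⟩).congr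
      fun y hy => ?_
    · show φ.symm (φ y) ∈ U
      rw [φ.left_inv hy.1]; exact hy.2
    · simp only [Function.comp, φ.left_inv hy.1]
  exact (h2.contMDiffAt ((φ.open_source.inter hU).mem_nhds ⟨hxφ, hx⟩)).contMDiffWithinAt

theorem InitialSubmanifold.contMDiff_incl {EM : Type*} [NormedAddCommGroup EM] [NormedSpace ℝ EM]
    {M : Type*} [TopologicalSpace M] [ChartedSpace EM M] {S : Set M}
    (N : InitialSubmanifold (EM := EM) S) : ContMDiff (𝓡 N.dim) 𝓘(ℝ, EM) ∞ N.incl :=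
  N.isImmersion.contMDiff

section Stabilizers

variable {EG : Type*} [NormedAddCommGroup EG] [NormedSpace ℝ EG] [FiniteDimensional ℝ EG]
  {EO : Type*} [NormedAddCommGroup EO] [NormedSpace ℝ EO] [FiniteDimensional ℝ EO]
  {EP : Type*} [NormedAddCommGroup EP] [NormedSpace ℝ EP] [FiniteDimensional ℝ EP]
  {G : Type*} [Group G] [TopologicalSpace G] [ChartedSpace EG G] [LieGroup 𝓘(ℝ, EG) ∞ G]
  {O : Type*} [TopologicalSpace O] [ChartedSpace EO O] [IsManifold 𝓘(ℝ, EO) ∞ O]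
  [MulAction G O] [ContMDiffSMul 𝓘(ℝ, EG) 𝓘(ℝ, EO) ∞ G O]

theorem isEmbedding_stabPIncl (P : Subgroup G) (α : O) : IsEmbedding (stabPIncl P α) :=
  ⟨isInducing_stabPIncl P α, stabPIncl_injective P α⟩

variable (EG EO) in
/-- The stabiliser of a point under a transitive action is a closed Lie subgroup, and its Lie
algebra is the kernel of the infinitesimal action. -/
theorem exists_isClosedLieSubgroup_stabilizer [SecondCountableTopology G] [T2Space O]
    [MulAction.IsPretransitive G O] (α : O) :
    ∃ (k : ℕ) (_ : ChartedSpace (EuclideanSpace ℝ (Fin k)) (MulAction.stabilizer G α)),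
      IsClosedLieSubgroup EG (EuclideanSpace ℝ (Fin k)) (MulAction.stabilizer G α) ∧
      ∀ X : EG, md 𝓘(ℝ, EG) 𝓘(ℝ, EO) (fun g : G => g • α) 1 X = 0 →
        ∃ w, md (𝓡 k) 𝓘(ℝ, EG) (Subtype.val : MulAction.stabilizer G α → G) 1 w = X := by
  obtain ⟨A⟩ := exists_submanifoldAtlas_stabilizer EG EO G α
  let := A.chartedSpace
  have := A.isManifold
  have he : Manifold.IsSmoothEmbedding
      (𝓡 (Module.finrank ℝ EG - Module.finrank ℝ EO)) 𝓘(ℝ, EG) ∞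
      (Subtype.val : MulAction.stabilizer G α → G) := ⟨A.isImmersion, IsEmbedding.subtypeVal⟩
  refine ⟨_, A.chartedSpace, ⟨?_, lieGroup_of_isSmoothEmbedding
    (MulAction.stabilizer G α).subtype he, he⟩, fun X hX => ?_⟩
  · exact isClosed_singleton.preimage (contMDiff_orbitMap EG EO G α).continuous
  · refine A.exists_md_eq (contMDiff_orbitMap EG EO G α) (α := α) (fun g => g.2) 1 ?_ hX
    rw [finrank_range_md_orbitMap_of_isPretransitive EG EO G α]
    exact Nat.sub_add_cancel (finrank_le_of_isPretransitive (G := G) EG EO α)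

/-- The inclusion of `P_α` into `P`, as a homomorphism. -/
def stabPHom (P : Subgroup G) (α : O) : stabP P α →* P where
  toFun := stabPIncl P α
  map_one' := rfl
  map_mul' _ _ := rfl

end Stabilizers

/-- The group `P_α` is a closed Lie subgroup of the stabiliser of `α`. -/
theorem exists_isClosedLieSubgroup_stabP
    {EG : Type*} [NormedAddCommGroup EG] [NormedSpace ℝ EG] [FiniteDimensional ℝ EG]
    (EO : Type*) [NormedAddCommGroup EO] [NormedSpace ℝ EO] [FiniteDimensional ℝ EO]
    {EP : Type*} [NormedAddCommGroup EP] [NormedSpace ℝ EP] [FiniteDimensional ℝ EP]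
    {G : Type*} [Group G] [TopologicalSpace G] [ChartedSpace EG G] [LieGroup 𝓘(ℝ, EG) ∞ G]
    {O : Type*} [TopologicalSpace O] [ChartedSpace EO O] [IsManifold 𝓘(ℝ, EO) ∞ O]
    [MulAction G O] [ContMDiffSMul 𝓘(ℝ, EG) 𝓘(ℝ, EO) ∞ G O]
    {P : Subgroup G} [ChartedSpace EP P]
    (hP : IsClosedLieSubgroup EG EP P) (α : O) {k : ℕ}
    [ChartedSpace (EuclideanSpace ℝ (Fin k)) (MulAction.stabilizer G α)]
    (hH : IsClosedLieSubgroup EG (EuclideanSpace ℝ (Fin k)) (MulAction.stabilizer G α)) :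
    ∃ (l : ℕ) (_ : ChartedSpace (EuclideanSpace ℝ (Fin l)) (stabP P α)),
      IsClosedLieSubgroup (EuclideanSpace ℝ (Fin k)) (EuclideanSpace ℝ (Fin l)) (stabP P α) ∧
      Manifold.IsSmoothEmbedding (𝓡 l) 𝓘(ℝ, EP) ∞ (stabPIncl P α) := by
  have := hP.lieGroup
  have := hH.lieGroup
  have hv := hP.isSmoothEmbedding.contMDiff
  have : ContMDiffSMul 𝓘(ℝ, EP) 𝓘(ℝ, EO) ∞ P O := contMDiffSMul_subgroup hv
  obtain ⟨l, ⟨A⟩⟩ : ∃ l, Nonempty (SubmanifoldAtlas EP (stabPIncl P α) l) :=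
    ⟨_, exists_submanifoldAtlas_stabP EO EP P α⟩
  let := A.chartedSpace
  have := A.isManifold
  have he : Manifold.IsSmoothEmbedding (𝓡 l) 𝓘(ℝ, EP) ∞ (stabPIncl P α) :=
    ⟨A.isImmersion, isEmbedding_stabPIncl P α⟩
  have hc : ContMDiff (𝓡 l) 𝓘(ℝ, EG) ∞
      (fun q : stabP P α => ((stabPIncl P α q : P) : G)) := hv.comp he.contMDiff
  have hc' : ContMDiff (𝓡 l) (𝓡 k) ∞ (Subtype.val : stabP P α → MulAction.stabilizer G α) :=
    contMDiff_of_isImmersion_of_isInducing hH.isSmoothEmbedding.isImmersion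
      hH.isSmoothEmbedding.isEmbedding.isInducing hc
  refine ⟨l, A.chartedSpace, ⟨?_, lieGroup_of_isSmoothEmbedding (stabPHom P α) he, ?_,
    IsEmbedding.subtypeVal⟩, he⟩
  · exact hP.isClosed.preimage continuous_subtype_val
  · refine isImmersion_of_injective_md hc' fun q => ?_
    have h1 := md_comp (g := (Subtype.val : P → G)) (f := stabPIncl P α) (L := 𝓘(ℝ, EG)) q
      (hv.mdifferentiableAt (by simp)) (he.contMDiff.mdifferentiableAt (by simp))
    have h2 := md_comp (g := (Subtype.val : MulAction.stabilizer G α → G))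
      (f := (Subtype.val : stabP P α → MulAction.stabilizer G α)) (L := 𝓘(ℝ, EG)) q
      (hH.isSmoothEmbedding.contMDiff.mdifferentiableAt (by simp))
      (hc'.mdifferentiableAt (by simp))
    have h3 : Function.Injective (md (𝓡 l) 𝓘(ℝ, EG)
        (fun q : stabP P α => ((stabPIncl P α q : P) : G)) q) := by
      rw [h1]
      exact (injective_md_of_isImmersion hP.isSmoothEmbedding.isImmersion _).comp
        (A.injective_md q)
    have h4 := h2.symm.trans rfl ▸ h3
    exact Function.Injective.of_comp h4


namespace CartanGeometry

variable {EG : Type*} [NormedAddCommGroup EG] [NormedSpace ℝ EG] [FiniteDimensional ℝ EG]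
  {EP : Type*} [NormedAddCommGroup EP] [NormedSpace ℝ EP] [FiniteDimensional ℝ EP]
  {EB : Type*} [NormedAddCommGroup EB] [NormedSpace ℝ EB] [FiniteDimensional ℝ EB]
  {EM : Type*} [NormedAddCommGroup EM] [NormedSpace ℝ EM] [FiniteDimensional ℝ EM]
  {EO : Type*} [NormedAddCommGroup EO] [NormedSpace ℝ EO] [FiniteDimensional ℝ EO]
  {G : Type*} [Group G] [TopologicalSpace G] [ChartedSpace EG G] [LieGroup 𝓘(ℝ, EG) ∞ G]
  [SecondCountableTopology G]
  {P : Subgroup G} [ChartedSpace EP P] [LieGroup 𝓘(ℝ, EP) ∞ P]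
  {B : Type*} [TopologicalSpace B] [ChartedSpace EB B] [IsManifold 𝓘(ℝ, EB) ∞ B]
  {M : Type*} [TopologicalSpace M] [ChartedSpace EM M] [IsManifold 𝓘(ℝ, EM) ∞ M]
  {O : Type*} [TopologicalSpace O] [ChartedSpace EO O] [IsManifold 𝓘(ℝ, EO) ∞ O]
  [MulAction G O] [ContMDiffSMul 𝓘(ℝ, EG) 𝓘(ℝ, EO) ∞ G O] [MulAction.IsPretransitive G O]
  [ContMDiffSMul 𝓘(ℝ, EP) 𝓘(ℝ, EO) ∞ P O]
  {C : CartanGeometry EG EP EB EM P B M} {s : B → O}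

theorem HolonomyReduction.finrank_range_md (hs : C.HolonomyReduction (EO := EO) s) (u : B) :
    Module.finrank ℝ (LinearMap.range (md 𝓘(ℝ, EB) 𝓘(ℝ, EO) s u).toLinearMap) =
      Module.finrank ℝ EO := by
  rw [LinearMap.range_eq_top.2 (hs.md_surjective u), finrank_top]

/-- The set `{s = α}` is an embedded submanifold of the Cartan bundle, and its tangent spaces are
the kernels of the derivative of `s`. -/
theorem HolonomyReduction.exists_manifold_reduction (hs : C.HolonomyReduction (EO := EO) s)
    (α : O) : ∃ (k : ℕ) (_ : ChartedSpace (EuclideanSpace ℝ (Fin k)) (Reduction s α)),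
      IsManifold (𝓡 k) ∞ (Reduction s α) ∧
      Manifold.IsSmoothEmbedding (𝓡 k) 𝓘(ℝ, EB) ∞ (Subtype.val : Reduction s α → B) ∧
      ∀ (v : Reduction s α) (ξ : EB), md 𝓘(ℝ, EB) 𝓘(ℝ, EO) s v.1 ξ = 0 →
        ∃ w, md (𝓡 k) 𝓘(ℝ, EB) (Subtype.val : Reduction s α → B) v w = ξ := by
  obtain ⟨A⟩ := hs.exists_submanifoldAtlas_reduction α
  let := A.chartedSpace
  refine ⟨_, A.chartedSpace, A.isManifold, ⟨A.isImmersion, IsEmbedding.subtypeVal⟩,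
    fun v ξ hξ => A.exists_md_eq hs.smooth (α := α) (fun v => v.2) v ?_ hξ⟩
  have := LinearMap.finrank_le_finrank_of_surjective
    (f := (md 𝓘(ℝ, EB) 𝓘(ℝ, EO) s v.1).toLinearMap) (hs.md_surjective v.1)
  rw [hs.finrank_range_md]
  omega

end CartanGeometry

/-! ### The principal bundle structure of the reduction -/

/-- The inclusion of Lie algebras intertwines the adjoint actions. -/
theorem md_val_ad {EG : Type*} [NormedAddCommGroup EG] [NormedSpace ℝ EG]
    {EH : Type*} [NormedAddCommGroup EH] [NormedSpace ℝ EH]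
    {G : Type*} [Group G] [TopologicalSpace G] [ChartedSpace EG G] [LieGroup 𝓘(ℝ, EG) ∞ G]
    {H : Subgroup G} [ChartedSpace EH H] [LieGroup 𝓘(ℝ, EH) ∞ H]
    (hv : ContMDiff 𝓘(ℝ, EH) 𝓘(ℝ, EG) ∞ (Subtype.val : H → G)) (h : H) (X : EH) :
    md 𝓘(ℝ, EH) 𝓘(ℝ, EG) (Subtype.val : H → G) 1 (Ad EH h X) =
      Ad EG (h : G) (md 𝓘(ℝ, EH) 𝓘(ℝ, EG) (Subtype.val : H → G) 1 X) := by
  have hcH : ContMDiff 𝓘(ℝ, EH) 𝓘(ℝ, EH) ∞ (fun x : H => h * x * h⁻¹) :=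
    (contMDiff_const.mul contMDiff_id).mul contMDiff_const
  have hcG : ContMDiff 𝓘(ℝ, EG) 𝓘(ℝ, EG) ∞ (fun x : G => (h : G) * x * (h : G)⁻¹) :=
    (contMDiff_const.mul contMDiff_id).mul contMDiff_const
  have h1 := md_comp_apply (g := (Subtype.val : H → G)) (f := fun x : H => h * x * h⁻¹)
    (L := 𝓘(ℝ, EG)) 1 (hv.mdifferentiableAt (by simp)) (hcH.mdifferentiableAt (by simp)) X
  have h2 := md_comp_apply (g := fun x : G => (h : G) * x * (h : G)⁻¹) (f := (Subtype.val : H → G))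
    (L := 𝓘(ℝ, EG)) 1 (hcG.mdifferentiableAt (by simp)) (hv.mdifferentiableAt (by simp)) X
  rw [show h * 1 * h⁻¹ = 1 by simp] at h1
  exact h1.symm.trans h2

namespace CartanGeometry

variable {EG : Type*} [NormedAddCommGroup EG] [NormedSpace ℝ EG] [FiniteDimensional ℝ EG]
  {EP : Type*} [NormedAddCommGroup EP] [NormedSpace ℝ EP] [FiniteDimensional ℝ EP]
  {EB : Type*} [NormedAddCommGroup EB] [NormedSpace ℝ EB] [FiniteDimensional ℝ EB]
  {EM : Type*} [NormedAddCommGroup EM] [NormedSpace ℝ EM] [FiniteDimensional ℝ EM]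
  {EO : Type*} [NormedAddCommGroup EO] [NormedSpace ℝ EO] [FiniteDimensional ℝ EO]
  {G : Type*} [Group G] [TopologicalSpace G] [ChartedSpace EG G] [LieGroup 𝓘(ℝ, EG) ∞ G]
  [SecondCountableTopology G]
  {P : Subgroup G} [ChartedSpace EP P] [LieGroup 𝓘(ℝ, EP) ∞ P]
  {B : Type*} [TopologicalSpace B] [ChartedSpace EB B] [IsManifold 𝓘(ℝ, EB) ∞ B]
  {M : Type*} [TopologicalSpace M] [ChartedSpace EM M] [IsManifold 𝓘(ℝ, EM) ∞ M]
  {O : Type*} [TopologicalSpace O] [ChartedSpace EO O] [IsManifold 𝓘(ℝ, EO) ∞ O]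
  [MulAction G O] [ContMDiffSMul 𝓘(ℝ, EG) 𝓘(ℝ, EO) ∞ G O] [MulAction.IsPretransitive G O]
  [ContMDiffSMul 𝓘(ℝ, EP) 𝓘(ℝ, EO) ∞ P O]
  {C : CartanGeometry EG EP EB EM P B M} {s : B → O}
  {α : O} {k l n : ℕ} [ChartedSpace (EuclideanSpace ℝ (Fin k)) (MulAction.stabilizer G α)]
  [ChartedSpace (EuclideanSpace ℝ (Fin l)) (stabP P α)]
  [ChartedSpace (EuclideanSpace ℝ (Fin n)) (Reduction s α)] [IsManifold (𝓡 n) ∞ (Reduction s α)]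

/-- The given manifold structures on `G_α`, `P_α` and `{s = α}` are those of submanifolds of `G`,
of `P`, and of the Cartan bundle. -/
structure IsReductionStructure (C : CartanGeometry EG EP EB EM P B M) (EO : Type*)
    [NormedAddCommGroup EO] [NormedSpace ℝ EO] [ChartedSpace EO O] (s : B → O)
    (α : O) (k l n : ℕ) [ChartedSpace (EuclideanSpace ℝ (Fin k)) (MulAction.stabilizer G α)]
    [ChartedSpace (EuclideanSpace ℝ (Fin l)) (stabP P α)]
    [ChartedSpace (EuclideanSpace ℝ (Fin n)) (Reduction s α)] : Prop where
  isClosedLieSubgroup : IsClosedLieSubgroup EG EP P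
  holonomyReduction : C.HolonomyReduction (EO := EO) s
  lieH : IsClosedLieSubgroup EG (EuclideanSpace ℝ (Fin k)) (MulAction.stabilizer G α)
  lieP : IsClosedLieSubgroup (EuclideanSpace ℝ (Fin k)) (EuclideanSpace ℝ (Fin l)) (stabP P α)
  isSmoothEmbedding_stabPIncl : Manifold.IsSmoothEmbedding (𝓡 l) 𝓘(ℝ, EP) ∞ (stabPIncl P α)
  isSmoothEmbedding_val :
    Manifold.IsSmoothEmbedding (𝓡 n) 𝓘(ℝ, EB) ∞ (Subtype.val : Reduction s α → B)
  exists_md_stabilizer_eq : ∀ X : EG, md 𝓘(ℝ, EG) 𝓘(ℝ, EO) (fun g : G => g • α) 1 X = 0 →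
    ∃ w, md (𝓡 k) 𝓘(ℝ, EG) (Subtype.val : MulAction.stabilizer G α → G) 1 w = X
  exists_md_val_eq : ∀ (v : Reduction s α) (ξ : EB), md 𝓘(ℝ, EB) 𝓘(ℝ, EO) s v.1 ξ = 0 →
    ∃ w, md (𝓡 n) 𝓘(ℝ, EB) (Subtype.val : Reduction s α → B) v w = ξ

namespace IsReductionStructure

variable (D : C.IsReductionStructure EO s α k l n)

theorem contMDiff_val (D : C.IsReductionStructure EO s α k l n) :
    ContMDiff (𝓡 n) 𝓘(ℝ, EB) ∞ (Subtype.val : Reduction s α → B) :=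
  D.isSmoothEmbedding_val.contMDiff

theorem contMDiff_stabPIncl (D : C.IsReductionStructure EO s α k l n) :
    ContMDiff (𝓡 l) 𝓘(ℝ, EP) ∞ (stabPIncl P α) :=
  D.isSmoothEmbedding_stabPIncl.contMDiff

/-- The action of `P_α` on `{s = α}`. -/
def act (D : C.IsReductionStructure EO s α k l n) (v : Reduction s α) (q : stabP P α) :
    Reduction s α :=
  ⟨C.act v.1 (stabPIncl P α q), by
    rw [D.holonomyReduction.equivariant', v.2, inv_smul_eq_iff]
    exact (stabPIncl_smul P α q).symm⟩

theorem contMDiff_act (D : C.IsReductionStructure EO s α k l n) :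
    ContMDiff ((𝓡 n).prod (𝓡 l)) (𝓡 n) ∞ (fun z : Reduction s α × stabP P α => D.act z.1 z.2) := by
  refine contMDiff_of_isImmersion_of_isInducing D.isSmoothEmbedding_val.isImmersion
    D.isSmoothEmbedding_val.isEmbedding.isInducing ?_
  exact C.contMDiff_act.comp ((D.contMDiff_val.comp contMDiff_fst).prodMk
    (D.contMDiff_stabPIncl.comp contMDiff_snd))

section Projection

variable {S : Set M} (N : InitialSubmanifold (EM := EM) S)
  (hS : ∀ x, x ∈ S ↔ ∃ u, C.proj u = x ∧ s u = α)

/-- The projection of `{s = α}` to the initial submanifold over which it lies. -/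
def proj (v : Reduction s α) : N.Carrier :=
  Classical.choose (show C.proj v.1 ∈ range N.incl by
    rw [N.range_eq]; exact (hS _).2 ⟨v.1, rfl, v.2⟩)

theorem incl_proj (v : Reduction s α) : N.incl (proj N hS v) = C.proj v.1 :=
  Classical.choose_spec (show C.proj v.1 ∈ range N.incl by
    rw [N.range_eq]; exact (hS _).2 ⟨v.1, rfl, v.2⟩)

theorem contMDiff_proj (D : C.IsReductionStructure EO s α k l n) :
    ContMDiff (𝓡 n) (𝓡 N.dim) ∞ (proj N hS) := by
  rw [← contMDiffOn_univ]
  refine N.contMDiffOn isOpen_univ ?_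
  simp only [incl_proj]
  exact (C.contMDiff_proj.comp D.contMDiff_val).contMDiffOn

/-- The set `{s = α}` is a principal bundle with group `P_α` over the initial submanifold. -/
theorem exists_trivialization (D : C.IsReductionStructure EO s α k l n) (x : N.Carrier) :
    ∃ (U : Set N.Carrier) (Φ : OpenPartialHomeomorph (Reduction s α) (N.Carrier × stabP P α)),
    IsOpen U ∧ x ∈ U ∧ Φ.source = proj N hS ⁻¹' U ∧ Φ.target = U ×ˢ univ ∧
    ContMDiffOn (𝓡 n) ((𝓡 N.dim).prod (𝓡 l)) ∞ Φ Φ.source ∧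
    ContMDiffOn ((𝓡 N.dim).prod (𝓡 l)) (𝓡 n) ∞ Φ.symm Φ.target ∧
    ∀ v ∈ Φ.source, (Φ v).1 = proj N hS v ∧
      ∀ p, D.act v p ∈ Φ.source ∧ Φ (D.act v p) = ((Φ v).1, (Φ v).2 * p) := by
  have hs := D.holonomyReduction
  have : SecondCountableTopology P := secondCountableTopology_subtype _
  have : LocallyConnectedSpace N.Carrier :=
    ChartedSpace.locallyConnectedSpace (EuclideanSpace ℝ (Fin N.dim)) _
  have hmem : ∀ y : N.Carrier, ∃ u, C.proj u = N.incl y ∧ s u = α := fun y =>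
    (hS _).1 (N.range_eq.subset (mem_range_self y))
  obtain ⟨u, hux, hu⟩ := hmem x
  obtain ⟨W, lam, τ, A, hW, huW, hlam, hlam1, hlam2, hτ, hτs, hA, hτA, h0⟩ :=
    hs.exists_adapted_section hu
  let U : Set N.Carrier := {y | N.incl y ∈ W ∧ τ (N.incl y) = 0}
  have hU : IsOpen U := isOpen_preimage_zero N.contMDiff_incl.continuous hmem hW hτ.continuousOn
    hA hτA
  have hxU : x ∈ U := by
    show N.incl x ∈ W ∧ τ (N.incl x) = 0
    rw [← hux]
    exact ⟨huW, (h0 _ huW).2 (by rw [hlam2, hu])⟩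
  have hlamU : ∀ y ∈ U, s (lam (N.incl y)) = α := fun y hy => (h0 _ hy.1).1 hy.2
  -- the local section of the reduction over `U`
  classical
  let ℓ : N.Carrier → Reduction s α := fun y =>
    if h : s (lam (N.incl y)) = α then ⟨lam (N.incl y), h⟩ else ⟨u, hu⟩
  have hℓ : ∀ y ∈ U, (ℓ y).1 = lam (N.incl y) := fun y hy => by
    simp only [ℓ]; rw [dif_pos (hlamU y hy)]
  have hℓs : ContMDiffOn (𝓡 N.dim) (𝓡 n) ∞ ℓ U := by
    refine contMDiffOn_of_isImmersion_of_isInducing D.isSmoothEmbedding_val.isImmersion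
      D.isSmoothEmbedding_val.isEmbedding.isInducing hU ?_
    exact (hlam.comp N.contMDiff_incl.contMDiffOn fun y hy => hy.1).congr hℓ
  have hprojact : ∀ v q, proj N hS (D.act v q) = proj N hS v := fun v q => by
    apply N.injective
    rw [incl_proj, incl_proj]
    exact C.proj_act _ _
  have hprojℓ : ∀ y ∈ U, proj N hS (ℓ y) = y := fun y hy => by
    apply N.injective
    rw [incl_proj, hℓ y hy]
    exact hlam1 _ hy.1
  let q : Reduction s α → stabP P α := fun v =>
    if h : C.div (ℓ (proj N hS v)).1 v.1 • α = α then ⟨⟨C.div (ℓ (proj N hS v)).1 v.1, h⟩,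
      (C.div (ℓ (proj N hS v)).1 v.1).2⟩ else 1
  have hfib : ∀ v, proj N hS v ∈ U → C.proj (ℓ (proj N hS v)).1 = C.proj v.1 := fun v hv => by
    rw [← incl_proj N hS, hprojℓ _ hv, incl_proj]
  have hq : ∀ v, proj N hS v ∈ U → stabPIncl P α (q v) = C.div (ℓ (proj N hS v)).1 v.1 := by
    intro v hv
    have h : C.div (ℓ (proj N hS v)).1 v.1 • α = α := by
      have h1 := hs.equivariant' (ℓ (proj N hS v)).1 (C.div (ℓ (proj N hS v)).1 v.1)
      rw [C.act_div (hfib v hv), v.2, (ℓ (proj N hS v)).2] at h1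
      exact (inv_smul_eq_iff.1 h1.symm).symm
    simp only [q]
    rw [dif_pos h]
    rfl
  have hpU : IsOpen (proj N hS ⁻¹' U) := hU.preimage (contMDiff_proj N hS D).continuous
  have hqs : ContMDiffOn (𝓡 n) (𝓡 l) ∞ q (proj N hS ⁻¹' U) := by
    refine contMDiffOn_of_isImmersion_of_isInducing D.isSmoothEmbedding_stabPIncl.isImmersion
      D.isSmoothEmbedding_stabPIncl.isEmbedding.isInducing hpU ?_
    refine (C.contMDiffOn_div (f := fun v => (ℓ (proj N hS v)).1) (g := fun v => v.1) hpU
      (D.contMDiff_val.comp_contMDiffOn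
        (hℓs.comp (contMDiff_proj N hS D).contMDiffOn fun v hv => hv))
      D.contMDiff_val.contMDiffOn fun v hv => hfib v hv).congr fun v hv => hq v hv
  have hΦs : ContMDiffOn (𝓡 n) ((𝓡 N.dim).prod (𝓡 l)) ∞ (fun v => (proj N hS v, q v))
      (proj N hS ⁻¹' U) := (contMDiff_proj N hS D).contMDiffOn.prodMk hqs
  have hΨs : ContMDiffOn ((𝓡 N.dim).prod (𝓡 l)) (𝓡 n) ∞
      (fun z : N.Carrier × stabP P α => D.act (ℓ z.1) z.2) (U ×ˢ univ) :=
    D.contMDiff_act.comp_contMDiffOn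
      ((hℓs.comp contMDiff_fst.contMDiffOn fun z hz => hz.1).prodMk contMDiff_snd.contMDiffOn)
  have hqact : ∀ v, proj N hS v ∈ U → D.act (ℓ (proj N hS v)) (q v) = v := fun v hv => by
    apply Subtype.ext
    show C.act (ℓ (proj N hS v)).1 (stabPIncl P α (q v)) = v.1
    rw [hq v hv, C.act_div (hfib v hv)]
  have hactq : ∀ v, proj N hS v ∈ U → ∀ p, q (D.act v p) = q v * p := fun v hv p => by
    apply stabPIncl_injective P α
    have hv' : proj N hS (D.act v p) ∈ U := by rwa [hprojact]
    apply C.act_injective (ℓ (proj N hS v)).1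
    have h1 := congrArg Subtype.val (hqact _ hv')
    rw [hprojact] at h1
    refine h1.trans ?_
    show C.act v.1 (stabPIncl P α p) = C.act (ℓ (proj N hS v)).1 (stabPIncl P α (q v) *
      stabPIncl P α p)
    rw [C.act_mul]
    exact congrArg (fun w : Reduction s α => C.act w.1 (stabPIncl P α p)) (hqact v hv).symm
  let Φ : OpenPartialHomeomorph (Reduction s α) (N.Carrier × stabP P α) :=
    { toFun := fun v => (proj N hS v, q v)
      invFun := fun z => D.act (ℓ z.1) z.2
      source := proj N hS ⁻¹' U
      target := U ×ˢ univ
      map_source' := fun v hv => ⟨hv, trivial⟩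
      map_target' := fun z hz => by
        show proj N hS (D.act (ℓ z.1) z.2) ∈ U
        rw [hprojact, hprojℓ _ hz.1]; exact hz.1
      left_inv' := fun v hv => hqact v hv
      right_inv' := fun z hz => by
        have h1 : proj N hS (ℓ z.1) ∈ U := by rw [hprojℓ _ hz.1]; exact hz.1
        have h2 : q (ℓ z.1) = 1 := by
          apply stabPIncl_injective P α
          apply C.act_injective (ℓ z.1).1
          have h3 := congrArg Subtype.val (hqact _ h1)
          rw [hprojℓ _ hz.1] at h3
          refine h3.trans ?_
          exact (C.act_one _).symm
        refine Prod.ext ?_ ?_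
        · simp only [hprojact, hprojℓ _ hz.1]
        · simp only [hactq _ h1, h2, one_mul]
      open_source := hpU
      open_target := hU.prod isOpen_univ
      continuousOn_toFun := hΦs.continuousOn
      continuousOn_invFun := hΨs.continuousOn }
  refine ⟨U, Φ, hU, hxU, rfl, rfl, hΦs, hΨs, fun v hv => ⟨rfl, fun p => ⟨?_, ?_⟩⟩⟩
  · show proj N hS (D.act v p) ∈ U
    rw [hprojact]; exact hv
  · exact Prod.ext (hprojact v p) (hactq v hv p)

end Projection

end IsReductionStructure

end CartanGeometry

/-! ### The induced Cartan geometry -/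

namespace CartanGeometry

variable {EG : Type*} [NormedAddCommGroup EG] [NormedSpace ℝ EG] [FiniteDimensional ℝ EG]
  {EP : Type*} [NormedAddCommGroup EP] [NormedSpace ℝ EP] [FiniteDimensional ℝ EP]
  {EB : Type*} [NormedAddCommGroup EB] [NormedSpace ℝ EB] [FiniteDimensional ℝ EB]
  {EM : Type*} [NormedAddCommGroup EM] [NormedSpace ℝ EM] [FiniteDimensional ℝ EM]
  {EO : Type*} [NormedAddCommGroup EO] [NormedSpace ℝ EO] [FiniteDimensional ℝ EO]
  {G : Type*} [Group G] [TopologicalSpace G] [ChartedSpace EG G] [LieGroup 𝓘(ℝ, EG) ∞ G]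
  [SecondCountableTopology G]
  {P : Subgroup G} [ChartedSpace EP P] [LieGroup 𝓘(ℝ, EP) ∞ P]
  {B : Type*} [TopologicalSpace B] [ChartedSpace EB B] [IsManifold 𝓘(ℝ, EB) ∞ B]
  {M : Type*} [TopologicalSpace M] [ChartedSpace EM M] [IsManifold 𝓘(ℝ, EM) ∞ M]
  {O : Type*} [TopologicalSpace O] [ChartedSpace EO O] [IsManifold 𝓘(ℝ, EO) ∞ O]
  [MulAction G O] [ContMDiffSMul 𝓘(ℝ, EG) 𝓘(ℝ, EO) ∞ G O] [MulAction.IsPretransitive G O]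
  [ContMDiffSMul 𝓘(ℝ, EP) 𝓘(ℝ, EO) ∞ P O]
  {C : CartanGeometry EG EP EB EM P B M} {s : B → O}
  {α : O} {k l n : ℕ} [ChartedSpace (EuclideanSpace ℝ (Fin k)) (MulAction.stabilizer G α)]
  [ChartedSpace (EuclideanSpace ℝ (Fin l)) (stabP P α)]
  [ChartedSpace (EuclideanSpace ℝ (Fin n)) (Reduction s α)] [IsManifold (𝓡 n) ∞ (Reduction s α)]

namespace IsReductionStructure

variable (D : C.IsReductionStructure EO s α k l n)

/-- The derivative of the inclusion of the stabiliser of `α` into `G`. -/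
def lie (EG : Type*) [NormedAddCommGroup EG] [NormedSpace ℝ EG] (G : Type*) [Group G]
    [TopologicalSpace G] [ChartedSpace EG G] {O : Type*} [MulAction G O] (α : O) (k : ℕ)
        [ChartedSpace (EuclideanSpace ℝ (Fin k)) (MulAction.stabilizer G α)] :
    EuclideanSpace ℝ (Fin k) →L[ℝ] EG :=
  md (𝓡 k) 𝓘(ℝ, EG) (Subtype.val : MulAction.stabilizer G α → G) 1

theorem lie_injective (D : C.IsReductionStructure EO s α k l n) :
    Function.Injective (lie EG G α k) :=
  have := D.lieH.lieGroup
  injective_md_of_isImmersion D.lieH.isSmoothEmbedding.isImmersion 1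

theorem md_orbitMap_lie (D : C.IsReductionStructure EO s α k l n) (w : EuclideanSpace ℝ (Fin k)) :
    md 𝓘(ℝ, EG) 𝓘(ℝ, EO) (fun g : G => g • α) 1 (lie EG G α k w) = 0 := by
  have h := md_comp_apply (g := fun g : G => g • α)
    (f := (Subtype.val : MulAction.stabilizer G α → G)) (I := 𝓡 k) (L := 𝓘(ℝ, EO)) 1
    ((contMDiff_orbitMap EG EO G α).mdifferentiableAt (by simp))
    (D.lieH.isSmoothEmbedding.contMDiff.mdifferentiableAt (by simp)) w
  have h1 : (fun g : MulAction.stabilizer G α => (g : G) • α) = fun _ => α :=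
    funext fun g => g.2
  rw [h1, md_const] at h
  exact h.symm

/-- The Cartan connection maps tangent vectors of `{s = α}` to the Lie algebra of `G_α`. -/
theorem exists_lie_eq (D : C.IsReductionStructure EO s α k l n) (v : Reduction s α)
    (ξ : EuclideanSpace ℝ (Fin n)) :
    ∃ w, lie EG G α k w =
      C.om v.1 (md (𝓡 n) 𝓘(ℝ, EB) (Subtype.val : Reduction s α → B) v ξ) := by
  refine D.exists_md_stabilizer_eq _ ?_
  have h := md_comp_apply (g := s) (f := (Subtype.val : Reduction s α → B)) (I := 𝓡 n)
    (L := 𝓘(ℝ, EO)) v (D.holonomyReduction.smooth.mdifferentiableAt (by simp))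
    (D.contMDiff_val.mdifferentiableAt (by simp)) ξ
  have h1 : (fun v : Reduction s α => s v.1) = fun _ => α := funext fun v => v.2
  rw [h1, md_const, D.holonomyReduction.md_eq, v.2] at h
  exact neg_eq_zero.1 h.symm

/-- A linear left inverse of the inclusion of Lie algebras. -/
theorem exists_retraction (D : C.IsReductionStructure EO s α k l n) :
    ∃ R : EG →L[ℝ] EuclideanSpace ℝ (Fin k), ∀ w, R (lie EG G α k w) = w := by
  obtain ⟨R, hR⟩ := (lie EG G α k).toLinearMap.exists_leftInverse_of_injective
    (LinearMap.ker_eq_bot.2 D.lie_injective)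
  exact ⟨R.toContinuousLinearMap, fun w => LinearMap.congr_fun hR w⟩

/-- The restriction of the Cartan connection to `{s = α}`. -/
def form (D : C.IsReductionStructure EO s α k l n) (v : Reduction s α) :
    EuclideanSpace ℝ (Fin n) →L[ℝ] EuclideanSpace ℝ (Fin k) :=
  D.exists_retraction.choose.comp
    ((C.om v.1).comp (md (𝓡 n) 𝓘(ℝ, EB) (Subtype.val : Reduction s α → B) v))

theorem lie_form (v : Reduction s α) (ξ : EuclideanSpace ℝ (Fin n)) :
    lie EG G α k (D.form v ξ) =
      C.om v.1 (md (𝓡 n) 𝓘(ℝ, EB) (Subtype.val : Reduction s α → B) v ξ) := by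
  obtain ⟨w, hw⟩ := D.exists_lie_eq v ξ
  show lie EG G α k (D.exists_retraction.choose
    (C.om v.1 (md (𝓡 n) 𝓘(ℝ, EB) (Subtype.val : Reduction s α → B) v ξ))) = _
  rw [← hw, D.exists_retraction.choose_spec]

theorem smooth_form (D : C.IsReductionStructure EO s α k l n) :
    ContMDiff (M' := EuclideanSpace ℝ (Fin k)) (𝓡 n).tangent (𝓡 k) ∞
      (fun ξ : TangentBundle (𝓡 n) (Reduction s α) => D.form ξ.1 ξ.2) := by
  have h1 := D.contMDiff_val.contMDiff_tangentMap (m := ∞) le_rfl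
  exact D.exists_retraction.choose.contDiff.contMDiff.comp (C.smooth_form.comp h1)

theorem form_act (v : Reduction s α) (q : stabP P α) (ξ : EuclideanSpace ℝ (Fin n)) :
    D.form (D.act v q) (md (𝓡 n) (𝓡 n) (fun v' => D.act v' q) v ξ) =
      Ad (EuclideanSpace ℝ (Fin k)) ((q : MulAction.stabilizer G α)⁻¹) (D.form v ξ) := by
  have := D.lieH.lieGroup
  refine D.lie_injective ?_
  have hact : ContMDiff (𝓡 n) (𝓡 n) ∞ (fun v' => D.act v' q) :=
    D.contMDiff_act.comp (contMDiff_id.prodMk contMDiff_const)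
  have h1 := md_comp_apply (g := (Subtype.val : Reduction s α → B)) (f := fun v' => D.act v' q)
    (L := 𝓘(ℝ, EB)) v (D.contMDiff_val.mdifferentiableAt (by simp))
    (hact.mdifferentiableAt (by simp)) ξ
  have h2 := md_comp_apply (g := fun u => C.act u (stabPIncl P α q))
    (f := (Subtype.val : Reduction s α → B)) (I := 𝓡 n)
    (L := 𝓘(ℝ, EB)) v ((C.contMDiff_act_left _).mdifferentiableAt (by simp))
    (D.contMDiff_val.mdifferentiableAt (by simp)) ξ
  have h3 := md_val_ad D.lieH.isSmoothEmbedding.contMDiff (q : MulAction.stabilizer G α)⁻¹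
    (D.form v ξ)
  rw [lie_form]
  refine (congrArg (C.om (D.act v q).1) (h1.symm.trans h2)).trans ?_
  refine (C.om_act v.1 (stabPIncl P α q) _).trans ?_
  rw [← D.lie_form]
  exact h3.symm

theorem form_fundamental (v : Reduction s α) (Y : EuclideanSpace ℝ (Fin l)) :
    D.form (D.act v 1) (md (𝓡 l) (𝓡 n) (fun q => D.act v q) 1 Y) =
      lieInclusion (EuclideanSpace ℝ (Fin k)) (EuclideanSpace ℝ (Fin l)) (stabP P α) Y := by
  refine D.lie_injective ?_
  have hact : ContMDiff (𝓡 l) (𝓡 n) ∞ (fun q => D.act v q) :=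
    D.contMDiff_act.comp (contMDiff_const.prodMk contMDiff_id)
  have h1 := md_comp_apply (g := (Subtype.val : Reduction s α → B)) (f := fun q => D.act v q)
    (I := 𝓡 l) (L := 𝓘(ℝ, EB)) 1 (D.contMDiff_val.mdifferentiableAt (by simp))
    (hact.mdifferentiableAt (by simp)) Y
  have h2 := md_comp_apply (g := fun p => C.act v.1 p) (f := stabPIncl P α) (I := 𝓡 l)
    (L := 𝓘(ℝ, EB)) 1 ((C.contMDiff_act_right _).mdifferentiableAt (by simp))
    (D.contMDiff_stabPIncl.mdifferentiableAt (by simp)) Y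
  rw [lie_form]
  refine (congrArg (C.om (D.act v 1).1) (h1.symm.trans h2)).trans ?_
  have hv1 : (D.act v 1).1 = v.1 := C.act_one v.1
  rw [hv1]
  refine (C.om_fundamental v.1 (md (𝓡 l) 𝓘(ℝ, EP) (stabPIncl P α) 1 Y)).trans ?_
  have hP : MDifferentiableAt 𝓘(ℝ, EP) 𝓘(ℝ, EG) (Subtype.val : P → G) 1 :=
    D.isClosedLieSubgroup.isSmoothEmbedding.contMDiff.mdifferentiableAt (by simp)
  have h3 := md_comp_apply (g := (Subtype.val : P → G)) (f := stabPIncl P α) (I := 𝓡 l)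
    (L := 𝓘(ℝ, EG)) 1 hP (D.contMDiff_stabPIncl.mdifferentiableAt (by simp)) Y
  have h4 := md_comp_apply (g := (Subtype.val : MulAction.stabilizer G α → G))
    (f := (Subtype.val : stabP P α → MulAction.stabilizer G α)) (I := 𝓡 l)
    (L := 𝓘(ℝ, EG)) 1 (D.lieH.isSmoothEmbedding.contMDiff.mdifferentiableAt (by simp))
    (D.lieP.isSmoothEmbedding.contMDiff.mdifferentiableAt (by simp)) Y
  exact h3.symm.trans h4

theorem form_bijective (v : Reduction s α) : Function.Bijective (D.form v) := by
  constructor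
  · intro ξ η h
    have h1 := congrArg (lie EG G α k) h
    rw [lie_form, lie_form] at h1
    exact injective_md_of_isImmersion D.isSmoothEmbedding_val.isImmersion v
      ((C.om_bijective v.1).1 h1)
  · intro w
    obtain ⟨ξ, hξ⟩ := (C.om_bijective v.1).2 (lie EG G α k w)
    obtain ⟨η, hη⟩ := D.exists_md_val_eq v ξ (by
      rw [D.holonomyReduction.md_eq, hξ, v.2, D.md_orbitMap_lie, neg_zero])
    refine ⟨η, D.lie_injective ?_⟩
    rw [lie_form, hη, hξ]

variable {S : Set M} (N : InitialSubmanifold (EM := EM) S)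
  (hS : ∀ x, x ∈ S ↔ ∃ u, C.proj u = x ∧ s u = α)

/-- The Cartan geometry of type `(G_α, P_α)` with total space `{s = α}`. -/
def geom : CartanGeometry (EuclideanSpace ℝ (Fin k)) (EuclideanSpace ℝ (Fin l))
    (EuclideanSpace ℝ (Fin n)) (EuclideanSpace ℝ (Fin N.dim)) (stabP P α) (Reduction s α)
    N.Carrier where
  proj := proj N hS
  act := D.act
  act_one v := Subtype.ext (C.act_one v.1)
  act_mul v p q := Subtype.ext (C.act_mul v.1 (stabPIncl P α p) (stabPIncl P α q))
  locallyTrivial := D.exists_trivialization N hS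
  form := D.form
  smooth_form := D.smooth_form
  form_act := D.form_act
  form_fundamental := D.form_fundamental
  form_bijective := D.form_bijective

/-- The Cartan geometry on `{s = α}` is induced by the ambient one. -/
theorem nonempty_inducedGeometry [T2Space B] [SecondCountableTopology B]
    (D : C.IsReductionStructure EO s α k l n) {S : Set M} (N : InitialSubmanifold (EM := EM) S)
    (hS : ∀ x, x ∈ S ↔ ∃ u, C.proj u = x ∧ s u = α) :
    Nonempty (InducedGeometry C s N α) := by
  have hc : ContMDiff (𝓡 n) ((𝓡 N.dim).prod 𝓘(ℝ, EB)) ∞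
      (fun v : Reduction s α => (proj N hS v, v.1)) := (contMDiff_proj N hS D).prodMk
          D.contMDiff_val
  refine ⟨{
    dimH := k
    lieH := D.lieH
    dimP := l
    lieP := D.lieP
    dimTotal := n
    Total := Reduction s α
    t2 := T2Space.of_injective_continuous Subtype.val_injective continuous_subtype_val
    secondCountable := secondCountableTopology_subtype _
    geom := D.geom N hS
    incl := Subtype.val
    proj_incl := fun v => (incl_proj N hS v).symm
    incl_act := fun v q => rfl
    isSmoothEmbedding := ⟨isImmersion_of_injective_md hc fun v => ?_,
      IsEmbedding.of_comp hc.continuous continuous_snd IsEmbedding.subtypeVal⟩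
    range_incl := ?_
    form_incl := fun v ξ => (D.lie_form v ξ).symm }⟩
  · show Function.Injective (md (𝓡 n) ((𝓡 N.dim).prod 𝓘(ℝ, EB))
      (fun v : Reduction s α => (proj N hS v, v.1)) v)
    rw [md_prodMk ((contMDiff_proj N hS D).mdifferentiableAt (by simp))
      (D.contMDiff_val.mdifferentiableAt (by simp))]
    intro ξ η h
    exact injective_md_of_isImmersion D.isSmoothEmbedding_val.isImmersion v (congrArg Prod.snd h)
  · ext u
    exact ⟨by rintro ⟨v, rfl⟩; exact ⟨(hS _).2 ⟨v.1, rfl, v.2⟩, v.2⟩, fun hu => ⟨⟨u, hu.2⟩, rfl⟩⟩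

end IsReductionStructure

end CartanGeometry

/-! ### Change of the representative -/

namespace CartanGeometry

variable {EG : Type*} [NormedAddCommGroup EG] [NormedSpace ℝ EG] [FiniteDimensional ℝ EG]
  {EP : Type*} [NormedAddCommGroup EP] [NormedSpace ℝ EP] [FiniteDimensional ℝ EP]
  {EB : Type*} [NormedAddCommGroup EB] [NormedSpace ℝ EB] [FiniteDimensional ℝ EB]
  {EM : Type*} [NormedAddCommGroup EM] [NormedSpace ℝ EM] [FiniteDimensional ℝ EM]
  {EO : Type*} [NormedAddCommGroup EO] [NormedSpace ℝ EO] [FiniteDimensional ℝ EO]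
  {G : Type*} [Group G] [TopologicalSpace G] [ChartedSpace EG G] [LieGroup 𝓘(ℝ, EG) ∞ G]
  [SecondCountableTopology G]
  {P : Subgroup G} [ChartedSpace EP P] [LieGroup 𝓘(ℝ, EP) ∞ P]
  {B : Type*} [TopologicalSpace B] [ChartedSpace EB B] [IsManifold 𝓘(ℝ, EB) ∞ B]
  {M : Type*} [TopologicalSpace M] [ChartedSpace EM M] [IsManifold 𝓘(ℝ, EM) ∞ M]
  {O : Type*} [TopologicalSpace O] [ChartedSpace EO O] [IsManifold 𝓘(ℝ, EO) ∞ O]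
  [MulAction G O] [ContMDiffSMul 𝓘(ℝ, EG) 𝓘(ℝ, EO) ∞ G O] [MulAction.IsPretransitive G O]
  [ContMDiffSMul 𝓘(ℝ, EP) 𝓘(ℝ, EO) ∞ P O]
  {C : CartanGeometry EG EP EB EM P B M} {s : B → O}

/-- The points over which `s` takes the value `α` carry a Cartan geometry of type `(G_α, P_α)`. -/
theorem HolonomyReduction.nonempty_inducedGeometry [T2Space B] [SecondCountableTopology B]
    [T2Space O] (hs : C.HolonomyReduction (EO := EO) s) (hP : IsClosedLieSubgroup EG EP P)
    {α : O} {S : Set M} (N : InitialSubmanifold (EM := EM) S)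
    (hS : ∀ x, x ∈ S ↔ ∃ u, C.proj u = x ∧ s u = α) : Nonempty (InducedGeometry C s N α) := by
  obtain ⟨k, _, hH, hH'⟩ := exists_isClosedLieSubgroup_stabilizer (G := G) EG EO α
  obtain ⟨l, _, hl, hl'⟩ := exists_isClosedLieSubgroup_stabP EO hP α hH
  obtain ⟨n, _, _, hn, hn'⟩ := hs.exists_manifold_reduction α
  have D : C.IsReductionStructure EO s α k l n := ⟨hP, hs, hH, hl, hl', hn, hH', hn'⟩
  exact D.nonempty_inducedGeometry N hS

end CartanGeometry

namespace InducedGeometry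

variable {EG : Type*} [NormedAddCommGroup EG] [NormedSpace ℝ EG] [FiniteDimensional ℝ EG]
  {EP : Type*} [NormedAddCommGroup EP] [NormedSpace ℝ EP] [FiniteDimensional ℝ EP]
  {EB : Type*} [NormedAddCommGroup EB] [NormedSpace ℝ EB] [FiniteDimensional ℝ EB]
  {EM : Type*} [NormedAddCommGroup EM] [NormedSpace ℝ EM] [FiniteDimensional ℝ EM]
  {G : Type*} [Group G] [TopologicalSpace G] [ChartedSpace EG G] [LieGroup 𝓘(ℝ, EG) ∞ G]
  {P : Subgroup G} [ChartedSpace EP P] [LieGroup 𝓘(ℝ, EP) ∞ P]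
  {B : Type*} [TopologicalSpace B] [ChartedSpace EB B] [IsManifold 𝓘(ℝ, EB) ∞ B]
  {M : Type*} [TopologicalSpace M] [ChartedSpace EM M] [IsManifold 𝓘(ℝ, EM) ∞ M]
  {O : Type*} [MulAction G O]
  {C : CartanGeometry EG EP EB EM P B M} {s : B → O} {S : Set M}
  {N : InitialSubmanifold (EM := EM) S} {α : O}

theorem contMDiff_incl (D : InducedGeometry C s N α) :
    ContMDiff (𝓡 D.dimTotal) 𝓘(ℝ, EB) ∞ D.incl :=
  contMDiff_snd.comp D.isSmoothEmbedding.contMDiff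

theorem mdiffAt_incl (D : InducedGeometry C s N α) (v : D.Total) :
    MDifferentiableAt (𝓡 D.dimTotal) 𝓘(ℝ, EB) D.incl v :=
  D.contMDiff_incl.mdifferentiableAt (by simp)

theorem incl_injective (D : InducedGeometry C s N α) : Function.Injective D.incl := by
  intro v w h
  refine D.isSmoothEmbedding.isEmbedding.injective (Prod.ext (N.injective ?_) h)
  rw [← D.proj_incl, ← D.proj_incl, h]

/-- The inclusion of Lie algebras, as a linear map between the model vector spaces. -/
def lie (D : InducedGeometry C s N α) : EuclideanSpace ℝ (Fin D.dimH) →L[ℝ] EG :=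
  md (𝓡 D.dimH) 𝓘(ℝ, EG) (Subtype.val : MulAction.stabilizer G α → G) 1

theorem om_incl (D : InducedGeometry C s N α) (v : D.Total)
    (ξ : EuclideanSpace ℝ (Fin D.dimTotal)) :
    C.om (D.incl v) (md (𝓡 D.dimTotal) 𝓘(ℝ, EB) D.incl v ξ) = D.lie (D.geom.om v ξ) :=
  D.form_incl v ξ

/-- The right action of `b` maps the total spaces of the induced geometries to each other. -/
theorem exists_translate (heq : ∀ (u : B) (p : P), s (C.act u p) = (p : G)⁻¹ • s u) {β : O} (b : P)
    (hβ : β = (b : G)⁻¹ • α) (D : InducedGeometry C s N α) (D' : InducedGeometry C s N β) :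
    ∃ f : D.Total → D'.Total, ContMDiff (𝓡 D.dimTotal) (𝓡 D'.dimTotal) ∞ f ∧
      ∀ v, D'.incl (f v) = C.act (D.incl v) b := by
  have h : ∀ v, ∃ w, D'.incl w = C.act (D.incl v) b := by
    intro v
    have hv : D.incl v ∈ {u | C.proj u ∈ S ∧ s u = α} := D.range_incl ▸ mem_range_self v
    have : C.act (D.incl v) b ∈ {u | C.proj u ∈ S ∧ s u = β} := by
      refine ⟨?_, by rw [heq, hv.2, hβ]⟩
      rw [C.proj_act]; exact hv.1
    rwa [← D'.range_incl] at this
  choose f hf using h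
  refine ⟨f, ?_, hf⟩
  have hproj : ∀ v, D'.geom.proj (f v) = D.geom.proj v := fun v => by
    apply N.injective
    rw [← D'.proj_incl, ← D.proj_incl, hf, C.proj_act]
  have := D.lieP.lieGroup
  refine contMDiff_of_isImmersion_of_isInducing D'.isSmoothEmbedding.isImmersion
    D'.isSmoothEmbedding.isEmbedding.isInducing ?_
  simp only [hproj, hf]
  exact D.geom.contMDiff_proj.prodMk ((C.contMDiff_act_left b).comp D.contMDiff_incl)

theorem exists_isTranslate (heq : ∀ (u : B) (p : P), s (C.act u p) = (p : G)⁻¹ • s u) (b : P)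
    (D : InducedGeometry C s N α) (D' : InducedGeometry C s N ((b : G) • α)) :
    ∃ Ψ, D.IsTranslate b D' Ψ := by
  obtain ⟨f, hf, hf'⟩ := exists_translate heq b⁻¹ (by simp) D D'
  obtain ⟨g, hg, hg'⟩ := exists_translate heq b (by simp) D' D
  let Ψ : Diffeomorph (𝓡 D.dimTotal) (𝓡 D'.dimTotal) D.Total D'.Total ∞ :=
    { toFun := f
      invFun := g
      left_inv := fun v => D.incl_injective (by
        rw [hg', hf', ← C.act_mul, inv_mul_cancel, C.act_one])
      right_inv := fun v => D'.incl_injective (by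
        rw [hf', hg', ← C.act_mul, mul_inv_cancel, C.act_one])
      contMDiff_toFun := hf
      contMDiff_invFun := hg }
  refine ⟨Ψ, hf', fun v => N.injective ?_, fun v q q' hq => D'.incl_injective ?_, fun v ξ => ?_⟩
  · rw [← D'.proj_incl, ← D.proj_incl]
    show C.proj (D'.incl (f v)) = _
    rw [hf', C.proj_act]
  · show D'.incl (f _) = D'.incl (D'.geom.act (f v) q')
    rw [hf', D.incl_act, D'.incl_act, hf', hq, ← C.act_mul, ← C.act_mul]
    congr 1
    group
  · have hfv := hf.mdifferentiableAt (x := v) (by simp)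
    have h1 := md_comp_apply (g := D'.incl) (f := f) (L := 𝓘(ℝ, EB)) v (D'.mdiffAt_incl _) hfv ξ
    have h2 := md_comp_apply (g := fun u => C.act u b⁻¹) (f := D.incl) (I := 𝓡 D.dimTotal)
      (L := 𝓘(ℝ, EB)) v ((C.contMDiff_act_left _).mdifferentiableAt (by simp)) (D.mdiffAt_incl v) ξ
    simp only [hf'] at h1
    have h3 := D'.om_incl (f v) (md (𝓡 D.dimTotal) (𝓡 D'.dimTotal) f v ξ)
    refine h3.symm.trans ?_
    rw [← h1, h2, hf']
    refine (C.om_act (D.incl v) b⁻¹ _).trans ?_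
    rw [Subgroup.coe_inv, inv_inv]
    exact congrArg (Ad EG (b : G)) (D.om_incl v ξ)

end InducedGeometry

/-! ### Exterior derivatives of one-forms -/

section ExteriorDerivative

variable {E : Type*} [NormedAddCommGroup E] [NormedSpace ℝ E] [FiniteDimensional ℝ E]
  {E' : Type*} [NormedAddCommGroup E'] [NormedSpace ℝ E'] [FiniteDimensional ℝ E']
  {F : Type*} [NormedAddCommGroup F] [NormedSpace ℝ F]
  {F' : Type*} [NormedAddCommGroup F'] [NormedSpace ℝ F']
  {B : Type*} [TopologicalSpace B] [ChartedSpace E B] [IsManifold 𝓘(ℝ, E) ∞ B]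
  {B' : Type*} [TopologicalSpace B'] [ChartedSpace E' B'] [IsManifold 𝓘(ℝ, E') ∞ B']

/-- The exterior derivative commutes with pullbacks, for one-forms on vector spaces. -/
theorem fderiv_pullback_sub {W : E → E →L[ℝ] F} {J : E' → E} {W' : E' → E' →L[ℝ] F} {x : E'}
    (hW : DifferentiableAt ℝ W (J x)) (hJ : ContDiffAt ℝ ∞ J x)
    (hW' : ∀ᶠ z in 𝓝 x, W' z = (W (J z)).comp (fderiv ℝ J z)) (a b : E') :
    fderiv ℝ W' x a b - fderiv ℝ W' x b a =
      fderiv ℝ W (J x) (fderiv ℝ J x a) (fderiv ℝ J x b) -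
        fderiv ℝ W (J x) (fderiv ℝ J x b) (fderiv ℝ J x a) := by
  have hJ2 : ContDiffAt ℝ 2 J x := hJ.of_le
    (show ((2 : ℕ∞) : WithTop ℕ∞) ≤ ((⊤ : ℕ∞) : WithTop ℕ∞) from WithTop.coe_le_coe.2 le_top)
  have hJ1 : DifferentiableAt ℝ (fderiv ℝ J) x :=
    (hJ.fderiv_right (m := ∞) le_rfl).differentiableAt (by simp)
  have h1 : HasFDerivAt (fun z => W (J z)) ((fderiv ℝ W (J x)).comp (fderiv ℝ J x)) x :=
    hW.hasFDerivAt.comp x (hJ.differentiableAt (by simp)).hasFDerivAt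
  have h2 := h1.clm_comp hJ1.hasFDerivAt
  have h3 : ∀ a b, fderiv ℝ W' x a b = W (J x) (fderiv ℝ (fderiv ℝ J) x a b) +
      fderiv ℝ W (J x) (fderiv ℝ J x a) (fderiv ℝ J x b) := fun a b => by
    rw [Filter.EventuallyEq.fderiv_eq hW', h2.fderiv]
    simp
  have hsymm : fderiv ℝ (fderiv ℝ J) x a b = fderiv ℝ (fderiv ℝ J) x b a :=
    (hJ2.isSymmSndFDerivAt (by simp)).eq a b
  rw [h3, h3, hsymm]
  abel

/-- The expression of a one-form in a chart. -/
def chartForm (φ : OpenPartialHomeomorph B E) (θ : B → E →L[ℝ] F) : E → E →L[ℝ] F :=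
  fun x => (θ (φ.symm x)).comp (md 𝓘(ℝ, E) 𝓘(ℝ, E) φ.symm x)

/-- A one-form is differentiable in the preferred chart at `u`. -/
def FormDifferentiableAt (θ : B → E →L[ℝ] F) (u : B) : Prop :=
  DifferentiableAt ℝ (chartForm (echart 𝓘(ℝ, E) u) θ) (echart 𝓘(ℝ, E) u u)

/-- The exterior derivative, for one-forms with values in linear maps on the model space. -/
def extD (θ : B → E →L[ℝ] F) (u : B) (ξ η : E) : F := extDerivForm (B := B) θ u ξ η

theorem extD_eq (θ : B → E →L[ℝ] F) (u : B) (ξ η : E) :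
    extD θ u ξ η =
      fderiv ℝ (chartForm (echart 𝓘(ℝ, E) u) θ) (echart 𝓘(ℝ, E) u u)
        (md 𝓘(ℝ, E) 𝓘(ℝ, E) (echart 𝓘(ℝ, E) u) u ξ) (md 𝓘(ℝ, E) 𝓘(ℝ, E) (echart 𝓘(ℝ, E) u) u η) -
      fderiv ℝ (chartForm (echart 𝓘(ℝ, E) u) θ) (echart 𝓘(ℝ, E) u u)
        (md 𝓘(ℝ, E) 𝓘(ℝ, E) (echart 𝓘(ℝ, E) u) u η)
        (md 𝓘(ℝ, E) 𝓘(ℝ, E) (echart 𝓘(ℝ, E) u) u ξ) := by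
  have h : formInChart (B := B) θ u = chartForm (echart 𝓘(ℝ, E) u) θ := by
    funext x
    simp only [chartForm, echart_coe_symm]
    rfl
  rw [← h, echart_coe]
  rfl

/-- The exterior derivative commutes with pullbacks. -/
theorem extD_pullback {θ : B → E →L[ℝ] F} {θ' : B' → E' →L[ℝ] F'} {j : B' → B} {L : F' →L[ℝ] F}
    (hj : ContMDiff 𝓘(ℝ, E') 𝓘(ℝ, E) ∞ j)
    (h : ∀ v ξ, θ (j v) (md 𝓘(ℝ, E') 𝓘(ℝ, E) j v ξ) = L (θ' v ξ)) {v : B'}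
    (hθ : FormDifferentiableAt θ (j v)) (hθ' : FormDifferentiableAt θ' v) (ξ η : E') :
    L (extD θ' v ξ η) =
      extD θ (j v) (md 𝓘(ℝ, E') 𝓘(ℝ, E) j v ξ) (md 𝓘(ℝ, E') 𝓘(ℝ, E) j v η) := by
  set ψ := echart 𝓘(ℝ, E') v with hψdef
  set φ := echart 𝓘(ℝ, E) (j v) with hφdef
  have hψ : IsPDiffeo 𝓘(ℝ, E') 𝓘(ℝ, E') ψ := isPDiffeo_echart v
  have hφ : IsPDiffeo 𝓘(ℝ, E) 𝓘(ℝ, E) φ := isPDiffeo_echart (j v)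
  have hvψ : v ∈ ψ.source := mem_echart_source v
  have hvφ : j v ∈ φ.source := mem_echart_source (j v)
  let J : E' → E := fun z => φ (j (ψ.symm z))
  let V : Set E' := ψ.target ∩ (fun z => j (ψ.symm z)) ⁻¹' φ.source
  have hjψ : ContMDiffOn 𝓘(ℝ, E') 𝓘(ℝ, E) ∞ (fun z => j (ψ.symm z)) ψ.target :=
    hj.comp_contMDiffOn hψ.2
  have hV : IsOpen V := hjψ.continuousOn.isOpen_inter_preimage ψ.open_target φ.open_source
  have hvV : ψ v ∈ V := ⟨ψ.map_source hvψ, by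
    show j (ψ.symm (ψ v)) ∈ φ.source
    rwa [ψ.left_inv hvψ]⟩
  have hJ : ContMDiffOn 𝓘(ℝ, E') 𝓘(ℝ, E) ∞ J V :=
    hφ.1.comp (hjψ.mono inter_subset_left) fun z hz => hz.2
  have hJd : ∀ z ∈ V, ∀ a, fderiv ℝ J z a = md 𝓘(ℝ, E) 𝓘(ℝ, E) φ (j (ψ.symm z))
      (md 𝓘(ℝ, E') 𝓘(ℝ, E) j (ψ.symm z) (md 𝓘(ℝ, E') 𝓘(ℝ, E') ψ.symm z a)) := by
    intro z hz a
    have h1 := md_comp_apply (g := φ) (f := fun z => j (ψ.symm z)) (L := 𝓘(ℝ, E)) z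
      (hφ.mdiffAt hz.2) (ContMDiffOn.mdiffAt hjψ ψ.open_target hz.1) a
    have h2 := md_comp_apply (g := j) (f := ψ.symm) (L := 𝓘(ℝ, E)) z
      (hj.mdifferentiableAt (by simp)) (hψ.symm.mdiffAt hz.1) a
    rw [md_eq_fderiv, h2] at h1
    exact h1
  have hJv : J (ψ v) = φ (j v) := by simp only [J, ψ.left_inv hvψ]
  have hJdv : ∀ ξ, fderiv ℝ J (ψ v) (md 𝓘(ℝ, E') 𝓘(ℝ, E') ψ v ξ) =
      md 𝓘(ℝ, E) 𝓘(ℝ, E) φ (j v) (md 𝓘(ℝ, E') 𝓘(ℝ, E) j v ξ) := by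
    intro ξ
    rw [hJd _ hvV, ψ.left_inv hvψ, hψ.md_symm_comp hvψ]
  let W' : E' → E' →L[ℝ] F := fun z => L.comp (chartForm ψ θ' z)
  have hW' : ∀ᶠ z in 𝓝 (ψ v), W' z = (chartForm φ θ (J z)).comp (fderiv ℝ J z) := by
    filter_upwards [hV.mem_nhds hvV] with z hz
    ext a
    show L (θ' (ψ.symm z) (md 𝓘(ℝ, E') 𝓘(ℝ, E') ψ.symm z a)) =
      θ (φ.symm (φ (j (ψ.symm z)))) (md 𝓘(ℝ, E) 𝓘(ℝ, E) φ.symm (J z) (fderiv ℝ J z a))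
    rw [hJd z hz, hφ.md_symm_comp hz.2, φ.left_inv hz.2, h]
  have hW'd : ∀ a b, fderiv ℝ W' (ψ v) a b = L (fderiv ℝ (chartForm ψ θ') (ψ v) a b) := by
    intro a b
    have h1 : HasFDerivAt W' ((ContinuousLinearMap.compL ℝ E' F' F L).comp
        (fderiv ℝ (chartForm ψ θ') (ψ v))) (ψ v) :=
      (ContinuousLinearMap.compL ℝ E' F' F L).hasFDerivAt.comp _ hθ'.hasFDerivAt
    rw [h1.fderiv]
    rfl
  have key := fderiv_pullback_sub (W := chartForm φ θ) (by rw [hJv]; exact hθ)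
    ((contMDiffOn_iff_contDiffOn.1 hJ).contDiffAt (hV.mem_nhds hvV)) hW'
    (md 𝓘(ℝ, E') 𝓘(ℝ, E') ψ v ξ) (md 𝓘(ℝ, E') 𝓘(ℝ, E') ψ v η)
  rw [hW'd, hW'd, hJdv, hJdv, hJv, ← map_sub] at key
  rw [extD_eq, extD_eq]
  exact key

/-- Smooth one-forms are differentiable in charts. -/
theorem formDifferentiableAt_of_contMDiff [FiniteDimensional ℝ F]
    {θ : ∀ u : B, TangentSpace 𝓘(ℝ, E) u →L[ℝ] F}
    (hθ : ContMDiff 𝓘(ℝ, E).tangent 𝓘(ℝ, F) ∞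
      (fun ξ : TangentBundle 𝓘(ℝ, E) B => θ ξ.1 ξ.2)) (u : B) :
    FormDifferentiableAt (E := E) (B := B) θ u := by
  set φ := echart 𝓘(ℝ, E) u
  have hφ : IsPDiffeo 𝓘(ℝ, E) 𝓘(ℝ, E) φ := isPDiffeo_echart u
  have huφ : u ∈ φ.source := mem_echart_source u
  have h : ContDiffOn ℝ ∞ (chartForm φ (fun u => (θ u : E →L[ℝ] F))) φ.target := by
    rw [contDiffOn_clm_apply]
    intro a
    rw [← contMDiffOn_iff_contDiffOn]
    have h1 := hφ.2.contMDiffOn_tangentMapWithin (m := ∞) le_rfl φ.open_target.uniqueMDiffOn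
    have h2 : ContMDiff 𝓘(ℝ, E) 𝓘(ℝ, E).tangent ∞
        (fun x : E => (⟨x, a⟩ : TangentBundle 𝓘(ℝ, E) E)) :=
      contMDiff_vectorSpace_iff_contDiff.2 contDiff_const
    refine (hθ.comp_contMDiffOn (h1.comp h2.contMDiffOn fun x hx => hx)).congr fun x hx => ?_
    simp only [Function.comp, tangentMapWithin, mfderivWithin_of_isOpen φ.open_target hx]
    rfl
  exact ((h.contDiffAt (φ.open_target.mem_nhds (φ.map_source huφ))).differentiableAt (by simp))

end ExteriorDerivative

/-! ### Fundamental fields and the Maurer-Cartan equation -/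

section Actions

variable {E : Type*} [NormedAddCommGroup E] [NormedSpace ℝ E] [FiniteDimensional ℝ E]
  {E' : Type*} [NormedAddCommGroup E'] [NormedSpace ℝ E'] [FiniteDimensional ℝ E']
  {F : Type*} [NormedAddCommGroup F] [NormedSpace ℝ F]
  {B : Type*} [TopologicalSpace B] [ChartedSpace E B] [IsManifold 𝓘(ℝ, E) ∞ B]
  {Q : Type*} [TopologicalSpace Q] [ChartedSpace E' Q] [IsManifold 𝓘(ℝ, E') ∞ Q]

/-- The exterior derivative of a one-form `θ` which is constant on the fundamental fields of an
action `A`, with one of these fields inserted: it is the derivative of `θ` along the action. -/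
theorem extD_fundamental {θ : B → E →L[ℝ] F} {A : B → Q → B}
    (hA : ContMDiff (𝓘(ℝ, E).prod 𝓘(ℝ, E')) 𝓘(ℝ, E) ∞ (fun z : B × Q => A z.1 z.2)) {e : Q}
    (hAe : ∀ u, A u e = u) {u : B} (hθ : FormDifferentiableAt θ u) {p : ℝ → Q} {T : Set ℝ}
    (hT : IsOpen T) (h0T : (0 : ℝ) ∈ T) (hp : ContMDiffOn 𝓘(ℝ, ℝ) 𝓘(ℝ, E') ∞ p T) (hp0 : p 0 = e)
    {X : F} (hX : ∀ u', θ u' (md 𝓘(ℝ, E') 𝓘(ℝ, E) (A u') e (md 𝓘(ℝ, ℝ) 𝓘(ℝ, E') p 0 1)) = X)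
    (η : E) :
    extD θ u (md 𝓘(ℝ, E') 𝓘(ℝ, E) (A u) e (md 𝓘(ℝ, ℝ) 𝓘(ℝ, E') p 0 1)) η =
      deriv (fun t => θ (A u (p t)) (md 𝓘(ℝ, E) 𝓘(ℝ, E) (fun u' => A u' (p t)) u η)) 0 := by
  -- the form is pulled back to a surface spanned by the action and a curve tangent to `η`
  obtain ⟨R, γ, hR, h0R, hγ, hγ0, hγd⟩ :=
    exists_contMDiffOn_md_eq (0 : ℝ) u (ContinuousLinearMap.toSpanSingleton ℝ η)
  have hγη : md 𝓘(ℝ, ℝ) 𝓘(ℝ, E) γ 0 1 = η := by rw [hγd]; simp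
  set φ := echart 𝓘(ℝ, E) u
  have hφ : IsPDiffeo 𝓘(ℝ, E) 𝓘(ℝ, E) φ := isPDiffeo_echart u
  have huφ : u ∈ φ.source := mem_echart_source u
  let c : ℝ × ℝ → B := fun z => A (γ z.2) (p z.1)
  have hc : ContMDiffOn 𝓘(ℝ, ℝ × ℝ) 𝓘(ℝ, E) ∞ c (T ×ˢ R) :=
    hA.comp_contMDiffOn ((hγ.comp contDiff_snd.contMDiff.contMDiffOn fun z hz => hz.2).prodMk
      (hp.comp contDiff_fst.contMDiff.contMDiffOn fun z hz => hz.1))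
  have hTR : IsOpen (T ×ˢ R) := hT.prod hR
  let V : Set (ℝ × ℝ) := (T ×ˢ R) ∩ c ⁻¹' φ.source
  have hV : IsOpen V := hc.continuousOn.isOpen_inter_preimage hTR φ.open_source
  have hc0 : c 0 = u := by
    show A (γ 0) (p 0) = u
    rw [hγ0, hp0, hAe]
  have h0V : (0 : ℝ × ℝ) ∈ V := ⟨⟨h0T, h0R⟩, by rw [mem_preimage, hc0]; exact huφ⟩
  let J : ℝ × ℝ → E := fun z => φ (c z)
  have hJ : ContMDiffOn 𝓘(ℝ, ℝ × ℝ) 𝓘(ℝ, E) ∞ J V :=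
    hφ.1.comp (hc.mono inter_subset_left) fun z hz => hz.2
  have hcd : ∀ z ∈ V, ∀ a : ℝ × ℝ, md 𝓘(ℝ, ℝ × ℝ) 𝓘(ℝ, E) c z a =
      md 𝓘(ℝ, E) 𝓘(ℝ, E) (fun u' => A u' (p z.1)) (γ z.2) (md 𝓘(ℝ, ℝ) 𝓘(ℝ, E) γ z.2 a.2) +
      md 𝓘(ℝ, E') 𝓘(ℝ, E) (A (γ z.2)) (p z.1) (md 𝓘(ℝ, ℝ) 𝓘(ℝ, E') p z.1 a.1) := by
    intro z hz a
    have hγz := ContMDiffOn.mdiffAt hγ hR hz.1.2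
    have hpz := ContMDiffOn.mdiffAt hp hT hz.1.1
    have hs : MDifferentiableAt 𝓘(ℝ, ℝ × ℝ) 𝓘(ℝ, ℝ) (Prod.snd : ℝ × ℝ → ℝ) z :=
      contDiff_snd.contMDiff.mdifferentiableAt (n := ∞) (by simp)
    have hf : MDifferentiableAt 𝓘(ℝ, ℝ × ℝ) 𝓘(ℝ, ℝ) (Prod.fst : ℝ × ℝ → ℝ) z :=
      contDiff_fst.contMDiff.mdifferentiableAt (n := ∞) (by simp)
    have h1 := md_comp_apply (g := γ) (f := Prod.snd) (L := 𝓘(ℝ, E)) z hγz hs a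
    have h2 := md_comp_apply (g := p) (f := Prod.fst) (L := 𝓘(ℝ, E')) z hpz hf a
    rw [md_eq_fderiv, fderiv_snd] at h1
    rw [md_eq_fderiv, fderiv_fst] at h2
    have hγz' : MDifferentiableAt 𝓘(ℝ, ℝ × ℝ) 𝓘(ℝ, E) (fun z : ℝ × ℝ => γ z.2) z := hγz.comp z hs
    have hpz' : MDifferentiableAt 𝓘(ℝ, ℝ × ℝ) 𝓘(ℝ, E') (fun z : ℝ × ℝ => p z.1) z := hpz.comp z hf
    have h3 := md_comp_apply (g := fun z : B × Q => A z.1 z.2)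
      (f := fun z : ℝ × ℝ => (γ z.2, p z.1)) (L := 𝓘(ℝ, E)) z
      (hA.mdifferentiableAt (by simp)) (hγz'.prodMk hpz') a
    rw [md_prodMk hγz' hpz', ContinuousLinearMap.prod_apply,
      md_prod_apply (hA.mdifferentiableAt (by simp)), h1, h2] at h3
    exact h3
  have hJd : ∀ z ∈ V, ∀ a, fderiv ℝ J z a =
      md 𝓘(ℝ, E) 𝓘(ℝ, E) φ (c z) (md 𝓘(ℝ, ℝ × ℝ) 𝓘(ℝ, E) c z a) := by
    intro z hz a
    have h1 := md_comp_apply (g := φ) (f := c) (L := 𝓘(ℝ, E)) z (hφ.mdiffAt hz.2)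
      (ContMDiffOn.mdiffAt hc hTR hz.1) a
    rw [md_eq_fderiv] at h1
    exact h1
  let W' : ℝ × ℝ → ℝ × ℝ →L[ℝ] F := fun z => (chartForm φ θ (J z)).comp (fderiv ℝ J z)
  have hW'V : ∀ z ∈ V, ∀ a, W' z a = θ (c z) (md 𝓘(ℝ, ℝ × ℝ) 𝓘(ℝ, E) c z a) := by
    intro z hz a
    show θ (φ.symm (φ (c z))) (md 𝓘(ℝ, E) 𝓘(ℝ, E) φ.symm (φ (c z)) (fderiv ℝ J z a)) = _
    rw [hJd z hz, hφ.md_symm_comp hz.2, φ.left_inv hz.2]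
  have hJ0 : J 0 = φ u := by simp only [J, hc0]
  have hJs : ContDiffAt ℝ ∞ J 0 := (contMDiffOn_iff_contDiffOn.1 hJ).contDiffAt (hV.mem_nhds h0V)
  have hW'd : DifferentiableAt ℝ W' 0 := by
    have h1 : DifferentiableAt ℝ (fun z => chartForm φ θ (J z)) 0 :=
      DifferentiableAt.fun_comp' (g := chartForm φ θ) (f := J) (0 : ℝ × ℝ)
        (by rw [hJ0]; exact hθ) (hJs.differentiableAt (by simp))
    exact h1.clm_comp ((hJs.fderiv_right (m := ∞) le_rfl).differentiableAt (by simp))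
  have key := fderiv_pullback_sub (W := chartForm φ θ) (J := J) (W' := W') (by rw [hJ0]; exact hθ)
    hJs (Filter.Eventually.of_forall fun z => rfl) (1, 0) (0, 1)
  -- derivatives along the two coordinate axes
  have hline : ∀ a b : ℝ × ℝ, HasDerivAt (fun t : ℝ => W' (t • a) b) (fderiv ℝ W' 0 a b) 0 := by
    intro a b
    have h1 : HasDerivAt (fun t : ℝ => t • a) a 0 := by
      simpa using (hasDerivAt_id (0 : ℝ)).smul_const a
    have h2 : HasDerivAt (fun t : ℝ => W' (t • a)) (fderiv ℝ W' 0 a) 0 := by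
      have h3 : HasFDerivAt W' (fderiv ℝ W' 0) ((0 : ℝ) • a) := by
        rw [zero_smul]; exact hW'd.hasFDerivAt
      exact h3.comp_hasDerivAt 0 h1
    simpa using h2.clm_apply (hasDerivAt_const (0 : ℝ) b)
  have hnear : ∀ a : ℝ × ℝ, ∀ᶠ t : ℝ in 𝓝 0, t • a ∈ V := by
    intro a
    have h1 : Continuous (fun t : ℝ => t • a) := by fun_prop
    exact h1.continuousAt.preimage_mem_nhds (by rw [zero_smul]; exact hV.mem_nhds h0V)
  have hfst : fderiv ℝ W' 0 (1, 0) (0, 1) =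
      deriv (fun t => θ (A u (p t)) (md 𝓘(ℝ, E) 𝓘(ℝ, E) (fun u' => A u' (p t)) u η)) 0 := by
    rw [← (hline (1, 0) (0, 1)).deriv]
    refine Filter.EventuallyEq.deriv_eq ?_
    filter_upwards [hnear (1, 0)] with t ht
    rw [hW'V _ ht, hcd _ ht]
    simp only [c, Prod.smul_fst, Prod.smul_snd, smul_eq_mul, mul_one, mul_zero, map_zero, add_zero,
      hγ0, hγη]
  have hsnd : fderiv ℝ W' 0 (0, 1) (1, 0) = 0 := by
    rw [← (hline (0, 1) (1, 0)).deriv]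
    have : (fun t : ℝ => W' (t • ((0 : ℝ), (1 : ℝ))) (1, 0)) =ᶠ[𝓝 0] fun _ => X := by
      filter_upwards [hnear (0, 1)] with t ht
      rw [hW'V _ ht, hcd _ ht]
      simp only [c, Prod.smul_fst, Prod.smul_snd, smul_eq_mul, mul_one, mul_zero, map_zero,
        zero_add, hp0, hAe, hX]
    rw [this.deriv_eq, deriv_const]
  have hd1 : fderiv ℝ J 0 (1, 0) = md 𝓘(ℝ, E) 𝓘(ℝ, E) φ u
      (md 𝓘(ℝ, E') 𝓘(ℝ, E) (A u) e (md 𝓘(ℝ, ℝ) 𝓘(ℝ, E') p 0 1)) := by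
    rw [hJd 0 h0V, hcd 0 h0V, hc0]
    simp only [Prod.fst_zero, Prod.snd_zero, map_zero, zero_add, hγ0, hp0]
  have hd2 : fderiv ℝ J 0 (0, 1) = md 𝓘(ℝ, E) 𝓘(ℝ, E) φ u η := by
    rw [hJd 0 h0V, hcd 0 h0V, hc0]
    simp only [Prod.fst_zero, Prod.snd_zero, map_zero, add_zero, hγ0, hp0, hγη, hAe]
    rw [md_id]; rfl
  rw [hfst, hsnd, sub_zero, hd1, hd2, hJ0] at key
  rw [extD_eq]
  exact key.symm

end Actions

section MaurerCartan

variable {EG : Type*} [NormedAddCommGroup EG] [NormedSpace ℝ EG] [FiniteDimensional ℝ EG]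
  {G : Type*} [Group G] [TopologicalSpace G] [ChartedSpace EG G] [LieGroup 𝓘(ℝ, EG) ∞ G]

variable (EG) in
/-- The Maurer-Cartan form, with values in linear maps on the model space. -/
def mc (g : G) : EG →L[ℝ] EG := md 𝓘(ℝ, EG) 𝓘(ℝ, EG) (fun x : G => g⁻¹ * x) g

theorem mc_mul_left (g : G) (v : EG) :
    mc EG g (md 𝓘(ℝ, EG) 𝓘(ℝ, EG) (fun x : G => g * x) 1 v) = v := by
  have h1 : ContMDiff 𝓘(ℝ, EG) 𝓘(ℝ, EG) ∞ (fun x : G => g⁻¹ * x) := contMDiff_mul_left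
  have h2 : ContMDiff 𝓘(ℝ, EG) 𝓘(ℝ, EG) ∞ (fun x : G => g * x) := contMDiff_mul_left
  have h := md_comp_apply (g := fun x : G => g⁻¹ * x) (f := fun x : G => g * x)
    (L := 𝓘(ℝ, EG)) 1 (h1.mdifferentiableAt (by simp)) (h2.mdifferentiableAt (by simp)) v
  simp only [inv_mul_cancel_left, mul_one, md_id] at h
  exact h.symm

theorem mc_bijective (g : G) : Function.Bijective (mc EG g) := md_mul_left_bijective EG g⁻¹ g

/-- The Maurer-Cartan form is smooth in charts. -/
theorem contDiffAt_chartForm_mc :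
    ContDiffAt ℝ ∞ (chartForm (echart 𝓘(ℝ, EG) (1 : G)) (mc EG)) (echart 𝓘(ℝ, EG) (1 : G) 1) := by
  set φ := echart 𝓘(ℝ, EG) (1 : G)
  have hφ : IsPDiffeo 𝓘(ℝ, EG) 𝓘(ℝ, EG) φ := isPDiffeo_echart 1
  have h1φ : (1 : G) ∈ φ.source := mem_echart_source 1
  -- left division in the chart
  let d : EG × EG → G := fun z => (φ.symm z.1)⁻¹ * φ.symm z.2
  have hd : ContMDiffOn 𝓘(ℝ, EG × EG) 𝓘(ℝ, EG) ∞ d (φ.target ×ˢ φ.target) :=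
    (hφ.2.comp contDiff_fst.contMDiff.contMDiffOn fun z hz => hz.1).inv.mul
      (hφ.2.comp contDiff_snd.contMDiff.contMDiffOn fun z hz => hz.2)
  let V : Set (EG × EG) := (φ.target ×ˢ φ.target) ∩ d ⁻¹' φ.source
  have hV : IsOpen V := hd.continuousOn.isOpen_inter_preimage
    (φ.open_target.prod φ.open_target) φ.open_source
  let ν : EG × EG → EG := fun z => φ (d z)
  have hν : ContDiffOn ℝ ∞ ν V := contMDiffOn_iff_contDiffOn.1
    (hφ.1.comp (hd.mono inter_subset_left) fun z hz => hz.2)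
  have hdiag : ∀ x ∈ φ.target, (x, x) ∈ V := fun x hx => ⟨⟨hx, hx⟩, by
    show (φ.symm x)⁻¹ * φ.symm x ∈ φ.source
    rw [inv_mul_cancel]; exact h1φ⟩
  let K : EG →L[ℝ] EG := md 𝓘(ℝ, EG) 𝓘(ℝ, EG) φ.symm (φ 1)
  have heq : ∀ x ∈ φ.target, chartForm φ (mc EG) x =
      K.comp ((fderiv ℝ ν (x, x)).comp (ContinuousLinearMap.inr ℝ EG EG)) := by
    intro x hx
    ext a
    have hxs := φ.map_target hx
    have hl : ContMDiff 𝓘(ℝ, EG) 𝓘(ℝ, EG) ∞ (fun y : G => (φ.symm x)⁻¹ * y) := contMDiff_mul_left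
    have hls := ((hl.comp_contMDiffOn hφ.2) : ContMDiffOn 𝓘(ℝ, EG) 𝓘(ℝ, EG) ∞
      (fun y => (φ.symm x)⁻¹ * φ.symm y) φ.target)
    have h1 := md_comp_apply (g := fun y : G => (φ.symm x)⁻¹ * y) (f := φ.symm)
      (L := 𝓘(ℝ, EG)) x (hl.mdifferentiableAt (by simp)) (hφ.symm.mdiffAt hx) a
    have h2 := md_comp_apply (g := φ) (f := fun y => (φ.symm x)⁻¹ * φ.symm y)
      (L := 𝓘(ℝ, EG)) x (by rw [inv_mul_cancel]; exact hφ.mdiffAt h1φ)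
      (ContMDiffOn.mdiffAt hls φ.open_target hx) a
    have h3 : HasFDerivAt (fun y => ν (x, y))
        ((fderiv ℝ ν (x, x)).comp (ContinuousLinearMap.inr ℝ EG EG)) x :=
      ((hν.contDiffAt (hV.mem_nhds (hdiag x hx))).differentiableAt (by simp)).hasFDerivAt.comp x
        (hasFDerivAt_prodMk_right x x)
    rw [md_eq_fderiv] at h2
    rw [inv_mul_cancel] at h2
    have h4 := congrArg (fun L => L a) h3.fderiv
    show md 𝓘(ℝ, EG) 𝓘(ℝ, EG) (fun y : G => (φ.symm x)⁻¹ * y) (φ.symm x)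
      (md 𝓘(ℝ, EG) 𝓘(ℝ, EG) φ.symm x a) = K _
    refine h1.symm.trans ?_
    refine Eq.trans ?_ (congrArg K h4)
    refine Eq.trans ?_ (congrArg K h2).symm
    exact (hφ.md_symm_comp h1φ _).symm
  have hs : ContDiffOn ℝ ∞ (fun x => K.comp ((fderiv ℝ ν (x, x)).comp
      (ContinuousLinearMap.inr ℝ EG EG))) φ.target := by
    have h1 : ContDiffOn ℝ ∞ (fun x => fderiv ℝ ν (x, x)) φ.target :=
      (hν.fderiv_of_isOpen hV (m := ∞) le_rfl).comp (contDiff_id.prodMk contDiff_id).contDiffOn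
        fun x hx => hdiag x hx
    exact contDiffOn_const.clm_comp (h1.clm_comp contDiffOn_const)
  exact (hs.congr heq).contDiffAt (φ.open_target.mem_nhds (φ.map_source h1φ))

theorem formDifferentiableAt_mc : FormDifferentiableAt (mc EG) (1 : G) :=
  contDiffAt_chartForm_mc.differentiableAt (by simp)

variable (EG G) in
/-- The bracket of the Lie algebra of `G`, on the model space. -/
def lieBr (X Y : EG) : EG :=
  Bracket.bracket (L := GroupLieAlgebra 𝓘(ℝ, EG) G) (M := GroupLieAlgebra 𝓘(ℝ, EG) G) X Y

/-- The Maurer-Cartan equation at the unit. -/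
theorem extD_mc (X Y : EG) : extD (mc EG) (1 : G) X Y = - lieBr EG G X Y := by
  set φ := echart 𝓘(ℝ, EG) (1 : G) with hφdef
  have hφ : IsPDiffeo 𝓘(ℝ, EG) 𝓘(ℝ, EG) φ := isPDiffeo_echart 1
  have h1φ : (1 : G) ∈ φ.source := mem_echart_source 1
  set W := chartForm φ (mc EG) with hW
  have hWs : ContDiffAt ℝ ∞ W (φ 1) := contDiffAt_chartForm_mc
  -- the left invariant vector fields in the chart
  let Z : EG → EG → EG := fun v x => (md 𝓘(ℝ, EG) 𝓘(ℝ, EG) φ.symm x).inverse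
    (md 𝓘(ℝ, EG) 𝓘(ℝ, EG) (fun y : G => φ.symm x * y) 1 v)
  have hinv : ∀ x ∈ φ.target, (md 𝓘(ℝ, EG) 𝓘(ℝ, EG) φ.symm x).IsInvertible := fun x hx =>
    ⟨(LinearEquiv.ofBijective (md 𝓘(ℝ, EG) 𝓘(ℝ, EG) φ.symm x).toLinearMap
      (hφ.symm.md_bijective hx)).toContinuousLinearEquiv, by ext; rfl⟩
  have hWinv : ∀ x ∈ φ.target, (W x).IsInvertible := fun x hx =>
    ⟨(LinearEquiv.ofBijective (W x).toLinearMap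
      ((mc_bijective _).comp (hφ.symm.md_bijective hx))).toContinuousLinearEquiv, by ext; rfl⟩
  have hWZ : ∀ v, ∀ x ∈ φ.target, W x (Z v x) = v := by
    intro v x hx
    show mc EG (φ.symm x) (md 𝓘(ℝ, EG) 𝓘(ℝ, EG) φ.symm x (Z v x)) = v
    have : md 𝓘(ℝ, EG) 𝓘(ℝ, EG) φ.symm x (Z v x) =
        md 𝓘(ℝ, EG) 𝓘(ℝ, EG) (fun y : G => φ.symm x * y) 1 v := (hinv x hx).self_apply_inverse _
    rw [this, mc_mul_left]
  have hZ : ∀ v, ∀ x ∈ φ.target, Z v x = (W x).inverse v := fun v x hx =>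
    (hWinv x hx).injective (by rw [hWZ v x hx, (hWinv x hx).self_apply_inverse])
  have hnhds : φ.target ∈ 𝓝 (φ 1) := φ.open_target.mem_nhds (φ.map_source h1φ)
  have hZd : ∀ v, DifferentiableAt ℝ (Z v) (φ 1) := by
    intro v
    have h1 : DifferentiableAt ℝ (fun x => (W x).inverse v) (φ 1) :=
      (((hWinv _ (φ.map_source h1φ)).contDiffAt_map_inverse (n := ∞)).comp (φ 1)
        hWs).differentiableAt (by simp) |>.clm_apply (differentiableAt_const v)
    exact h1.congr_of_eventuallyEq (Filter.eventuallyEq_of_mem hnhds (hZ v))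
  -- differentiate `W (Z v) = v`
  have hWd := (hWs.differentiableAt (by simp)).hasFDerivAt
  have hder : ∀ v a, fderiv ℝ W (φ 1) a (Z v (φ 1)) = - W (φ 1) (fderiv ℝ (Z v) (φ 1) a) := by
    intro v a
    have h1 := hWd.clm_apply (hZd v).hasFDerivAt
    have h2 : (fun x => W x (Z v x)) =ᶠ[𝓝 (φ 1)] fun _ => v :=
      Filter.eventuallyEq_of_mem hnhds (hWZ v)
    have h3 := congrArg (fun L => L a) (h1.fderiv.symm.trans (h2.fderiv_eq.trans (by simp)) :
      _ = (0 : EG →L[ℝ] EG))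
    simp only [_root_.add_apply, ContinuousLinearMap.comp_apply,
      ContinuousLinearMap.flip_apply, _root_.zero_apply] at h3
    exact eq_neg_of_add_eq_zero_right h3
  have hZ1 : ∀ v, Z v (φ 1) = md 𝓘(ℝ, EG) 𝓘(ℝ, EG) φ 1 v := by
    intro v
    have h1 := φ.map_source h1φ
    refine (hφ.symm.md_bijective h1).1 ?_
    refine ((hinv _ h1).self_apply_inverse _).trans ?_
    rw [hφ.md_symm_comp h1φ, φ.left_inv h1φ]
    simp only [one_mul]
    rw [md_id]; rfl
  have hW1 : ∀ a, W (φ 1) a = md 𝓘(ℝ, EG) 𝓘(ℝ, EG) φ.symm (φ 1) a := by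
    intro a
    show mc EG (φ.symm (φ 1)) (md 𝓘(ℝ, EG) 𝓘(ℝ, EG) φ.symm (φ 1) a) = _
    rw [φ.left_inv h1φ]
    simp only [mc, inv_one, one_mul]
    rw [md_id]; rfl
  have hbr : md 𝓘(ℝ, EG) 𝓘(ℝ, EG) φ 1 (lieBr EG G X Y) =
      VectorField.lieBracket ℝ (Z X) (Z Y) (φ 1) := by
    have hφi : (md 𝓘(ℝ, EG) 𝓘(ℝ, EG) φ 1).IsInvertible :=
      ⟨(LinearEquiv.ofBijective (md 𝓘(ℝ, EG) 𝓘(ℝ, EG) φ 1).toLinearMap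
        (hφ.md_bijective h1φ)).toContinuousLinearEquiv, by ext; rfl⟩
    have h1 : lieBr EG G X Y = (md 𝓘(ℝ, EG) 𝓘(ℝ, EG) φ 1).inverse
        (VectorField.lieBracket ℝ (Z X) (Z Y) (φ 1)) := by
      have h2 : ∀ v : EG, VectorField.mpullbackWithin 𝓘(ℝ, EG) 𝓘(ℝ, EG)
          (extChartAt 𝓘(ℝ, EG) (1 : G)).symm
          (mulInvariantVectorField (I := 𝓘(ℝ, EG)) (G := G) v) (range 𝓘(ℝ, EG)) = Z v := by
        intro v
        funext x
        rw [VectorField.mpullbackWithin_apply]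
        simp only [modelWithCornersSelf_coe, range_id, mfderivWithin_univ]
        simp only [Z, hφdef, echart_coe_symm]
        rfl
      show VectorField.mlieBracket 𝓘(ℝ, EG)
        (mulInvariantVectorField (I := 𝓘(ℝ, EG)) (G := G) X)
        (mulInvariantVectorField (I := 𝓘(ℝ, EG)) (G := G) Y) (1 : G) = _
      rw [VectorField.mlieBracket, VectorField.mlieBracketWithin_apply, h2, h2]
      simp only [modelWithCornersSelf_coe, range_id, preimage_univ, inter_univ,
        VectorField.lieBracketWithin_univ]
      rw [hφdef, echart_coe]
      rfl
    rw [h1, hφi.self_apply_inverse]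
  rw [extD_eq, ← hφdef, ← hW, ← hZ1, ← hZ1, hder, hder]
  have h := congrArg (md 𝓘(ℝ, EG) 𝓘(ℝ, EG) φ.symm (φ 1)) hbr
  rw [hφ.md_symm_comp h1φ] at h
  rw [h, VectorField.lieBracket_eq, ← hW1]
  simp only [map_sub]
  abel

end MaurerCartan

/-! ### Curvature of the induced geometry -/

section LieSubgroups

variable {EG : Type*} [NormedAddCommGroup EG] [NormedSpace ℝ EG] [FiniteDimensional ℝ EG]
  {EH : Type*} [NormedAddCommGroup EH] [NormedSpace ℝ EH] [FiniteDimensional ℝ EH]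
  {G : Type*} [Group G] [TopologicalSpace G] [ChartedSpace EG G] [LieGroup 𝓘(ℝ, EG) ∞ G]
  {H : Subgroup G} [ChartedSpace EH H]

/-- The derivative of a right translation, read with the Maurer-Cartan form, is an adjoint action.
-/
theorem mc_md_mul_right (g : G) (η : EG) :
    mc EG g (md 𝓘(ℝ, EG) 𝓘(ℝ, EG) (fun x : G => x * g) 1 η) = Ad EG g⁻¹ η := by
  have h1 : ContMDiff 𝓘(ℝ, EG) 𝓘(ℝ, EG) ∞ (fun x : G => g⁻¹ * x) := contMDiff_mul_left
  have h2 : ContMDiff 𝓘(ℝ, EG) 𝓘(ℝ, EG) ∞ (fun x : G => x * g) := contMDiff_mul_right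
  have h := md_comp_apply (g := fun x : G => g⁻¹ * x) (f := fun x : G => x * g)
    (L := 𝓘(ℝ, EG)) 1 (h1.mdifferentiableAt (by simp)) (h2.mdifferentiableAt (by simp)) η
  rw [one_mul] at h
  refine h.symm.trans ?_
  show _ = md 𝓘(ℝ, EG) 𝓘(ℝ, EG) (fun x : G => g⁻¹ * x * g⁻¹⁻¹) 1 η
  simp only [mul_assoc, inv_inv]

/-- The Maurer-Cartan form of the group is constant on the left invariant fields of a subgroup. -/
theorem mc_md_coe_mul (hv : ContMDiff 𝓘(ℝ, EH) 𝓘(ℝ, EG) ∞ (Subtype.val : H → G)) (g : G)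
    (Y : EH) : mc EG g (md 𝓘(ℝ, EH) 𝓘(ℝ, EG) (fun h : H => g * (h : G)) 1 Y) =
      lieInclusion EG EH H Y := by
  have h1 : ContMDiff 𝓘(ℝ, EG) 𝓘(ℝ, EG) ∞ (fun x : G => g * x) := contMDiff_mul_left
  have h := md_comp_apply (g := fun x : G => g * x) (f := (Subtype.val : H → G))
    (L := 𝓘(ℝ, EG)) 1 (h1.mdifferentiableAt (by simp)) (hv.mdifferentiableAt (by simp)) Y
  exact (congrArg (mc EG g) h).trans (mc_mul_left g _)

/-- The Maurer-Cartan form of a Lie subgroup is the restriction of the one of the group. -/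
theorem mc_coe [LieGroup 𝓘(ℝ, EH) ∞ H]
    (hv : ContMDiff 𝓘(ℝ, EH) 𝓘(ℝ, EG) ∞ (Subtype.val : H → G)) (h : H) (ξ : EH) :
    mc EG (h : G) (md 𝓘(ℝ, EH) 𝓘(ℝ, EG) (Subtype.val : H → G) h ξ) =
      md 𝓘(ℝ, EH) 𝓘(ℝ, EG) (Subtype.val : H → G) 1 (mc EH h ξ) := by
  have h1 : ContMDiff 𝓘(ℝ, EG) 𝓘(ℝ, EG) ∞ (fun x : G => (h : G)⁻¹ * x) := contMDiff_mul_left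
  have h2 : ContMDiff 𝓘(ℝ, EH) 𝓘(ℝ, EH) ∞ (fun x : H => h⁻¹ * x) := contMDiff_mul_left
  have e1 := md_comp_apply (g := fun x : G => (h : G)⁻¹ * x) (f := (Subtype.val : H → G))
    (L := 𝓘(ℝ, EG)) h (h1.mdifferentiableAt (by simp)) (hv.mdifferentiableAt (by simp)) ξ
  have e2 := md_comp_apply (g := (Subtype.val : H → G)) (f := fun x : H => h⁻¹ * x)
    (L := 𝓘(ℝ, EG)) h (hv.mdifferentiableAt (by simp)) (h2.mdifferentiableAt (by simp)) ξ
  rw [inv_mul_cancel] at e2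
  exact e1.symm.trans e2

/-- The inclusion of the Lie algebra of a Lie subgroup is compatible with brackets: this follows
from the Maurer-Cartan equation, which is preserved by pullbacks. -/
theorem md_val_lieBr [LieGroup 𝓘(ℝ, EH) ∞ H]
    (hv : ContMDiff 𝓘(ℝ, EH) 𝓘(ℝ, EG) ∞ (Subtype.val : H → G)) (X Y : EH) :
    md 𝓘(ℝ, EH) 𝓘(ℝ, EG) (Subtype.val : H → G) 1 (lieBr EH H X Y) =
      lieBr EG G (md 𝓘(ℝ, EH) 𝓘(ℝ, EG) (Subtype.val : H → G) 1 X)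
        (md 𝓘(ℝ, EH) 𝓘(ℝ, EG) (Subtype.val : H → G) 1 Y) := by
  have h := extD_pullback (θ := mc EG (G := G)) (θ' := mc EH (G := H))
    (L := md 𝓘(ℝ, EH) 𝓘(ℝ, EG) (Subtype.val : H → G) 1) hv (mc_coe hv) (v := 1)
    (formDifferentiableAt_mc (G := G)) formDifferentiableAt_mc X Y
  rw [extD_mc, map_neg] at h
  exact neg_injective (h.trans (extD_mc (G := G) _ _))

end LieSubgroups

namespace CartanGeometry

variable {EG : Type*} [NormedAddCommGroup EG] [NormedSpace ℝ EG] [FiniteDimensional ℝ EG]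
  {EP : Type*} [NormedAddCommGroup EP] [NormedSpace ℝ EP] [FiniteDimensional ℝ EP]
  {EB : Type*} [NormedAddCommGroup EB] [NormedSpace ℝ EB] [FiniteDimensional ℝ EB]
  {EM : Type*} [NormedAddCommGroup EM] [NormedSpace ℝ EM] [FiniteDimensional ℝ EM]
  {G : Type*} [Group G] [TopologicalSpace G] [ChartedSpace EG G] [LieGroup 𝓘(ℝ, EG) ∞ G]
  {P : Subgroup G} [ChartedSpace EP P] [LieGroup 𝓘(ℝ, EP) ∞ P]
  {B : Type*} [TopologicalSpace B] [ChartedSpace EB B] [IsManifold 𝓘(ℝ, EB) ∞ B]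
  {M : Type*} [TopologicalSpace M] [ChartedSpace EM M] [IsManifold 𝓘(ℝ, EM) ∞ M]
  (C : CartanGeometry EG EP EB EM P B M)

theorem curvature_eq (u : B) (ξ η : EB) :
    (C.curvature u ξ η : EG) = extD C.om u ξ η + lieBr EG G (C.om u ξ) (C.om u η) := rfl

theorem formDifferentiableAt_om (u : B) : FormDifferentiableAt C.om u :=
  formDifferentiableAt_of_contMDiff C.smooth_form u

/-- The curvature is horizontal. The derivative of the Cartan connection along a fundamental field
and the derivative of the Maurer-Cartan form along a left invariant field are given by the same
expression in the adjoint action, hence the Maurer-Cartan equation gives the claim. -/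
theorem curvature_fundamental (hv : ContMDiff 𝓘(ℝ, EP) 𝓘(ℝ, EG) ∞ (Subtype.val : P → G))
    (u : B) (Y : EP) (η : EB) :
    (C.curvature u (md 𝓘(ℝ, EP) 𝓘(ℝ, EB) (C.act u) 1 Y) η : EG) = 0 := by
  obtain ⟨T, p, hT, h0T, hp, hp0, hpd⟩ :=
    exists_contMDiffOn_md_eq (0 : ℝ) (1 : P) (ContinuousLinearMap.toSpanSingleton ℝ Y)
  have hpY : md 𝓘(ℝ, ℝ) 𝓘(ℝ, EP) p 0 1 = Y := by rw [hpd]; simp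
  have hX : C.om u (md 𝓘(ℝ, EP) 𝓘(ℝ, EB) (C.act u) 1 Y) = lieInclusion EG EP P Y :=
    C.om_fundamental u Y
  have h1 := extD_fundamental (θ := C.om) (A := C.act) C.contMDiff_act C.act_one
    (C.formDifferentiableAt_om u) hT h0T hp hp0 (X := lieInclusion EG EP P Y)
    (fun u' => by rw [hpY]; exact C.om_fundamental u' Y) η
  have hA : ContMDiff (𝓘(ℝ, EG).prod 𝓘(ℝ, EP)) 𝓘(ℝ, EG) ∞
      (fun z : G × P => z.1 * (z.2 : G)) := contMDiff_fst.mul (hv.comp contMDiff_snd)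
  have h2 := extD_fundamental (θ := mc EG) (A := fun (g : G) (q : P) => g * (q : G)) hA
    (fun g => by simp) formDifferentiableAt_mc hT h0T hp hp0 (X := lieInclusion EG EP P Y)
    (fun g => by rw [hpY]; exact mc_md_coe_mul hv g Y) (C.om u η)
  rw [hpY] at h1 h2
  have h3 : ∀ t, C.om (C.act u (p t)) (md 𝓘(ℝ, EB) 𝓘(ℝ, EB) (fun u' => C.act u' (p t)) u η) =
      mc EG (1 * (p t : G)) (md 𝓘(ℝ, EG) 𝓘(ℝ, EG) (fun x : G => x * (p t : G)) 1 (C.om u η)) := by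
    intro t
    rw [one_mul, mc_md_mul_right]
    exact C.om_act u (p t) η
  have h4 : extD C.om u (md 𝓘(ℝ, EP) 𝓘(ℝ, EB) (C.act u) 1 Y) η =
      extD (mc EG) (1 : G) (lieInclusion EG EP P Y) (C.om u η) := by
    have h5 : md 𝓘(ℝ, EP) 𝓘(ℝ, EG) (fun q : P => (1 : G) * (q : G)) 1 Y =
        lieInclusion EG EP P Y := by
      simp only [one_mul]; rfl
    rw [h5] at h2
    exact (h1.trans (congrArg (fun f : ℝ → EG => deriv f 0) (funext h3))).trans h2.symm
  rw [curvature_eq, h4, hX]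
  exact (congrArg (· + _) (extD_mc (G := G) _ _)).trans (neg_add_cancel _)

end CartanGeometry

namespace InducedGeometry

variable {EG : Type*} [NormedAddCommGroup EG] [NormedSpace ℝ EG] [FiniteDimensional ℝ EG]
  {EP : Type*} [NormedAddCommGroup EP] [NormedSpace ℝ EP] [FiniteDimensional ℝ EP]
  {EB : Type*} [NormedAddCommGroup EB] [NormedSpace ℝ EB] [FiniteDimensional ℝ EB]
  {EM : Type*} [NormedAddCommGroup EM] [NormedSpace ℝ EM] [FiniteDimensional ℝ EM]
  {EO : Type*} [NormedAddCommGroup EO] [NormedSpace ℝ EO] [FiniteDimensional ℝ EO]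
  {G : Type*} [Group G] [TopologicalSpace G] [ChartedSpace EG G] [LieGroup 𝓘(ℝ, EG) ∞ G]
  {P : Subgroup G} [ChartedSpace EP P] [LieGroup 𝓘(ℝ, EP) ∞ P]
  {B : Type*} [TopologicalSpace B] [ChartedSpace EB B] [IsManifold 𝓘(ℝ, EB) ∞ B]
  {M : Type*} [TopologicalSpace M] [ChartedSpace EM M] [IsManifold 𝓘(ℝ, EM) ∞ M]
  {O : Type*} [MulAction G O]
  {C : CartanGeometry EG EP EB EM P B M} {s : B → O} {S : Set M}
  {N : InitialSubmanifold (EM := EM) S} {α : O}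

/-- The curvature of the induced geometry is the pullback of the ambient curvature. -/
theorem lie_curvature (D : InducedGeometry C s N α) (v : D.Total)
    (ξ η : EuclideanSpace ℝ (Fin D.dimTotal)) :
    D.lie (D.geom.curvature v ξ η) = C.curvature (D.incl v) (md (𝓡 D.dimTotal) 𝓘(ℝ, EB) D.incl v ξ)
      (md (𝓡 D.dimTotal) 𝓘(ℝ, EB) D.incl v η) := by
  have := D.lieH.lieGroup
  have := D.lieP.lieGroup
  have h := extD_pullback (θ := C.om) (θ' := D.geom.om) (L := D.lie) D.contMDiff_incl D.om_incl
    (v := v) (C.formDifferentiableAt_om _) (D.geom.formDifferentiableAt_om v) ξ η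
  have hbr := md_val_lieBr D.lieH.isSmoothEmbedding.contMDiff (D.geom.om v ξ) (D.geom.om v η)
  refine (D.lie.map_add (extD D.geom.om v ξ η) (lieBr _ _ (D.geom.om v ξ) (D.geom.om v η))).trans ?_
  refine Eq.trans ?_ (C.curvature_eq _ _ _).symm
  rw [h, D.om_incl, D.om_incl]
  exact congrArg _ hbr

/-- The inverses of the Cartan connections correspond to each other under the embedding. -/
theorem formInv_incl (D : InducedGeometry C s N α) (v : D.Total)
    (X : EuclideanSpace ℝ (Fin D.dimH)) :
    C.formInv (D.incl v) (D.lie X) =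
      md (𝓡 D.dimTotal) 𝓘(ℝ, EB) D.incl v (D.geom.formInv v X) := by
  have h1 : ∀ Z : EG, C.om (D.incl v) (C.formInv (D.incl v) Z) = Z := fun Z =>
    (LinearEquiv.ofBijective (C.form (D.incl v)).toLinearMap
      (C.form_bijective (D.incl v))).apply_symm_apply Z
  have h2 : D.geom.om v (D.geom.formInv v X) = X :=
    (LinearEquiv.ofBijective (D.geom.form v).toLinearMap
      (D.geom.form_bijective v)).apply_symm_apply X
  exact (C.om_bijective _).1 ((h1 _).trans ((congrArg D.lie h2).symm.trans (D.om_incl v _).symm))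

/-- The curvature functions correspond to each other under the embedding. -/
theorem curvatureFunction_lie (D : InducedGeometry C s N α) (v : D.Total)
    (X Y : EuclideanSpace ℝ (Fin D.dimH)) :
    C.curvatureFunction (D.incl v) (D.lie X) (D.lie Y) =
      D.lie (D.geom.curvatureFunction v X Y) := by
  refine Eq.trans ?_ (D.lie_curvature v _ _).symm
  show C.curvature _ (C.formInv (D.incl v) (D.lie X)) (C.formInv (D.incl v) (D.lie Y)) = _
  rw [D.formInv_incl, D.formInv_incl]

end InducedGeometry

namespace CartanGeometry

variable {EG : Type*} [NormedAddCommGroup EG] [NormedSpace ℝ EG] [FiniteDimensional ℝ EG]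
  {EP : Type*} [NormedAddCommGroup EP] [NormedSpace ℝ EP] [FiniteDimensional ℝ EP]
  {EB : Type*} [NormedAddCommGroup EB] [NormedSpace ℝ EB] [FiniteDimensional ℝ EB]
  {EM : Type*} [NormedAddCommGroup EM] [NormedSpace ℝ EM] [FiniteDimensional ℝ EM]
  {G : Type*} [Group G] [TopologicalSpace G] [ChartedSpace EG G] [LieGroup 𝓘(ℝ, EG) ∞ G]
  {P : Subgroup G} [ChartedSpace EP P] [LieGroup 𝓘(ℝ, EP) ∞ P]
  {B : Type*} [TopologicalSpace B] [ChartedSpace EB B] [IsManifold 𝓘(ℝ, EB) ∞ B]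
  {M : Type*} [TopologicalSpace M] [ChartedSpace EM M] [IsManifold 𝓘(ℝ, EM) ∞ M]
  (C : CartanGeometry EG EP EB EM P B M)

/-- The curvature function descends to the quotient by the Lie algebra of `P`. -/
theorem curvatureFunction_eq_zero
    (hv : ContMDiff 𝓘(ℝ, EP) 𝓘(ℝ, EG) ∞ (Subtype.val : P → G)) (u : B) {X : EG}
    (hX : X ∈ range (lieInclusion EG EP P)) (Y : EG) : (C.curvatureFunction u X Y : EG) = 0 := by
  obtain ⟨Z, rfl⟩ := hX
  have h : C.formInv u (lieInclusion EG EP P Z) = md 𝓘(ℝ, EP) 𝓘(ℝ, EB) (C.act u) 1 Z :=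
    (C.om_bijective u).1 (((LinearEquiv.ofBijective (C.form u).toLinearMap
      (C.form_bijective u)).apply_symm_apply _).trans (C.om_fundamental u Z).symm)
  refine Eq.trans ?_ (C.curvature_fundamental hv u Z (C.formInv u Y))
  exact congrArg (fun ξ : EB => C.curvature u ξ (C.formInv u Y)) h

end CartanGeometry

section TorsionFree

variable {EG : Type*} [NormedAddCommGroup EG] [NormedSpace ℝ EG] [FiniteDimensional ℝ EG]
  {EP : Type*} [NormedAddCommGroup EP] [NormedSpace ℝ EP] [FiniteDimensional ℝ EP]
  {G : Type*} [Group G] [TopologicalSpace G] [ChartedSpace EG G] [LieGroup 𝓘(ℝ, EG) ∞ G]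
  {O : Type*} [TopologicalSpace O] [MulAction G O]
  {P : Subgroup G} [ChartedSpace EP P] {α : O} {k l : ℕ}
  [ChartedSpace (EuclideanSpace ℝ (Fin k)) (MulAction.stabilizer G α)]
  [ChartedSpace (EuclideanSpace ℝ (Fin l)) (stabP P α)]

/-- The Lie algebra of `P_α = G_α ∩ P` is the intersection of the Lie algebras of `G_α`
and `P`. -/
theorem mem_range_lieInclusion_stabP
    (EO : Type*) [NormedAddCommGroup EO] [NormedSpace ℝ EO] [FiniteDimensional ℝ EO]
    [ChartedSpace EO O] [IsManifold 𝓘(ℝ, EO) ∞ O] [ContMDiffSMul 𝓘(ℝ, EG) 𝓘(ℝ, EO) ∞ G O]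
    (hP : IsClosedLieSubgroup EG EP P)
    (hH : IsClosedLieSubgroup EG (EuclideanSpace ℝ (Fin k)) (MulAction.stabilizer G α))
    (hl : IsClosedLieSubgroup (EuclideanSpace ℝ (Fin k)) (EuclideanSpace ℝ (Fin l)) (stabP P α))
    {w : EuclideanSpace ℝ (Fin k)}
    (hw : lieInclusion EG (EuclideanSpace ℝ (Fin k)) (MulAction.stabilizer G α) w ∈
      range (lieInclusion EG EP P)) :
    w ∈ range (lieInclusion (EuclideanSpace ℝ (Fin k)) (EuclideanSpace ℝ (Fin l))
      (stabP P α)) := by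
  have := hP.lieGroup
  have := hH.lieGroup
  have := hl.lieGroup
  have hv := hP.isSmoothEmbedding.contMDiff
  have hHv := hH.isSmoothEmbedding.contMDiff
  have hlv := hl.isSmoothEmbedding.contMDiff
  have : ContMDiffSMul 𝓘(ℝ, EP) 𝓘(ℝ, EO) ∞ P O := contMDiffSMul_subgroup hv
  obtain ⟨Y, hY⟩ : ∃ Y : EP, md 𝓘(ℝ, EP) 𝓘(ℝ, EG) (Subtype.val : P → G) 1 Y =
    md (𝓡 k) 𝓘(ℝ, EG) (Subtype.val : MulAction.stabilizer G α → G) 1 w := hw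
  have hY0 : md 𝓘(ℝ, EP) 𝓘(ℝ, EO) (fun p : P => p • α) 1 Y = 0 := by
    rw [md_orbitMap_subgroup hv, hY, ← md_orbitMap_subgroup hHv]
    have : (fun h : MulAction.stabilizer G α => h • α) = fun _ => α := funext fun h => h.2
    rw [this, md_const]; rfl
  obtain ⟨A⟩ := exists_submanifoldAtlas_stabP EO EP P α
  obtain ⟨z, hz⟩ := exists_md_param_stabP_eq (EP := EP) (EO := EO) P α A hY0
  -- the parametrization is smooth for the given manifold structure on `P_α`
  have hc := A.contMDiffOn_param 1
  have hm := A.mem_target 1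
  have hpc := A.param_chart 1
  have ho := (A.chart 1).open_target
  have hcG := hv.comp_contMDiffOn hc
  have hcH := contMDiffOn_of_isImmersion_of_isInducing hH.isSmoothEmbedding.isImmersion
    hH.isSmoothEmbedding.isEmbedding.isInducing
    (f := fun z => ((A.param 1 z : stabP P α) : MulAction.stabilizer G α)) ho hcG
  have hcl := contMDiffOn_of_isImmersion_of_isInducing hl.isSmoothEmbedding.isImmersion
    hl.isSmoothEmbedding.isEmbedding.isInducing (f := fun z => A.param 1 z) ho hcH
  have e1 := md_comp_apply (g := (Subtype.val : P → G)) (f := fun z => stabPIncl P α (A.param 1 z))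
    (L := 𝓘(ℝ, EG)) (A.chart 1 1) (hv.mdifferentiableAt (by simp))
    (ContMDiffOn.mdiffAt hc ho hm) z
  have e2 := md_comp_apply (g := (Subtype.val : MulAction.stabilizer G α → G))
    (f := fun z => ((A.param 1 z : stabP P α) : MulAction.stabilizer G α))
    (L := 𝓘(ℝ, EG)) (A.chart 1 1) (hHv.mdifferentiableAt (by simp))
    (ContMDiffOn.mdiffAt hcH ho hm) z
  have e3 := md_comp_apply (g := (Subtype.val : stabP P α → MulAction.stabilizer G α))
    (f := fun z => A.param 1 z) (L := 𝓡 k) (A.chart 1 1) (hlv.mdifferentiableAt (by simp))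
    (ContMDiffOn.mdiffAt hcl ho hm) z
  rw [hz, hpc] at e1
  rw [hpc] at e2 e3
  refine ⟨_, e3.symm.trans ?_⟩
  exact injective_md_of_isImmersion hH.isSmoothEmbedding.isImmersion 1
    (e2.symm.trans (e1.trans hY))

end TorsionFree

end CurvedOrbit

end

theorem mainTheorem1
    {EG : Type*} [NormedAddCommGroup EG] [NormedSpace ℝ EG] [FiniteDimensional ℝ EG]
    {EP : Type*} [NormedAddCommGroup EP] [NormedSpace ℝ EP] [FiniteDimensional ℝ EP]
    {EB : Type*} [NormedAddCommGroup EB] [NormedSpace ℝ EB] [FiniteDimensional ℝ EB]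
    {EM : Type*} [NormedAddCommGroup EM] [NormedSpace ℝ EM] [FiniteDimensional ℝ EM]
    {EO : Type*} [NormedAddCommGroup EO] [NormedSpace ℝ EO] [FiniteDimensional ℝ EO]
    -- the Lie group `G` and its closed subgroup `P`
    {G : Type*} [Group G] [TopologicalSpace G] [ChartedSpace EG G] [LieGroup 𝓘(ℝ, EG) ∞ G]
    [T2Space G] [SecondCountableTopology G]
    (P : Subgroup G) [ChartedSpace EP P] (hP : IsClosedLieSubgroup EG EP P)
    -- the manifold `M` and the total space `B` of the Cartan bundle
    {M : Type*} [TopologicalSpace M] [ChartedSpace EM M] [IsManifold 𝓘(ℝ, EM) ∞ M]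
    [T2Space M] [SecondCountableTopology M]
    {B : Type*} [TopologicalSpace B] [ChartedSpace EB B] [IsManifold 𝓘(ℝ, EB) ∞ B]
    [T2Space B] [SecondCountableTopology B]
    -- the homogeneous space `O` of `G`
    {O : Type*} [TopologicalSpace O] [ChartedSpace EO O] [IsManifold 𝓘(ℝ, EO) ∞ O]
    [T2Space O] [SecondCountableTopology O]
    [MulAction G O] [ContMDiffSMul 𝓘(ℝ, EG) 𝓘(ℝ, EO) ∞ G O] [MulAction.IsPretransitive G O]
    -- the Cartan geometry, the holonomy reduction and the `P`-orbit `i`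
    (C : CartanGeometry EG EP EB EM P B M) (s : B → O) (hs : C.HolonomyReduction (EO := EO) s)
    (i : Set O) (hi : ∃ α : O, i = MulAction.orbit P α) (hne : (C.curvedOrbit s i).Nonempty) :
    -- (i) local form of the curved orbit, for the smooth structure of `G ⧸ P`
    (∃ (d : ℕ) (_ : ChartedSpace (EuclideanSpace ℝ (Fin d)) (G ⧸ P)),
      IsManifold (𝓡 d) ∞ (G ⧸ P) ∧
      Manifold.IsSubmersion 𝓘(ℝ, EG) (𝓡 d) ∞ (fun g : G => (g : G ⧸ P)) ∧
      ∀ α ∈ i, ∀ x ∈ C.curvedOrbit s i, ∃ φ : OpenPartialHomeomorph M (G ⧸ P),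
        x ∈ φ.source ∧ φ x = ((1 : G) : G ⧸ P) ∧
        ContMDiffOn 𝓘(ℝ, EM) (𝓡 d) ∞ φ φ.source ∧
        ContMDiffOn (𝓡 d) 𝓘(ℝ, EM) ∞ φ.symm φ.target ∧
        φ '' (C.curvedOrbit s i ∩ φ.source) =
          MulAction.orbit (MulAction.stabilizer G α) ((1 : G) : G ⧸ P) ∩ φ.target) ∧
    -- the curved orbit is an initial submanifold
    Nonempty (InitialSubmanifold (EM := EM) (C.curvedOrbit s i)) ∧
    ∀ N : InitialSubmanifold (EM := EM) (C.curvedOrbit s i),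
      -- (ii) the induced Cartan geometries, and their independence of the representative `α`
      (∀ α ∈ i, Nonempty (InducedGeometry C s N α)) ∧
      (∀ α ∈ i, ∀ (b : P) (D : InducedGeometry C s N α)
        (D' : InducedGeometry C s N ((b : G) • α)), ∃ Ψ, D.IsTranslate b D' Ψ) ∧
      -- (iii) the curvature of the induced geometries
      ∀ α ∈ i, ∀ D : InducedGeometry C s N α,
        (∀ v (ξ η : TangentSpace (𝓡 D.dimTotal) v),
          D.lieIncl (D.geom.curvature v ξ η) =
            C.curvature (D.incl v) (D.tangentIncl v ξ) (D.tangentIncl v η)) ∧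
        (C.TorsionFree → D.geom.TorsionFree) ∧
        (∀ v (X Y : GroupLieAlgebra (𝓡 D.dimH) (MulAction.stabilizer G α)),
          C.curvatureFunction (D.incl v) (D.lieIncl X) (D.lieIncl Y) =
            D.lieIncl (D.geom.curvatureFunction v X Y) ∧
          (D.lieIncl X ∈ range (lieInclusion EG EP P) →
            C.curvatureFunction (D.incl v) (D.lieIncl X) (D.lieIncl Y) = 0)) := by
  have := hP.lieGroup
  have hv := hP.isSmoothEmbedding.contMDiff
  have : ContMDiffSMul 𝓘(ℝ, EP) 𝓘(ℝ, EO) ∞ P O := contMDiffSMul_subgroup hv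
  have heq := hs.equivariant
  have hiα : ∀ α ∈ i, i = MulAction.orbit P α := by
    obtain ⟨β, rfl⟩ := hi
    exact fun α hα => (MulAction.orbit_eq_iff.2 hα).symm
  -- `M_i` is the set of points over which `s` takes the value `α`, for each `α ∈ i`
  have hS : ∀ α ∈ i, ∀ x, x ∈ C.curvedOrbit s i ↔ ∃ u, C.proj u = x ∧ s u = α :=
    fun α hα x => C.mem_curvedOrbit_iff heq (hiα α hα)
  refine ⟨?_, ?_, fun N => ⟨fun α hα => hs.nonempty_inducedGeometry hP N (hS α hα),
    fun α _ b D D' => D.exists_isTranslate heq b D', fun α hα D => ⟨D.lie_curvature, ?_, ?_⟩⟩⟩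
  · obtain ⟨d, hd⟩ : ∃ d, d = Module.finrank ℝ EG - Module.finrank ℝ EP := ⟨_, rfl⟩
    obtain ⟨Z⟩ : Nonempty (CosetSlice EG P d) := hd ▸ exists_cosetSlice hP
    refine ⟨d, Z.chartedSpace, Z.isManifold, Z.isSubmersion_mk, fun α hα x hx => ?_⟩
    obtain ⟨u, rfl, hu⟩ := (hS α hα x).1 hx
    obtain ⟨φ, h1, h2, h3, h4⟩ := hs.exists_local_form hP Z hd hu
    refine ⟨φ, h1, h2, h3.1, h3.2, ?_⟩
    rwa [show C.curvedOrbit s i = {x | ∃ u, C.proj u = x ∧ s u = α} from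
      Set.ext (hS α hα)]
  · obtain ⟨α, hα⟩ := hi
    exact hs.nonempty_initialSubmanifold (hS α (hα ▸ MulAction.mem_orbit_self α))
  · intro hC v ξ η
    refine mem_range_lieInclusion_stabP EO hP D.lieH D.lieP ?_
    have h := D.lie_curvature v ξ η
    rw [show lieInclusion EG _ _ _ = _ from h]
    exact hC _ _ _
  · exact fun v X Y => ⟨D.curvatureFunction_lie v X Y,
      fun hX => C.curvatureFunction_eq_zero hv (D.incl v) hX _⟩
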